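/- **Setting.** Let $Q=M_1+\dots+M_k\subset\mathbb{R}^n$ ($k\ge 1$, $\dim Q=n$) be an admissible Minkowski decomposition: each $M_p$ is a lattice polytope with the origin as a vertex, whose non-zero vertices $v_{p,1},\dots,v_{p,m_p}$ are part of a $\mathbb{Z}$-basis of $\mathbb{Z}^n$. For each $p$ let $V_p$ be the matrix with rows $v_{p,j}$, choose $E_p$ such that the rows of $X_p=\binom{V_p}{E_p}$ form a basis of $\mathbb{Z}^n$, and write $X_p^{-1}=(A_p\;\,C_p)$, where $A_p$ has columns $a_{p,1},\dots,a_{p,m_p}$ and $C_p$ has columns $c_{p,1},\dots,c_{p,n-m_p}$; put $b_p=-\sum_j a_{p,j}$. For $v\in\mathbb{Z}^n$ let $\phi(v)=\sum_{i=1}^k\max\langle v,-M_i\rangle\, e_i\in\mathbb{Z}^k$. Let $\widetilde\sigma\subset\mathbb{R}^n\times\mathbb{R}^k$ be the cone generated by $\bigcup_i (M_i\cap\mathbb{Z}^n)\times\{e_i\}$, let $\mathscr{H}$ be the Hilbert basis of $\widetilde\sigma^\vee\cap\mathbb{Z}^{n+k}$, and let $\mathscr{A}$ be the finite set consisting of all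 $(0,e_i)$, all $(v,\phi(v))$ with $(v,w)\in\mathscr{H}$ for some $w$ and $v\neq 0$, and all $(u,\phi(u))$ with $u\in\{a_{p,j},\,b_p,\,c_{p,l},\,-c_{p,l}\}$. Let $Y_{\widetilde\sigma}\subset\mathbb{C}^{\mathscr{A}}$ be the Zariski closure of the image of $(\mathbb{C}^*)^{n+k}$ under the characters in $\mathscr{A}$. Write $\chi^q$ for the coordinate with index $q\in\mathscr{A}$, and $t_i=\chi^{(0,e_i)}$, $x_{p,j}=\chi^{(a_{p,j},\phi(a_{p,j}))}$, $w^+_{p,l}=\chi^{(c_{p,l},\phi(c_{p,l}))}$, $y_p=\chi^{(b_p,\phi(b_p))}$. Let $\epsilon_1=0,\epsilon_2,\dots,\epsilon_k\in\mathbb{C}$ be pairwise distinct and all different from $1$, and put $$Y_{\widetilde\sigma,\epsilon}=\{z\in Y_{\widetilde\sigma} : t_1-t_i=\epsilon_i,\ i=1,\dots,k\},$$ with the restriction of the standard symplectic form of $\mathbb{C}^{\mathscr{A}}$. For $r>0$ and $\delta\in\mathbb{R}^n$ let $$T_{\gamma(r),\delta}=\Big\{z\in Y_{\widetilde\sigma,\epsilon}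 : |t_1-1|=r,\ \sum_{q\in\mathscr{A}}q_a\,|\chi^q|^2=\delta_a \text{ for } a=1,\dots,n\Big\},$$ and let $S$ be the set of points of $Y_{\widetilde\sigma,\epsilon}$ at which, for some $p$, one has $t_1=\epsilon_p$ and at least two of $y_p,x_{p,1},\dots,x_{p,m_p}$ vanish. **Proposition.** The set $Y_{\widetilde\sigma,\epsilon}\setminus\{t_1=1\}$ is a complex submanifold of $\mathbb{C}^{\mathscr{A}}$ of dimension $n+1$, and on it there is a nowhere vanishing holomorphic $(n+1)$-form $\Omega$ which is given by $$\Omega=i^{\,n+1}\,\frac{dx_{1,1}\wedge\dots\wedge dx_{1,m_1}\wedge dw^+_{1,1}\wedge\dots\wedge dw^+_{1,n-m_1}\wedge dt_1}{(t_1-1)\prod_j x_{1,j}\prod_l w^+_{1,l}}$$ wherever the denominator does not vanish, and such that for all $r>0$ and all $\delta\in\mathbb{R}^n$: 1. if $|\epsilon_p-1|\neq r$ for all $p$, then $T_{\gamma(r),\delta}$ is a smoothly embedded $(n+1)$-dimensional torus and is special Lagrangian in $Y_{\widetilde\sigma,\epsilon}\setminus\{t_1=1\}$ with respect to $\Omega$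 with phase $0$, that is, it is a Lagrangian submanifold and $\operatorname{Im}\Omega$ restricts to $0$ on it; 2. in general, $T_{\gamma(r),\delta}\setminus S$ is a special Lagrangian submanifold of $Y_{\widetilde\sigma,\epsilon}\setminus\{t_1=1\}$ with respect to $\Omega$ with phase $0$; in particular so is $T_{\gamma(r),\delta}$ itself whenever it does not meet $S$. -/

import Mathlib

open scoped Pointwise ContDiff Topology

noncomputable section

/-! ### Submanifolds, holomorphic volume forms and special Lagrangians in a complex vector space -/

section Geometry

variable {ι : Type*} [Fintype ι]

/-- `φ` is a smooth (over `ℝ`) or holomorphic (over `ℂ`) local parametrization of the subset `S`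
at `z`, defined near `0 ∈ 𝕜 ^ d`: an immersion which carries the neighbourhoods of `0` to the
neighbourhoods of `z` in `S`.  The tangent space of `S` at `z` is then the range of
`fderiv 𝕜 φ 0`. -/
structure IsLocalParam (𝕜 : Type*) [RCLike 𝕜] [NormedSpace 𝕜 (ι → ℂ)] (d : ℕ)
    (S : Set (ι → ℂ)) (z : ι → ℂ) (φ : (Fin d → 𝕜) → (ι → ℂ)) : Prop where
  map_zero : φ 0 = z
  smooth : ∀ᶠ s in 𝓝 0, ContDiffAt 𝕜 ∞ φ s
  immersive : Function.Injective (fderiv 𝕜 φ 0)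
  map_nhds : Filter.map φ (𝓝 0) = 𝓝[S] z

/-- `S` is an embedded submanifold of `ℂ ^ ι` of dimension `d` over `𝕜`. -/
def IsEmbeddedSubmanifold (𝕜 : Type*) [RCLike 𝕜] [NormedSpace 𝕜 (ι → ℂ)] (d : ℕ)
    (S : Set (ι → ℂ)) : Prop :=
  ∀ z ∈ S, ∃ φ, IsLocalParam 𝕜 d S z φ

/-- `X` is a complex submanifold of dimension `d`, and `Ω` restricts to a nowhere vanishing
holomorphic `d`-form on `X`: in every holomorphic parametrization `φ`, the coefficient of the
pull-back `φ^* Ω` with respect to `ds₁ ∧ … ∧ ds_d` is holomorphic and non-zero.  (Only the values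
of `Ω z` on the tangent vectors of `X` at `z ∈ X` matter.) -/
def IsHolomorphicVolumeForm (d : ℕ) (X : Set (ι → ℂ))
    (Ω : (ι → ℂ) → ((ι → ℂ) [⋀^Fin d]→ₗ[ℂ] ℂ)) : Prop :=
  IsEmbeddedSubmanifold ℂ d X ∧
  ∀ z ∈ X, ∀ φ : (Fin d → ℂ) → (ι → ℂ), IsLocalParam ℂ d X z φ →
    AnalyticAt ℂ (fun s => Ω (φ s) (fun j => fderiv ℂ φ s (Pi.single j 1))) 0 ∧
    Ω (φ 0) (fun j => fderiv ℂ φ 0 (Pi.single j 1)) ≠ 0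

/-- The standard symplectic form `(i / 2) ∑ dz_q ∧ dz̄_q` of `ℂ ^ ι`. -/
def stdSymplectic (u v : ι → ℂ) : ℝ :=
  ∑ q, (starRingEnd ℂ (u q) * v q).im

/-- `L` is a Lagrangian submanifold of the `d`-dimensional complex submanifold `X` of `ℂ ^ ι`, where
`X` carries the restriction of the standard symplectic form. -/
structure IsLagrangian (d : ℕ) (X L : Set (ι → ℂ)) : Prop where
  subset : L ⊆ X
  submanifold : IsEmbeddedSubmanifold ℝ d L
  isotropic : ∀ z ∈ L, ∀ φ : (Fin d → ℝ) → (ι → ℂ), IsLocalParam ℝ d L z φ →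
    ∀ u v : Fin d → ℝ, stdSymplectic (fderiv ℝ φ 0 u) (fderiv ℝ φ 0 v) = 0

/-- `L` is a special Lagrangian submanifold of `X` with phase `θ`, with respect to the `d`-form
`Ω`: it is Lagrangian, and `Im (e^{-iθ} Ω)` vanishes on all tangent vectors of `L`. -/
structure IsSpecialLagrangian (d : ℕ) (X : Set (ι → ℂ))
    (Ω : (ι → ℂ) → ((ι → ℂ) [⋀^Fin d]→ₗ[ℂ] ℂ)) (θ : ℝ) (L : Set (ι → ℂ)) : Prop
    extends IsLagrangian d X L where
  special : ∀ z ∈ L, ∀ φ : (Fin d → ℝ) → (ι → ℂ), IsLocalParam ℝ d L z φ →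
    ∀ u : Fin d → (Fin d → ℝ),
      (Complex.exp (-(Complex.I * θ)) * Ω z (fun j => fderiv ℝ φ 0 (u j))).im = 0

/-- `L` is a smoothly embedded `d`-dimensional torus `(ℝ / 2πℤ) ^ d`: the image of a smooth
immersion of `ℝ ^ d` whose fibres are the cosets of `(2πℤ) ^ d`. -/
def IsEmbeddedTorus (d : ℕ) (L : Set (ι → ℂ)) : Prop :=
  ∃ Φ : (Fin d → ℝ) → (ι → ℂ), ContDiff ℝ ∞ Φ ∧
    (∀ s, Function.Injective (fderiv ℝ Φ s)) ∧
    (∀ s s', Φ s = Φ s' ↔ ∃ p : Fin d → ℤ, ∀ j, s j - s' j = 2 * Real.pi * p j) ∧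
    Set.range Φ = L

end Geometry

/-! ### Admissible Minkowski decompositions -/

/-- The origin and the first `m` rows of the integer matrix `X`. -/
def simplexVertices {n : ℕ} (m : ℕ) (X : Matrix (Fin n) (Fin n) ℤ) : Finset (Fin n → ℤ) :=
  insert 0 ((Finset.univ.filter fun j : Fin n => j.val < m).image fun j => X j)

/-- The lattice polytope whose vertices are the origin and the first `m` rows of `X`. -/
def latticeSimplex {n : ℕ} (m : ℕ) (X : Matrix (Fin n) (Fin n) ℤ) : Set (Fin n → ℝ) :=
  convexHull ℝ ((fun (v : Fin n → ℤ) (a : Fin n) => (v a : ℝ)) '' simplexVertices m X)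

/-- An admissible Minkowski decomposition `Q = M₁ + ⋯ + M_k` of an `n`-dimensional lattice polytope
`Q ⊆ ℝ ^ n`, together with a choice of the matrices associated with it.  Here `m i` is the number
of non-zero vertices of `M_i`; they are the first `m i` rows of `X i` (the block `V_i`), and the
other rows (the block `E_i`) complete them to a basis of `ℤ ^ n`. -/
structure AdmissibleDecomposition (n k : ℕ) where
  m : Fin k → ℕ
  m_le : ∀ i, m i ≤ n
  X : Fin k → Matrix (Fin n) (Fin n) ℤ
  isUnit_det : ∀ i, IsUnit (X i).det
  full_dim : affineSpan ℝ (∑ i, latticeSimplex (m i) (X i)) = ⊤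

namespace AdmissibleDecomposition

variable {n k : ℕ} (D : AdmissibleDecomposition n k)

/-- The `i`-th summand `M_i`. -/
def M (i : Fin k) : Set (Fin n → ℝ) := latticeSimplex (D.m i) (D.X i)

/-- The function `φ(v) = ∑ i, max ⟨v, -M_i⟩ e_i`; the maximum over `M_i` is the one over the
vertices, see `isGreatest_phi`. -/
def phi (v : Fin n → ℤ) : Fin k → ℤ := fun i =>
  (simplexVertices (D.m i) (D.X i)).sup' ⟨0, Finset.mem_insert_self _ _⟩ fun q => -(v ⬝ᵥ q)

/-- The cone generated by the `(q, e_i)` with `q ∈ M_i ∩ ℤ ^ n`. -/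
def sigmaTilde : PointedCone ℝ ((Fin n → ℝ) × (Fin k → ℝ)) :=
  PointedCone.hull ℝ (⋃ i : Fin k, {x | x.1 ∈ D.M i ∧
    (∃ q : Fin n → ℤ, x.1 = fun a => (q a : ℝ)) ∧ x.2 = Pi.single i 1})

/-- The lattice points of the dual cone of `sigmaTilde`. -/
def dualSemigroup : Set ((Fin n → ℤ) × (Fin k → ℤ)) :=
  {u | ∀ x ∈ D.sigmaTilde,
    0 ≤ (fun a => (u.1 a : ℝ)) ⬝ᵥ x.1 + (fun i => (u.2 i : ℝ)) ⬝ᵥ x.2}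

/-- The Hilbert basis: the irreducible elements of the semigroup. -/
def hilbertBasis : Set ((Fin n → ℤ) × (Fin k → ℤ)) :=
  {u | u ∈ D.dualSemigroup ∧ u ≠ 0 ∧
    ∀ a ∈ D.dualSemigroup, ∀ b ∈ D.dualSemigroup, u = a + b → a = 0 ∨ b = 0}

/-- The vector `(v, φ(v))`. -/
def tilde (v : Fin n → ℤ) : (Fin n → ℤ) × (Fin k → ℤ) := (v, D.phi v)

/-- The columns of `Z_p = X_p⁻¹`: the columns `a_{p,j}` of `A_p` for `j < m p`, followed by the
columns `c_{p,l}` of `C_p`. -/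
def zcol (p : Fin k) (j : Fin n) : Fin n → ℤ := fun a => (D.X p)⁻¹ a j

/-- The vector `b_p = - ∑ j, a_{p,j}`. -/
def b (p : Fin k) : Fin n → ℤ := -∑ j with j.val < D.m p, D.zcol p j

/-- The set of generators of the semigroup. -/
def genSet : Set ((Fin n → ℤ) × (Fin k → ℤ)) :=
  {u | ∃ i : Fin k, u = (0, Pi.single i 1)} ∪
  {u | ∃ v w, (v, w) ∈ D.hilbertBasis ∧ v ≠ 0 ∧ u = D.tilde v} ∪
  {u | ∃ p j, u = D.tilde (D.zcol p j)} ∪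
  {u | ∃ p, u = D.tilde (D.b p)} ∪
  {u | ∃ p, ∃ j : Fin n, D.m p ≤ j.val ∧ u = D.tilde (-D.zcol p j)}

/-! #### Finiteness of the set of generators -/

theorem neg_dot_le_phi (v : Fin n → ℤ) (i : Fin k) {q : Fin n → ℝ} (hq : q ∈ D.M i) :
    -((fun a => (v a : ℝ)) ⬝ᵥ q) ≤ (D.phi v i : ℝ) := by
  have hconv : Convex ℝ {q : Fin n → ℝ | -((fun a => (v a : ℝ)) ⬝ᵥ q) ≤ (D.phi v i : ℝ)} := by
    intro x hx y hy s t hs ht hst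
    simp only [Set.mem_ofPred_eq, dotProduct_add, dotProduct_smul, smul_eq_mul] at *
    have h : (D.phi v i : ℝ) = s * D.phi v i + t * D.phi v i := by rw [← add_mul, hst, one_mul]
    have h1 := mul_le_mul_of_nonneg_left hx hs
    have h2 := mul_le_mul_of_nonneg_left hy ht
    linarith
  refine convexHull_min ?_ hconv hq
  rintro _ ⟨w, hw, rfl⟩
  have h1 : -(v ⬝ᵥ w) ≤ D.phi v i :=
    Finset.le_sup' (fun q => -(v ⬝ᵥ q)) hw
  have h2 : (fun a => (v a : ℝ)) ⬝ᵥ (fun a => (w a : ℝ)) = ((v ⬝ᵥ w : ℤ) : ℝ) := by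
    simp [dotProduct]
  simp only [Set.mem_ofPred_eq, h2]
  exact_mod_cast h1

theorem isGreatest_phi (v : Fin n → ℤ) (i : Fin k) :
    IsGreatest ((fun q => -((fun a => (v a : ℝ)) ⬝ᵥ q)) '' D.M i) (D.phi v i : ℝ) := by
  constructor
  · obtain ⟨w, hw, h⟩ := Finset.exists_mem_eq_sup'
      (s := simplexVertices (D.m i) (D.X i)) ⟨0, Finset.mem_insert_self _ _⟩
      (fun q => -(v ⬝ᵥ q))
    refine ⟨fun a => (w a : ℝ), subset_convexHull ℝ _ ⟨w, hw, rfl⟩, ?_⟩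
    have h' : D.phi v i = -(v ⬝ᵥ w) := h
    rw [h']
    simp [dotProduct]
  · rintro _ ⟨q, hq, rfl⟩
    exact D.neg_dot_le_phi v i hq

theorem mem_dualSemigroup_iff (u : (Fin n → ℤ) × (Fin k → ℤ)) :
    u ∈ D.dualSemigroup ↔
      ∀ i, ∀ q ∈ simplexVertices (D.m i) (D.X i), 0 ≤ u.1 ⬝ᵥ q + u.2 i := by
  constructor
  · intro h i q hq
    have := h ((fun a => (q a : ℝ)), Pi.single i 1) (Submodule.subset_span
      (Set.mem_iUnion.2 ⟨i, subset_convexHull ℝ _ ⟨q, hq, rfl⟩, ⟨q, rfl⟩, rfl⟩))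
    have h2 : (fun a => (u.1 a : ℝ)) ⬝ᵥ (fun a => (q a : ℝ)) = ((u.1 ⬝ᵥ q : ℤ) : ℝ) := by
      simp [dotProduct]
    simp only [h2, dotProduct_single, mul_one] at this
    exact_mod_cast this
  · intro h x hx
    induction hx using Submodule.span_induction with
    | mem x hx =>
      obtain ⟨i, h1, -, h3⟩ := Set.mem_iUnion.1 hx
      have := D.neg_dot_le_phi u.1 i h1
      have h4 : D.phi u.1 i ≤ u.2 i :=
        Finset.sup'_le _ _ fun q hq => by linarith [h i q hq]
      have h5 : (D.phi u.1 i : ℝ) ≤ u.2 i := by exact_mod_cast h4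
      rw [h3, dotProduct_single, mul_one]
      linarith
    | zero => simp
    | add x y _ _ hx hy =>
      simp only [Prod.fst_add, Prod.snd_add, dotProduct_add]
      linarith
    | smul c x _ hx =>
      have hc : (0 : ℝ) ≤ c := c.2
      have : (fun a => (u.1 a : ℝ)) ⬝ᵥ (c • x).1 + (fun i => (u.2 i : ℝ)) ⬝ᵥ (c • x).2
          = (c : ℝ) * ((fun a => (u.1 a : ℝ)) ⬝ᵥ x.1 + (fun i => (u.2 i : ℝ)) ⬝ᵥ x.2) := by
        change (fun a => (u.1 a : ℝ)) ⬝ᵥ ((c : ℝ) • x.1)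
          + (fun i => (u.2 i : ℝ)) ⬝ᵥ ((c : ℝ) • x.2) = _
        simp only [dotProduct_smul, smul_eq_mul]
        ring
      rw [this]
      exact mul_nonneg hc hx

theorem eq_zero_of_orthogonal (v : Fin n → ℤ)
    (hv : ∀ i, ∀ q ∈ simplexVertices (D.m i) (D.X i), v ⬝ᵥ q = 0) : v = 0 := by
  let f : (Fin n → ℝ) →ₗ[ℝ] ℝ := ∑ a, (v a : ℝ) • LinearMap.proj a
  have hf : ∀ x, f x = (fun a => (v a : ℝ)) ⬝ᵥ x := fun x => by
    simp [f, dotProduct]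
  have h1 : ∀ i, ∀ q ∈ D.M i, q ∈ LinearMap.ker f := by
    intro i q hq
    refine convexHull_min ?_ (LinearMap.ker f).convex hq
    rintro _ ⟨w, hw, rfl⟩
    have := hv i w hw
    change f _ = 0
    rw [hf]
    have h2 : (fun a => (v a : ℝ)) ⬝ᵥ (fun a => (w a : ℝ)) = ((v ⬝ᵥ w : ℤ) : ℝ) := by
      simp [dotProduct]
    simp [h2, this]
  have h2 : (∑ i, latticeSimplex (D.m i) (D.X i)) ⊆ (LinearMap.ker f : Set (Fin n → ℝ)) := by
    intro x hx
    rw [Set.mem_finsetSum] at hx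
    obtain ⟨g, hg, rfl⟩ := hx
    exact Submodule.sum_mem _ fun i hi => h1 i _ (hg hi)
  have h3 : affineSpan ℝ (∑ i, latticeSimplex (D.m i) (D.X i))
      ≤ (LinearMap.ker f).toAffineSubspace := affineSpan_le.2 h2
  rw [D.full_dim] at h3
  funext a
  have h4 : (Pi.single a 1 : Fin n → ℝ) ∈ (LinearMap.ker f).toAffineSubspace :=
    h3 (AffineSubspace.mem_top _ _ _)
  have h5 : f (Pi.single a 1) = 0 := h4
  rw [hf, dotProduct_single, mul_one] at h5
  exact_mod_cast h5

theorem finite_hilbertBasis : D.hilbertBasis.Finite := by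
  let I := Σ i : Fin k, {q // q ∈ simplexVertices (D.m i) (D.X i)}
  let g : (Fin n → ℤ) × (Fin k → ℤ) → (I → ℕ) := fun u s => (u.1 ⬝ᵥ s.2.1 + u.2 s.1).toNat
  have hg : ∀ u ∈ D.dualSemigroup, ∀ s : I, (g u s : ℤ) = u.1 ⬝ᵥ s.2.1 + u.2 s.1 :=
    fun u hu s => Int.toNat_of_nonneg ((D.mem_dualSemigroup_iff u).1 hu s.1 s.2.1 s.2.2)
  have hsub : ∀ u ∈ D.dualSemigroup, ∀ w ∈ D.dualSemigroup, g u ≤ g w →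
      w - u ∈ D.dualSemigroup := by
    intro u hu w hw huw
    refine (D.mem_dualSemigroup_iff _).2 fun i q hq => ?_
    have h1 := hg u hu ⟨i, q, hq⟩
    have h2 := hg w hw ⟨i, q, hq⟩
    have h3 : (g u ⟨i, q, hq⟩ : ℤ) ≤ g w ⟨i, q, hq⟩ := by exact_mod_cast huw ⟨i, q, hq⟩
    simp only [Prod.fst_sub, Prod.snd_sub, sub_dotProduct, Pi.sub_apply]
    simp only at h1 h2
    linarith
  have hle : ∀ u ∈ D.hilbertBasis, ∀ w ∈ D.hilbertBasis, g u ≤ g w → u = w := by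
    intro u hu w hw huw
    rcases hw.2.2 u hu.1 (w - u) (hsub u hu.1 w hw.1 huw) (by abel) with h | h
    · exact absurd h hu.2.1
    · exact (sub_eq_zero.1 h).symm
  have hanti : IsAntichain (· ≤ ·) (g '' D.hilbertBasis) := by
    rintro _ ⟨u, hu, rfl⟩ _ ⟨w, hw, rfl⟩ hne h
    exact hne (congrArg g (hle u hu w hw h))
  refine Set.Finite.of_finite_image (WellQuasiOrderedLE.finite_of_isAntichain hanti) ?_
  intro u hu w hw h
  exact hle u hu w hw h.le

theorem finite_genSet : D.genSet.Finite := by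
  refine Set.Finite.union (Set.Finite.union (Set.Finite.union (Set.Finite.union ?_ ?_) ?_) ?_) ?_
  · exact (Set.finite_range fun i : Fin k =>
      ((0, Pi.single i 1) : (Fin n → ℤ) × (Fin k → ℤ))).subset
      (by rintro _ ⟨i, rfl⟩; exact ⟨i, rfl⟩)
  · exact (D.finite_hilbertBasis.image fun u => D.tilde u.1).subset
      (by rintro _ ⟨v, w, h, -, rfl⟩; exact ⟨(v, w), h, rfl⟩)
  · exact (Set.finite_range fun s : Fin k × Fin n => D.tilde (D.zcol s.1 s.2)).subset
      (by rintro _ ⟨p, j, rfl⟩; exact ⟨(p, j), rfl⟩)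
  · exact (Set.finite_range fun p => D.tilde (D.b p)).subset
      (by rintro _ ⟨p, rfl⟩; exact ⟨p, rfl⟩)
  · exact (Set.finite_range fun s : Fin k × Fin n => D.tilde (-D.zcol s.1 s.2)).subset
      (by rintro _ ⟨p, j, -, rfl⟩; exact ⟨(p, j), rfl⟩)

instance : Fintype D.genSet := D.finite_genSet.fintype

/-! #### The toric variety, its deformation and the tori -/

/-- The affine space with one coordinate for each generator. -/
abbrev Ambient : Type := D.genSet → ℂ

/-- The coordinate `t_i`, that is, the character `χ^{(0, e_i)}`. -/
def t (i : Fin k) : D.genSet :=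
  ⟨(0, Pi.single i 1), Or.inl (Or.inl (Or.inl (Or.inl ⟨i, rfl⟩)))⟩

/-- The coordinate `x_{p,j}` for `j < m p`, and a coordinate `w⁺_{p,l}` for the other `j`. -/
def xw (p : Fin k) (j : Fin n) : D.genSet :=
  ⟨D.tilde (D.zcol p j), Or.inl (Or.inl (Or.inr ⟨p, j, rfl⟩))⟩

/-- The coordinate `y_p`. -/
def y (p : Fin k) : D.genSet :=
  ⟨D.tilde (D.b p), Or.inl (Or.inr ⟨p, rfl⟩)⟩

/-- The map from the torus `(ℂ^*) ^ (n + k)` to affine space given by the characters. -/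
def torusMap (τ : (Fin n → ℂˣ) × (Fin k → ℂˣ)) : D.Ambient := fun q =>
  (((∏ a, τ.1 a ^ q.1.1 a) * ∏ i, τ.2 i ^ q.1.2 i : ℂˣ) : ℂ)

/-- The affine toric variety: the Zariski closure of the image of the torus. -/
def toricVariety : Set D.Ambient :=
  MvPolynomial.zeroLocus ℂ (MvPolynomial.vanishingIdeal ℂ (Set.range D.torusMap))

/-- Twice the moment map of the action of the compact torus `(S^1) ^ n`. -/
def moment (z : D.Ambient) (a : Fin n) : ℝ := ∑ q : D.genSet, (q.1.1 a : ℝ) * ‖z q‖ ^ 2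

variable [NeZero k]

/-- The deformation `Ψ⁻¹(ε)`, where `Ψ = (t_1 - t_2, …, t_1 - t_k)`.  The index `0 : Fin k` is the
first one, and `ε 0 = 0` in all uses. -/
def deformation (ε : Fin k → ℂ) : Set D.Ambient :=
  {z ∈ D.toricVariety | ∀ i, z (D.t 0) - z (D.t i) = ε i}

/-- The complement of the divisor `{t_1 = 1}` in the deformation. -/
def divisorComplement (ε : Fin k → ℂ) : Set D.Ambient :=
  {z ∈ D.deformation ε | z (D.t 0) ≠ 1}

/-- `T_{γ(r), δ} = f⁻¹(γ(r)) ∩ λ⁻¹(δ)`, where `f = t_1` and `γ(r)` is the circle of centre `1` and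
radius `r`. -/
def torus (ε : Fin k → ℂ) (r : ℝ) (δ : Fin n → ℝ) : Set D.Ambient :=
  {z ∈ D.deformation ε | ‖z (D.t 0) - 1‖ = r ∧ ∀ a, D.moment z a = δ a}

/-- The points of the singular fibres `t_1 = ε_p` (that is, `t_p = 0`) where at least two of the
coordinates `y_p, x_{p,1}, …, x_{p,m_p}` vanish. -/
def singularLocus (ε : Fin k → ℂ) : Set D.Ambient :=
  {z ∈ D.deformation ε | ∃ p, z (D.t 0) = ε p ∧
    ((∃ j : Fin n, j.val < D.m p ∧ z (D.xw p j) = 0 ∧ z (D.y p) = 0) ∨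
     (∃ j j' : Fin n, j.val < D.m p ∧ j'.val < D.m p ∧ j ≠ j' ∧
        z (D.xw p j) = 0 ∧ z (D.xw p j') = 0))}

/-- The wedge product of the coordinate differentials
`dx_{1,1} ∧ … ∧ dx_{1,m_1} ∧ dw⁺_{1,1} ∧ … ∧ dw⁺_{1,n-m_1} ∧ dt_1`. -/
def coordWedge : D.Ambient [⋀^Fin (n + 1)]→ₗ[ℂ] ℂ :=
  Matrix.detRowAlternating.compLinearMap
    (LinearMap.funLeft ℂ ℂ (Fin.snoc (α := fun _ => D.genSet) (D.xw 0) (D.t 0)))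

/-- The form `i^{n+1} dx ∧ dw⁺ ∧ dt_1 / ((t_1 - 1) ∏ x_{1,j} ∏ w⁺_{1,l})`; it is meaningful where
the denominator does not vanish. -/
def omegaFormula (z : D.Ambient) : D.Ambient [⋀^Fin (n + 1)]→ₗ[ℂ] ℂ :=
  (Complex.I ^ (n + 1) / ((z (D.t 0) - 1) * ∏ j, z (D.xw 0 j))) • D.coordWedge

end AdmissibleDecomposition

end

/-! Local structure. Fix `p` and work where `t_i ≠ 0` for all `i ≠ p`. The rows of `X_p` form a
lattice basis, so every generator is a Laurent monomial in the `n + 1` coordinates `x_{p,j}`,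
`w⁺_{p,l}`, `y_p` and the `t_i` with `i ≠ p` (if `M_p` is a point, `y_p` is replaced by `t_p`). The
exponents of `x_{p,j}` and `y_p` are nonnegative (`expo_nonneg`) and the `w⁺_{p,l}` do not vanish
(`coord_ne_zero`), so the toric variety is described there by these monomials (`eq_mono`,
`mono_mem_toricVariety`), and `t_p` is a unit `v_p` times the product of `y_p` and the `x_{p,j}`. On
the deformation `t_i = t_1 - ε_i`, hence `v_p(t_1) y_p ∏ x_{p,j} = t_1 - ε_p`. Near `t_1 = ε_p` this
can be solved for `t_1`, and the `n + 1` coordinates form a chart (`isChart_graphParam`). Where at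
most one of `y_p, x_{p,j}` vanishes there is another chart: a section of `t_1` is moved by the
complex torus, with coordinates `(ζ, t_1)` (`isChart_orbitParam`).

Volume form. In the coordinates `(ζ, t_1)` the given formula is a nonzero constant times `dζ ∧ dt_1
/ (t_1 - 1)`. In the other chart, logarithmic differentiation shows that the zeros of `y_p` and
`x_{p,j}` cancel, leaving the holomorphic nonvanishing coefficient `volCoeff` near `t_1 = ε_p`
(`omegaFormula_graphParam`). The two descriptions agree on a dense set, hence by continuity wherever
both make sense.

Special Lagrangian fibres. In an orbit chart the moment map depends only on `Re ζ` and `t_1`, and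
its derivative in `Re ζ` is injective. So the fibre is locally `ζ = S(ψ) + iθ`, `t_1 = 1 + (t_1(z) -
1) e^{iψ}` with `S` analytic (`exists_isTorusChart`). The rotations `∂_θ` are symplectically
orthogonal to every direction preserving the moment map, and only one further direction remains, so
the fibre is Lagrangian. The Jacobian of the angular coordinates is `i^{n+1} (t_1 - 1)`, which makes
`Ω` real.

Global torus. Over a circle avoiding the `ε_p` there is a global section `base`. The moment map
along a real orbit is half the gradient of a convex function; it is a bijection because the weights
positively span, so `S` exists on the whole circle and is periodic, and the angles parametrize an
embedded torus. -/

noncomputable section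

/-! ### Smooth functions of several complex variables are analytic -/

section SeveralComplexVariables

variable {E F : Type*} [NormedAddCommGroup E] [NormedSpace ℂ E]
  [NormedAddCommGroup F] [NormedSpace ℂ F]

/-- Cauchy's estimate for the Fréchet derivative. -/
theorem norm_fderiv_le_of_forall_mem_closedBall_norm_le {G : E → F} {z : E} {ρ C : ℝ} (hρ : 0 < ρ)
    (hd : ∀ w ∈ Metric.closedBall z ρ, DifferentiableAt ℂ G w)
    (hC : ∀ w ∈ Metric.closedBall z ρ, ‖G w‖ ≤ C) : ‖fderiv ℂ G z‖ ≤ C / ρ := by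
  have hC0 : 0 ≤ C := (norm_nonneg _).trans (hC z (Metric.mem_closedBall_self hρ.le))
  refine ContinuousLinearMap.opNorm_le_bound _ (by positivity) fun v => ?_
  rcases eq_or_ne v 0 with rfl | hv
  · simp
  have hv' : 0 < ‖v‖ := norm_pos_iff.2 hv
  have hmem : ∀ l ∈ Metric.closedBall (0 : ℂ) (ρ / ‖v‖), z + l • v ∈ Metric.closedBall z ρ := by
    intro l hl
    rw [mem_closedBall_zero_iff, le_div_iff₀ hv'] at hl
    simpa [norm_smul] using hl
  have hder : ∀ l ∈ Metric.closedBall (0 : ℂ) (ρ / ‖v‖),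
      HasDerivAt (fun l : ℂ => G (z + l • v)) (fderiv ℂ G (z + l • v) v) l := by
    intro l hl
    have h1 : HasDerivAt (fun l : ℂ => z + l • v) v l := by
      simpa using ((hasDerivAt_id l).smul_const v).const_add z
    exact (hd _ (hmem l hl)).hasFDerivAt.comp_hasDerivAt l h1
  have hR : 0 < ρ / ‖v‖ := by positivity
  have key := Complex.norm_deriv_le_of_forall_mem_sphere_norm_le (f := fun l : ℂ => G (z + l • v))
    (c := 0) (C := C) hR
    (DifferentiableOn.diffContOnCl fun l hl => ((hder l
      (Metric.closure_ball_subset_closedBall hl)).differentiableAt).differentiableWithinAt)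
    (fun l hl => hC _ (hmem l (Metric.sphere_subset_closedBall hl)))
  rw [(hder 0 (Metric.mem_closedBall_self hR.le)).deriv] at key
  simp only [zero_smul, add_zero] at key
  calc _ ≤ C / (ρ / ‖v‖) := key
    _ = C / ρ * ‖v‖ := by field_simp

/-- Each derivative costs a radius `ρ` and a factor `1 / ρ`, by Cauchy's estimate applied to the
previous one. -/
theorem norm_iteratedFDeriv_le_of_forall_mem_ball_norm_le {f : E → F} {x : E} {r ρ M : ℝ}
    (hρ : 0 < ρ) (hf : ∀ w ∈ Metric.ball x r, ContDiffAt ℂ ∞ f w)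
    (hM : ∀ w ∈ Metric.ball x r, ‖f w‖ ≤ M) (N : ℕ) :
    ∀ z, dist z x + N * ρ < r → ‖iteratedFDeriv ℂ N f z‖ ≤ M / ρ ^ N := by
  induction N with
  | zero =>
    intro z hz
    simpa using hM z (by simpa using hz)
  | succ N ih =>
    intro z hz
    push_cast at hz
    have hd : ∀ w ∈ Metric.closedBall z ρ, dist w x + N * ρ < r := by
      intro w hw
      have := dist_triangle w z x
      rw [Metric.mem_closedBall] at hw
      linarith
    rw [← norm_fderiv_iteratedFDeriv, pow_succ, ← div_div]
    refine norm_fderiv_le_of_forall_mem_closedBall_norm_le hρ (fun w hw => ?_)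
      fun w hw => ih w (hd w hw)
    refine (hf w ?_).differentiableAt_iteratedFDeriv ?_
    · have := hd w hw
      rw [Metric.mem_ball]
      have : 0 ≤ (N : ℝ) * ρ := by positivity
      linarith
    · exact_mod_cast ENat.natCast_lt_top N

theorem iteratedDeriv_comp_add_smul {f : E → F} {x y : E} {U : Set ℂ} (hU : IsOpen U)
    (hf : ∀ l ∈ U, ContDiffAt ℂ ∞ f (x + l • y)) (N : ℕ) :
    ∀ l ∈ U, iteratedDeriv N (fun l : ℂ => f (x + l • y)) l
      = iteratedFDeriv ℂ N f (x + l • y) fun _ => y := by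
  induction N with
  | zero => intro l _; simp
  | succ N ih =>
    intro l hl
    rw [iteratedDeriv_succ, (Filter.eventuallyEq_of_mem (hU.mem_nhds hl) ih).deriv_eq]
    exact ((hf l hl).of_le (by exact_mod_cast le_top)).deriv_fderiv_add_smul

/-- Cauchy estimates make the Taylor series converge near `x`; restriction to complex lines
identifies its sum with `f`. It is needed because local parametrizations are only assumed smooth
over `ℂ`, whereas volume form coefficients must be analytic. -/
theorem AnalyticAt.of_eventually_contDiffAt [CompleteSpace F] {f : E → F} {x : E}
    (hf : ∀ᶠ w in 𝓝 x, ContDiffAt ℂ ∞ f w) : AnalyticAt ℂ f x := by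
  obtain ⟨r, hr, hball⟩ := Metric.eventually_nhds_iff_ball.1 (hf.and
    (hf.self_of_nhds.continuousAt.norm.eventually_lt_const (lt_add_one ‖f x‖)))
  set M := ‖f x‖ + 1
  have hM0 : 0 ≤ M := by positivity
  have hfb : ∀ w ∈ Metric.ball x r, ContDiffAt ℂ ∞ f w := fun w hw => (hball w hw).1
  have hbound : ∀ N : ℕ, ‖((N.factorial : ℂ)⁻¹ • iteratedFDeriv ℂ N f x)‖ *
      (r / (2 * Real.exp 1)) ^ N ≤ M := by
    intro N
    rcases Nat.eq_zero_or_pos N with rfl | hN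
    · have := (hball x (Metric.mem_ball_self hr)).2.le
      simpa using this
    have hNpos : (0 : ℝ) < N := by exact_mod_cast hN
    -- With `N` steps of size `r / (2N)` only half the radius is used; the resulting `N ^ N / N!` is
    -- absorbed by `e ^ N`, whence the radius `r / (2e)` of convergence.
    have h1 := norm_iteratedFDeriv_le_of_forall_mem_ball_norm_le (ρ := r / (2 * N)) (by positivity)
      hfb (fun w hw => (hball w hw).2.le) N x (by
        rw [dist_self, zero_add]
        field_simp
        linarith)
    have h2 := Real.pow_div_factorial_le_exp _ hNpos.le N
    rw [norm_smul, norm_inv, Complex.norm_natCast]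
    have hfac : (0 : ℝ) < N.factorial := by exact_mod_cast N.factorial_pos
    calc (N.factorial : ℝ)⁻¹ * ‖iteratedFDeriv ℂ N f x‖ * (r / (2 * Real.exp 1)) ^ N
        ≤ (N.factorial : ℝ)⁻¹ * (M / (r / (2 * N)) ^ N) * (r / (2 * Real.exp 1)) ^ N := by gcongr
      _ = M * ((N : ℝ) ^ N / N.factorial / Real.exp N) := by
        rw [show Real.exp N = Real.exp 1 ^ N by rw [← Real.exp_nat_mul]; simp]
        simp only [div_pow, mul_pow]
        field_simp
      _ ≤ M * 1 := by
        gcongr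
        rw [div_le_one (Real.exp_pos _)]
        exact h2
      _ = M := mul_one M
  set p : FormalMultilinearSeries ℂ E F := fun N => (N.factorial : ℂ)⁻¹ • iteratedFDeriv ℂ N f x
  set R : NNReal := ⟨r / (2 * Real.exp 1), by positivity⟩
  have hR : (0 : ℝ) < R := by
    change 0 < r / (2 * Real.exp 1)
    positivity
  refine ⟨p, R, ⟨p.le_radius_of_bound M hbound, by exact_mod_cast hR, fun {y} hy => ?_⟩⟩
  rw [Metric.eball_coe, mem_ball_zero_iff] at hy
  have hRr : (R : ℝ) < r / 2 := by
    change r / (2 * Real.exp 1) < r / 2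
    have := Real.exp_one_gt_d9
    gcongr
    linarith
  have hy2 : ‖y‖ < r / 2 := hy.trans hRr
  have hmem : ∀ l ∈ Metric.ball (0 : ℂ) 2, x + l • y ∈ Metric.ball x r := by
    intro l hl
    rw [mem_ball_zero_iff] at hl
    have : ‖l‖ * ‖y‖ ≤ 2 * ‖y‖ := by gcongr
    simp only [mem_ball_iff_norm, add_sub_cancel_left, norm_smul]
    linarith
  have hdiff : DifferentiableOn ℂ (fun l : ℂ => f (x + l • y)) (Metric.ball 0 2) := by
    intro l hl
    refine DifferentiableAt.differentiableWithinAt ?_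
    refine DifferentiableAt.comp l ((hfb _ (hmem l hl)).differentiableAt (by simp)) ?_
    fun_prop
  -- The restriction to the line is holomorphic on a disc of radius 2, so its Taylor series may be
  -- evaluated at 1.
  have := Complex.hasSum_taylorSeries_on_ball hdiff (z := 1) (by simp)
  simp only [one_smul, sub_zero, one_pow] at this
  refine this.congr_fun fun N => ?_
  rw [iteratedDeriv_comp_add_smul Metric.isOpen_ball (fun l hl => hfb _ (hmem l hl)) N 0 (by simp)]
  simp [p]

end SeveralComplexVariables

/-! ### Parametrizations with an analytic inverse -/

section Charts

variable {ι : Type*} [Fintype ι]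

/-- `Ψ` is an analytic parametrization of `S` at `z`, and `ρ` is an analytic map on a neighbourhood
of `z` in the ambient space which restricts to the inverse of `Ψ` on `S`. -/
structure IsChart (𝕜 : Type*) [RCLike 𝕜] [NormedSpace 𝕜 (ι → ℂ)] (d : ℕ)
    (S : Set (ι → ℂ)) (z : ι → ℂ) (Ψ : (Fin d → 𝕜) → (ι → ℂ)) (ρ : (ι → ℂ) → (Fin d → 𝕜)) :
    Prop where
  map_zero : Ψ 0 = z
  contDiffAt : ContDiffAt 𝕜 ω Ψ 0
  contDiffAt_inv : ContDiffAt 𝕜 ω ρ z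
  mem : ∀ᶠ s in 𝓝 0, Ψ s ∈ S
  left_inv : ∀ᶠ s in 𝓝 0, ρ (Ψ s) = s
  right_inv : ∀ᶠ w in 𝓝[S] z, Ψ (ρ w) = w

namespace IsChart

variable {𝕜 : Type*} [RCLike 𝕜] [NormedSpace 𝕜 (ι → ℂ)] {d : ℕ} {S : Set (ι → ℂ)} {z : ι → ℂ}
  {Ψ φ : (Fin d → 𝕜) → (ι → ℂ)} {ρ : (ι → ℂ) → (Fin d → 𝕜)}

theorem inv_apply (h : IsChart 𝕜 d S z Ψ ρ) : ρ z = 0 := by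
  have := h.left_inv.self_of_nhds
  rwa [h.map_zero] at this

theorem isLocalParam (h : IsChart 𝕜 d S z Ψ ρ) : IsLocalParam 𝕜 d S z Ψ where
  map_zero := h.map_zero
  smooth := (h.contDiffAt.eventually (by simp)).mono fun s hs => hs.of_le le_top
  immersive := by
    have h1 : HasFDerivAt Ψ (fderiv 𝕜 Ψ 0) 0 :=
      (h.contDiffAt.differentiableAt (by simp)).hasFDerivAt
    have h2 : HasFDerivAt ρ (fderiv 𝕜 ρ z) (Ψ 0) := by
      rw [h.map_zero]
      exact (h.contDiffAt_inv.differentiableAt (by simp)).hasFDerivAt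
    have h3 := (h2.comp 0 h1).unique
      ((hasFDerivAt_id (0 : Fin d → 𝕜)).congr_of_eventuallyEq h.left_inv)
    intro u v huv
    have h4 : ∀ u, fderiv 𝕜 ρ z (fderiv 𝕜 Ψ 0 u) = u := fun u => congrArg (fun f => f u) h3
    rw [← h4 u, huv, h4]
  map_nhds := by
    apply le_antisymm
    · have h1 : Filter.Tendsto Ψ (𝓝 0) (𝓝 z) := by
        simpa only [ContinuousAt, h.map_zero] using h.contDiffAt.continuousAt
      exact tendsto_nhdsWithin_iff.2 ⟨h1, h.mem⟩
    · have h1 : Filter.Tendsto ρ (𝓝[S] z) (𝓝 0) := by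
        have := h.contDiffAt_inv.continuousAt
        rw [ContinuousAt, h.inv_apply] at this
        exact this.mono_left nhdsWithin_le_nhds
      have h2 := (Filter.tendsto_map (f := Ψ)).comp h1
      exact Filter.tendsto_id'.1 (h2.congr' h.right_inv)

/-- Since `ρ` is defined on an ambient neighbourhood, the transition map `ρ ∘ φ` is smooth without
further argument. This reduces claims about all parametrizations to one chart. -/
theorem eventually_comp_eq (h : IsChart 𝕜 d S z Ψ ρ) (hφ : IsLocalParam 𝕜 d S z φ) :
    φ =ᶠ[𝓝 0] Ψ ∘ ρ ∘ φ := by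
  have h1 := h.right_inv
  rw [← hφ.map_nhds, Filter.eventually_map] at h1
  exact h1.mono fun s hs => hs.symm

theorem inv_comp_zero (h : IsChart 𝕜 d S z Ψ ρ) (hφ : IsLocalParam 𝕜 d S z φ) :
    (ρ ∘ φ) 0 = 0 := by
  rw [Function.comp_apply, hφ.map_zero, h.inv_apply]

theorem eventually_contDiffAt_inv_comp (h : IsChart 𝕜 d S z Ψ ρ) (hφ : IsLocalParam 𝕜 d S z φ) :
    ∀ᶠ s in 𝓝 0, ContDiffAt 𝕜 ∞ (ρ ∘ φ) s := by
  have h1 : ContinuousAt φ 0 := hφ.smooth.self_of_nhds.continuousAt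
  have h2 := h.contDiffAt_inv.eventually (by simp)
  rw [← hφ.map_zero] at h2
  filter_upwards [hφ.smooth, h1.eventually h2] with s hs1 hs2
  exact (hs2.of_le le_top).comp s hs1

theorem fderiv_eq_comp (h : IsChart 𝕜 d S z Ψ ρ) (hφ : IsLocalParam 𝕜 d S z φ) :
    ∀ᶠ s in 𝓝 0, fderiv 𝕜 φ s = (fderiv 𝕜 Ψ (ρ (φ s))).comp (fderiv 𝕜 (ρ ∘ φ) s) := by
  have hc := h.eventually_contDiffAt_inv_comp hφ
  have h3 : ContinuousAt (ρ ∘ φ) 0 := hc.self_of_nhds.continuousAt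
  have h4 := h.contDiffAt.eventually (by simp)
  rw [← h.inv_comp_zero hφ] at h4
  filter_upwards [(h.eventually_comp_eq hφ).eventually_nhds, hc, h3.eventually h4]
    with s hs1 hs2 hs3
  rw [Filter.EventuallyEq.fderiv_eq hs1]
  exact fderiv_comp s (hs3.differentiableAt (by simp)) (hs2.differentiableAt (by simp))

theorem fderiv_zero_eq_comp (h : IsChart 𝕜 d S z Ψ ρ) (hφ : IsLocalParam 𝕜 d S z φ) :
    fderiv 𝕜 φ 0 = (fderiv 𝕜 Ψ 0).comp (fderiv 𝕜 (ρ ∘ φ) 0) := by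
  have := (h.fderiv_eq_comp hφ).self_of_nhds
  rwa [show ρ (φ 0) = 0 from h.inv_comp_zero hφ] at this

end IsChart

/-- The pull-back is an alternating form of top degree on `R ^ d`, hence a multiple of the
determinant. -/
theorem AlternatingMap.map_linearMap_apply {R M : Type*} [CommRing R] [AddCommGroup M] [Module R M]
    {d : ℕ} (f : M [⋀^Fin d]→ₗ[R] R) (A : (Fin d → R) →ₗ[R] M) (u : Fin d → Fin d → R) :
    f (fun j => A (u j)) = (Matrix.of u).det * f (fun j => A (Pi.single j 1)) := by
  have h := congrArg (fun g : (Fin d → R) [⋀^Fin d]→ₗ[R] R => g u)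
    ((f.compLinearMap A).eq_smul_basis_det (Pi.basisFun R (Fin d)))
  simp only [AlternatingMap.compLinearMap_apply, AlternatingMap.smul_apply,
    Pi.basisFun_det_apply, smul_eq_mul] at h
  have h2 : ⇑(Pi.basisFun R (Fin d)) = fun j => Pi.single j 1 := by
    funext j
    exact Pi.basisFun_apply R (Fin d) j
  rw [h2] at h
  rw [mul_comm]
  exact h

/-- In another parametrization the coefficient is multiplied by the Jacobian determinant of the
transition map, which is analytic and nonzero. -/
theorem IsHolomorphicVolumeForm.of_charts {d : ℕ} {X : Set (ι → ℂ)}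
    {Ω : (ι → ℂ) → ((ι → ℂ) [⋀^Fin d]→ₗ[ℂ] ℂ)}
    (H : ∀ z ∈ X, ∃ Ψ ρ, ∃ h : (Fin d → ℂ) → ℂ, IsChart ℂ d X z Ψ ρ ∧ AnalyticAt ℂ h 0 ∧ h 0 ≠ 0 ∧
      ∀ᶠ s in 𝓝 0, Ω (Ψ s) (fun j => fderiv ℂ Ψ s (Pi.single j 1)) = h s) :
    IsHolomorphicVolumeForm d X Ω := by
  refine ⟨fun z hz => ?_, fun z hz φ hφ => ?_⟩
  · obtain ⟨Ψ, ρ, h, hΨ, -⟩ := H z hz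
    exact ⟨Ψ, hΨ.isLocalParam⟩
  obtain ⟨Ψ, ρ, h, hΨ, hh, hh0, hΩ⟩ := H z hz
  have hg0 := hΨ.inv_comp_zero hφ
  set g := ρ ∘ φ with hg
  have hga : AnalyticAt ℂ g 0 :=
    AnalyticAt.of_eventually_contDiffAt (hΨ.eventually_contDiffAt_inv_comp hφ)
  have key : (fun s => Ω (φ s) (fun j => fderiv ℂ φ s (Pi.single j 1))) =ᶠ[𝓝 0]
      fun s => (Matrix.of fun j => fderiv ℂ g s (Pi.single j 1)).det * h (g s) := by
    have h1 : ∀ᶠ s in 𝓝 0, Ω (Ψ (g s)) (fun j => fderiv ℂ Ψ (g s) (Pi.single j 1)) = h (g s) := by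
      rw [← hg0] at hΩ
      exact hga.continuousAt.eventually hΩ
    filter_upwards [h1, hΨ.eventually_comp_eq hφ, hΨ.fderiv_eq_comp hφ] with s hs1 hs2 hs3
    rw [hs3, ← hs1, show Ω (φ s) = Ω (Ψ (g s)) from congrArg Ω hs2]
    exact (Ω (Ψ (g s))).map_linearMap_apply (fderiv ℂ Ψ (g s)).toLinearMap _
  refine ⟨AnalyticAt.congr ?_ key.symm, ?_⟩
  · refine AnalyticAt.mul ?_ (AnalyticAt.comp_of_eq hh hga hg0)
    simp only [Matrix.det_apply']
    have hder : ∀ i j, AnalyticAt ℂ (fun s => fderiv ℂ g s (Pi.single i 1) j) 0 := by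
      intro i j
      have h1 := hga.fderiv
      have h2 := ((ContinuousLinearMap.proj (R := ℂ) (φ := fun _ : Fin d => ℂ) j).comp
        (ContinuousLinearMap.apply ℂ (Fin d → ℂ) (Pi.single i 1))).analyticAt (fderiv ℂ g 0)
      exact h2.comp h1
    refine Finset.analyticAt_fun_sum _ fun σ _ => analyticAt_const.mul ?_
    exact Finset.analyticAt_fun_prod _ fun i _ => hder _ _
  · have := key.self_of_nhds
    simp only [hg0] at this
    rw [this]
    refine mul_ne_zero ?_ hh0
    -- The derivative of `φ` is injective and factors through that of `g`.
    have hinj : Function.Injective (fderiv ℂ g 0) := by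
      have h1 := hφ.immersive
      rw [hΨ.fderiv_zero_eq_comp hφ] at h1
      exact Function.Injective.of_comp (f := fderiv ℂ Ψ 0) h1
    intro hdet
    obtain ⟨v, hv, hv0⟩ := Matrix.exists_vecMul_eq_zero_iff.2 hdet
    refine hv (hinj ?_)
    have h1 : fderiv ℂ g 0 v
        = Matrix.vecMul v (Matrix.of fun j => fderiv ℂ g 0 (Pi.single j 1)) := by
      conv_lhs => rw [pi_eq_sum_univ' v, map_sum]
      ext j
      simp [Matrix.vecMul, dotProduct, Finset.sum_apply]
    rw [map_zero, h1, hv0]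

end Charts

namespace AdmissibleDecomposition

variable {n k : ℕ} (D : AdmissibleDecomposition n k)

/-! ### Combinatorics of the generators -/

section Combinatorics

variable (p : Fin k)

theorem row_dot_zcol (i j : Fin n) : D.X p i ⬝ᵥ D.zcol p j = if i = j then 1 else 0 := by
  have h := Matrix.mul_nonsing_inv (D.X p) (D.isUnit_det p)
  rw [← Matrix.one_apply, ← h, Matrix.mul_apply]
  rfl

theorem sum_row_dot_smul_zcol (v : Fin n → ℤ) : ∑ j, (D.X p j ⬝ᵥ v) • D.zcol p j = v := by
  have h := Matrix.nonsing_inv_mul (D.X p) (D.isUnit_det p)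
  have h2 : (D.X p)⁻¹.mulVec ((D.X p).mulVec v) = v := by
    rw [Matrix.mulVec_mulVec, h, Matrix.one_mulVec]
  conv_rhs => rw [← h2]
  ext a
  simp only [Finset.sum_apply, Pi.smul_apply, smul_eq_mul, Matrix.mulVec, zcol]
  exact Finset.sum_congr rfl fun j _ => mul_comm _ _

theorem phi_nonneg (v : Fin n → ℤ) : 0 ≤ D.phi v p := by
  have := Finset.le_sup' (fun q => -(v ⬝ᵥ q)) (Finset.mem_insert_self 0
    ((Finset.univ.filter fun j : Fin n => j.val < D.m p).image fun j => D.X p j))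
  rwa [dotProduct_zero, neg_zero] at this

theorem phi_le_iff (v : Fin n → ℤ) {c : ℤ} (hc : 0 ≤ c) :
    D.phi v p ≤ c ↔ ∀ j : Fin n, j.val < D.m p → -(v ⬝ᵥ D.X p j) ≤ c := by
  refine (Finset.sup'_le_iff _ _).trans ?_
  simp only [simplexVertices, Finset.mem_insert, Finset.mem_image, Finset.mem_filter,
    Finset.mem_univ, true_and, forall_eq_or_imp, dotProduct_zero, neg_zero, hc]
  exact ⟨fun h j hj => h _ ⟨j, hj, rfl⟩, by rintro h _ ⟨j, hj, rfl⟩; exact h j hj⟩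

theorem neg_dot_row_le_phi (v : Fin n → ℤ) {j : Fin n} (hj : j.val < D.m p) :
    -(v ⬝ᵥ D.X p j) ≤ D.phi v p :=
  (D.phi_le_iff p v (D.phi_nonneg p v)).1 le_rfl j hj

@[simp]
theorem phi_zcol_self (j : Fin n) : D.phi (D.zcol p j) p = 0 := by
  refine le_antisymm ((D.phi_le_iff p _ le_rfl).2 fun i _ => ?_) (D.phi_nonneg p _)
  rw [dotProduct_comm, row_dot_zcol]
  split_ifs <;> simp

theorem phi_neg_zcol_self {j : Fin n} (hj : D.m p ≤ j.val) : D.phi (-D.zcol p j) p = 0 := by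
  refine le_antisymm ((D.phi_le_iff p _ le_rfl).2 fun i hi => ?_) (D.phi_nonneg p _)
  rw [dotProduct_comm, dotProduct_neg, row_dot_zcol, if_neg (by rintro rfl; omega)]
  simp

theorem row_dot_b (i : Fin n) : D.X p i ⬝ᵥ D.b p = if i.val < D.m p then -1 else 0 := by
  rw [b, dotProduct_neg, dotProduct_sum]
  simp only [row_dot_zcol, Finset.sum_ite_eq, Finset.mem_filter, Finset.mem_univ, true_and]
  split_ifs <;> simp

/-- For `m p = 0` one has `b p = 0` and the value is 0: then `y_p` is constant and cannot serve as a
coordinate, which is why `yc` is defined by cases. -/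
theorem phi_b_self (hm : 0 < D.m p) : D.phi (D.b p) p = 1 := by
  have hrow : ∀ i : Fin n, i.val < D.m p → -(D.b p ⬝ᵥ D.X p i) = 1 := by
    intro i hi
    rw [dotProduct_comm, row_dot_b, if_pos hi, neg_neg]
  refine le_antisymm ((D.phi_le_iff p _ zero_le_one).2 fun i hi => (hrow i hi).le) ?_
  have := D.neg_dot_row_le_phi p (D.b p) (j := ⟨0, hm.trans_le (D.m_le p)⟩) hm
  rwa [hrow _ hm] at this

/-- The coordinate `y_p`, or `t_p` if `M_p` is a point. -/
def yc : D.genSet := if 0 < D.m p then D.y p else D.t p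

/-- The coordinates `x_{p,j}`, `w⁺_{p,l}` and `y_p`. -/
def coord : Fin (n + 1) → D.genSet := Fin.snoc (α := fun _ => D.genSet) (D.xw p) (D.yc p)

@[simp]
theorem coord_castSucc (j : Fin n) : D.coord p j.castSucc = D.xw p j := by
  simp [coord]

@[simp]
theorem coord_last : D.coord p (Fin.last n) = D.yc p := by
  simp [coord]

theorem yc_fst : (D.yc p).1.1 = D.b p := by
  unfold yc
  split_ifs with h
  · rfl
  · have : ∀ j : Fin n, ¬ j.val < D.m p := fun j => by omega
    simp [t, b, this]

theorem yc_snd_self : (D.yc p).1.2 p = 1 := by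
  unfold yc
  split_ifs with h
  · exact D.phi_b_self p h
  · simp [t]

/-- The exponents of the coordinates `x_{p,j}`, `w⁺_{p,l}` and `y_p` in the generator `q`. -/
def expo (q : (Fin n → ℤ) × (Fin k → ℤ)) : Fin (n + 1) → ℤ :=
  Fin.snoc (α := fun _ => ℤ)
    (fun j => D.X p j ⬝ᵥ q.1 + if j.val < D.m p then q.2 p else 0) (q.2 p)

@[simp]
theorem expo_castSucc (q : (Fin n → ℤ) × (Fin k → ℤ)) (j : Fin n) :
    D.expo p q j.castSucc = D.X p j ⬝ᵥ q.1 + if j.val < D.m p then q.2 p else 0 := by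
  simp [expo]

@[simp]
theorem expo_last (q : (Fin n → ℤ) × (Fin k → ℤ)) : D.expo p q (Fin.last n) = q.2 p := by
  simp [expo]

/-- The exponents of the coordinates `t_i` in the generator `q`. -/
def texpo (q : (Fin n → ℤ) × (Fin k → ℤ)) : Fin k → ℤ :=
  q.2 - ∑ j, D.expo p q j • (D.coord p j).1.2

/-- The term `q.2 p` added to the first `m p` exponents is compensated by the weight `b p` of the
last coordinate; what remains is the expansion of `q.1` in the basis of columns of `X_p⁻¹`. -/
theorem sum_expo_smul_fst (q : (Fin n → ℤ) × (Fin k → ℤ)) :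
    ∑ j, D.expo p q j • (D.coord p j).1.1 = q.1 := by
  have h1 : ∀ j, (D.xw p j).1.1 = D.zcol p j := fun j => rfl
  simp only [Fin.sum_univ_castSucc, expo_castSucc, coord_castSucc, expo_last, coord_last, yc_fst,
    h1, add_smul, Finset.sum_add_distrib, sum_row_dot_smul_zcol, ite_smul, zero_smul, b, smul_neg,
    Finset.smul_sum, ← Finset.sum_filter]
  abel

/-- Only `yc p` has a nonzero `p`-th height, namely 1. Thus `t_p` itself never enters the monomials,
which remain meaningful where it vanishes. -/
theorem texpo_self (q : (Fin n → ℤ) × (Fin k → ℤ)) : D.texpo p q p = 0 := by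
  have h1 : ∀ j, (D.xw p j).1.2 p = 0 := fun j => D.phi_zcol_self p j
  simp [texpo, Fin.sum_univ_castSucc, h1, yc_snd_self]

theorem eq_sum_expo_add_sum_texpo (q : (Fin n → ℤ) × (Fin k → ℤ)) :
    q = ∑ j, D.expo p q j • (D.coord p j).1 + ∑ i, D.texpo p q i • (D.t i).1 := by
  have h1 : ∑ i, D.texpo p q i • (D.t i).1.2 = D.texpo p q := by
    ext i
    simp [t, Finset.sum_apply, Pi.single_apply]
  refine Prod.ext ?_ ?_
  · rw [Prod.fst_add, Prod.fst_sum, Prod.fst_sum]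
    simp only [Prod.smul_fst, sum_expo_smul_fst]
    simp [t]
  · rw [Prod.snd_add, Prod.snd_sum, Prod.snd_sum]
    simp only [Prod.smul_snd, h1]
    simp [texpo]

theorem expo_coord (j : Fin (n + 1)) : D.expo p (D.coord p j).1 = Pi.single j 1 := by
  ext i
  induction j using Fin.lastCases with
  | last =>
    induction i using Fin.lastCases with
    | last => simp [yc_snd_self]
    | cast i =>
      rw [expo_castSucc, coord_last, yc_fst, yc_snd_self, row_dot_b,
        Pi.single_eq_of_ne (Fin.castSucc_lt_last i).ne]
      split_ifs <;> simp
  | cast j =>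
    have h1 : (D.xw p j).1.1 = D.zcol p j := rfl
    have h2 : (D.xw p j).1.2 p = 0 := D.phi_zcol_self p j
    induction i using Fin.lastCases with
    | last => simp [h2]
    | cast i => simp [h1, h2, row_dot_zcol, Pi.single_apply]

theorem texpo_coord (j : Fin (n + 1)) : D.texpo p (D.coord p j).1 = 0 := by
  simp [texpo, expo_coord, Pi.single_apply]

theorem expo_t_of_ne {i : Fin k} (hi : i ≠ p) : D.expo p (D.t i).1 = 0 := by
  ext j
  induction j using Fin.lastCases <;> simp [t, hi.symm]

theorem texpo_t_of_ne {i : Fin k} (hi : i ≠ p) : D.texpo p (D.t i).1 = Pi.single i 1 := by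
  rw [texpo, expo_t_of_ne D p hi]
  simp [t]

/-- The indices of the coordinates `x_{p,j}` and `y_p`. -/
def bdry : Finset (Fin (n + 1)) := {j | j.val < D.m p ∨ j = Fin.last n}

theorem castSucc_mem_bdry {j : Fin n} : j.castSucc ∈ D.bdry p ↔ j.val < D.m p := by
  simp [bdry, (Fin.castSucc_lt_last j).ne]

theorem last_mem_bdry : Fin.last n ∈ D.bdry p := by
  simp [bdry]

theorem expo_t_self (j : Fin (n + 1)) :
    D.expo p (D.t p).1 j = if j ∈ D.bdry p then 1 else 0 := by
  induction j using Fin.lastCases with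
  | last => simp [t, last_mem_bdry]
  | cast j => simp [t, castSucc_mem_bdry]

/-- The weights add up to that of `t_p`, so the product of the boundary coordinates is invariant
under the `n`-dimensional torus. -/
theorem sum_bdry_fst : ∑ j ∈ D.bdry p, (D.coord p j).1.1 = 0 := by
  have h : (D.t p).1.1 = 0 := rfl
  rw [← h, ← D.sum_expo_smul_fst p (D.t p).1]
  simp only [expo_t_self, ite_smul, one_smul, zero_smul, Finset.sum_ite_mem, Finset.univ_inter]

theorem neg_dot_row_le_snd (q : D.genSet) {j : Fin n} (hj : j.val < D.m p) :
    -(D.X p j ⬝ᵥ q.1.1) ≤ q.1.2 p := by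
  have h : ∀ v, -(D.X p j ⬝ᵥ v) ≤ D.phi v p := fun v => by
    rw [dotProduct_comm]
    exact D.neg_dot_row_le_phi p v hj
  obtain ⟨q, (((⟨i, rfl⟩ | ⟨v, w, -, -, rfl⟩) | ⟨p, j, rfl⟩) | ⟨p, rfl⟩) | ⟨p, j, -, rfl⟩⟩ := q
  · simp [Pi.single_apply]
    split_ifs <;> simp
  all_goals exact h _

theorem snd_nonneg (q : D.genSet) : 0 ≤ q.1.2 p := by
  obtain ⟨q, (((⟨i, rfl⟩ | ⟨v, w, -, -, rfl⟩) | ⟨p, j, rfl⟩) | ⟨p, rfl⟩) | ⟨p, j, -, rfl⟩⟩ := q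
  · simp [Pi.single_apply]
    split_ifs <;> simp
  all_goals exact D.phi_nonneg _ _

/-- Every generator lies in the dual cone: its pairings with `(v_{p,j}, e_p)` and `(0, e_p)` are
exactly these exponents. Hence the monomials extend across the zeros of the boundary coordinates. -/
theorem expo_nonneg (q : D.genSet) {j : Fin (n + 1)} (hj : j ∈ D.bdry p) : 0 ≤ D.expo p q.1 j := by
  induction j using Fin.lastCases with
  | last => simpa using D.snd_nonneg p q
  | cast j =>
    rw [castSucc_mem_bdry] at hj
    have := D.neg_dot_row_le_snd p q hj
    rw [expo_castSucc, if_pos hj]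
    linarith

/-- The coordinate `w⁻_{p,l}`. -/
def wneg (j : Fin n) (hj : D.m p ≤ j.val) : D.genSet :=
  ⟨D.tilde (-D.zcol p j), Or.inr ⟨p, j, hj, rfl⟩⟩

end Combinatorics

/-! ### Monomial description of the toric variety -/

theorem prod_zpow_eq_zpow_sum {G ι : Type*} [CommGroup G] (g : G) (e : ι → ℤ) (S : Finset ι) :
    ∏ i ∈ S, g ^ e i = g ^ ∑ i ∈ S, e i := by
  classical
  induction S using Finset.induction_on with
  | empty => simp
  | insert i S hi ih => rw [Finset.prod_insert hi, Finset.sum_insert hi, ih, zpow_add]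

/-- The characters of the torus. -/
def torusChar (τ : (Fin n → ℂˣ) × (Fin k → ℂˣ)) :
    (Fin n → ℤ) × (Fin k → ℤ) →+ Additive ℂˣ where
  toFun u := Additive.ofMul ((∏ a, τ.1 a ^ u.1 a) * ∏ i, τ.2 i ^ u.2 i)
  map_zero' := by simp
  map_add' u v := by
    simp only [Prod.fst_add, Prod.snd_add, Pi.add_apply, zpow_add, Finset.prod_mul_distrib,
      ← ofMul_mul]
    congr 1
    exact mul_mul_mul_comm _ _ _ _

theorem torusMap_eq_torusChar (τ : (Fin n → ℂˣ) × (Fin k → ℂˣ)) (q : D.genSet) :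
    D.torusMap τ q = ((torusChar τ q.1).toMul : ℂˣ) := rfl

theorem isClosed_toricVariety : IsClosed D.toricVariety := by
  have : D.toricVariety = ⋂ f ∈ MvPolynomial.vanishingIdeal ℂ (Set.range D.torusMap),
      {z | MvPolynomial.eval z f = 0} := by
    ext z
    simp [toricVariety, MvPolynomial.mem_zeroLocus_iff, MvPolynomial.aeval_eq_eval]
  rw [this]
  exact isClosed_biInter fun f _ => isClosed_eq (MvPolynomial.continuous_eval f) continuous_const

theorem torusMap_mem_toricVariety (τ : (Fin n → ℂˣ) × (Fin k → ℂˣ)) :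
    D.torusMap τ ∈ D.toricVariety := by
  rw [toricVariety, MvPolynomial.mem_zeroLocus_iff]
  intro f hf
  exact MvPolynomial.mem_vanishingIdeal_iff.1 hf _ ⟨τ, rfl⟩

theorem eval_eq_zero_of_mem_toricVariety {z : D.Ambient} (hz : z ∈ D.toricVariety)
    {f : MvPolynomial D.genSet ℂ} (hf : ∀ τ, MvPolynomial.eval (D.torusMap τ) f = 0) :
    MvPolynomial.eval z f = 0 := by
  rw [toricVariety, MvPolynomial.mem_zeroLocus_iff] at hz
  refine hz f (MvPolynomial.mem_vanishingIdeal_iff.2 ?_)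
  rintro _ ⟨τ, rfl⟩
  exact hf τ

/-- An additive relation between exponents gives a binomial that vanishes on the torus image, hence
on its Zariski closure. -/
theorem prod_pow_eq_prod_pow {z : D.Ambient} (hz : z ∈ D.toricVariety) {J : Type*} [Fintype J]
    (c : J → D.genSet) (e f : J → ℕ) (h : ∑ j, e j • (c j).1 = ∑ j, f j • (c j).1) :
    ∏ j, z (c j) ^ e j = ∏ j, z (c j) ^ f j := by
  have h := D.eval_eq_zero_of_mem_toricVariety hz
    (f := ∏ j, MvPolynomial.X (c j) ^ e j - ∏ j, MvPolynomial.X (c j) ^ f j) (by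
    intro τ
    have h2 := congrArg (fun u => (((torusChar τ u).toMul : ℂˣ) : ℂ)) h
    simp only [map_sum, map_nsmul, toMul_sum, toMul_nsmul, Units.coe_prod,
      Units.val_pow_eq_pow_val, ← torusMap_eq_torusChar] at h2
    simp [h2])
  simpa [map_sub, map_prod, map_pow, MvPolynomial.eval_X, sub_eq_zero] using h

theorem apply_eq_prod_zpow {z : D.Ambient} (hz : z ∈ D.toricVariety) {J : Type*} [Fintype J]
    (c : J → D.genSet) (e : J → ℤ) (q : D.genSet) (hq : q.1 = ∑ j, e j • (c j).1)
    (he : ∀ j, e j < 0 → z (c j) ≠ 0) : z q = ∏ j, z (c j) ^ e j := by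
  -- Negative powers are moved to the side of `q`; the `Unit` summand is the factor `z q`.
  have h := D.prod_pow_eq_prod_pow hz (Sum.elim c fun _ : Unit => q)
    (Sum.elim (fun j => (-e j).toNat) fun _ => 1) (Sum.elim (fun j => (e j).toNat) fun _ => 0) (by
      simp only [Fintype.sum_sum_type, Sum.elim_inl, Sum.elim_inr, Finset.univ_unique,
        Finset.sum_singleton, one_smul, zero_smul, add_zero]
      rw [hq, ← Finset.sum_add_distrib]
      refine Finset.sum_congr rfl fun j _ => ?_
      rw [← natCast_zsmul, ← natCast_zsmul, ← add_smul]
      congr 1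
      omega)
  simp only [Fintype.prod_sum_type, Sum.elim_inl, Sum.elim_inr, Finset.univ_unique,
    Finset.prod_singleton, pow_one, pow_zero, mul_one] at h
  have hne : ∏ j, z (c j) ^ (-e j).toNat ≠ 0 := by
    refine Finset.prod_ne_zero_iff.2 fun j _ => ?_
    rcases lt_or_ge (e j) 0 with hj | hj
    · exact pow_ne_zero _ (he j hj)
    · rw [show (-e j).toNat = 0 by omega, pow_zero]
      exact one_ne_zero
  refine mul_left_cancel₀ hne (h.trans ?_)
  rw [← Finset.prod_mul_distrib]
  refine Finset.prod_congr rfl fun j _ => ?_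
  rcases lt_or_ge (e j) 0 with hj | hj
  · rw [show (e j).toNat = 0 by omega, pow_zero, ← zpow_natCast, ← zpow_add₀ (he j hj),
      show ((-e j).toNat : ℤ) + e j = 0 by omega, zpow_zero]
  · rw [show (-e j).toNat = 0 by omega, pow_zero, one_mul, ← zpow_natCast,
      show ((e j).toNat : ℤ) = e j by omega]

/-- The point with coordinates `s` and `T`, given by monomials. -/
def mono (p : Fin k) (s : Fin (n + 1) → ℂ) (T : Fin k → ℂ) : D.Ambient := fun q =>
  (∏ j, s j ^ D.expo p q.1 j) * ∏ i, T i ^ D.texpo p q.1 i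

section Mono

variable (p : Fin k) (s : Fin (n + 1) → ℂ) (T : Fin k → ℂ)

theorem mono_congr {T T' : Fin k → ℂ} (h : ∀ i, i ≠ p → T i = T' i) :
    D.mono p s T = D.mono p s T' := by
  funext q
  unfold mono
  congr 1
  refine Finset.prod_congr rfl fun i _ => ?_
  rcases eq_or_ne i p with rfl | hi
  · simp [texpo_self]
  · rw [h i hi]

@[simp]
theorem mono_coord (j : Fin (n + 1)) : D.mono p s T (D.coord p j) = s j := by
  unfold mono
  rw [expo_coord, texpo_coord, Finset.prod_eq_single j]
  · simp
  · intro i _ hi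
    simp [hi]
  · simp

theorem mono_t_of_ne {i : Fin k} (hi : i ≠ p) : D.mono p s T (D.t i) = T i := by
  unfold mono
  rw [expo_t_of_ne D p hi, texpo_t_of_ne D p hi, Finset.prod_eq_single (a := i)
    (f := fun l => T l ^ (Pi.single i (1 : ℤ) : Fin k → ℤ) l)]
  · simp
  · intro l _ hl
    simp [hl]
  · simp

theorem mono_t_self : D.mono p s T (D.t p)
    = (∏ j ∈ D.bdry p, s j) * ∏ i, T i ^ D.texpo p (D.t p).1 i := by
  unfold mono
  have h : ∀ j, s j ^ D.expo p (D.t p).1 j = if j ∈ D.bdry p then s j else 1 := fun j => by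
    rw [expo_t_self]
    split_ifs <;> simp
  simp only [h, Finset.prod_ite_mem, Finset.univ_inter]

variable {p s T}

theorem mono_ne_zero (hs : ∀ j, s j ≠ 0) (hT : ∀ i, i ≠ p → T i ≠ 0) (q : D.genSet) :
    D.mono p s T q ≠ 0 := by
  refine mul_ne_zero (Finset.prod_ne_zero_iff.2 fun j _ => zpow_ne_zero _ (hs j))
    (Finset.prod_ne_zero_iff.2 fun i _ => ?_)
  rcases eq_or_ne i p with rfl | hi
  · simp [texpo_self]
  · exact zpow_ne_zero _ (hT i hi)

/-- A non-boundary coordinate is some `w⁺`; the binomial relation makes `w⁺ w⁻` a monomial in the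
`t_i`, in which `t_p` has exponent 0. -/
theorem coord_ne_zero {z : D.Ambient} (hz : z ∈ D.toricVariety) (ht : ∀ i, i ≠ p → z (D.t i) ≠ 0)
    {j : Fin (n + 1)} (hj : j ∉ D.bdry p) : z (D.coord p j) ≠ 0 := by
  induction j using Fin.lastCases with
  | last => exact absurd (D.last_mem_bdry p) hj
  | cast j =>
    rw [castSucc_mem_bdry, not_lt] at hj
    rw [coord_castSucc]
    have key := D.prod_pow_eq_prod_pow hz
      (Sum.elim (Sum.elim (fun _ : Unit => D.xw p j) fun _ : Unit => D.wneg p j hj) D.t)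
      (Sum.elim (Sum.elim 1 1) 0)
      (Sum.elim 0 fun i => (D.phi (D.zcol p j) i + D.phi (-D.zcol p j) i).toNat) (by
        have h : ∀ i, ((D.phi (D.zcol p j) i + D.phi (-D.zcol p j) i).toNat : ℤ)
            = D.phi (D.zcol p j) i + D.phi (-D.zcol p j) i := fun i =>
          Int.toNat_of_nonneg (add_nonneg (D.phi_nonneg i _) (D.phi_nonneg i _))
        simp only [Fintype.sum_sum_type, Sum.elim_inl, Sum.elim_inr, Pi.one_apply, Pi.zero_apply,
          one_smul, zero_smul, Finset.sum_const_zero, Finset.univ_unique, Finset.sum_singleton,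
          zero_add, add_zero, ← natCast_zsmul, h, Nat.cast_one, Nat.cast_zero]
        refine Prod.ext ?_ ?_
        · rw [Prod.fst_sum]
          simp [xw, wneg, tilde, t]
        · rw [Prod.snd_sum]
          ext i
          simp [xw, wneg, tilde, t, Finset.sum_apply, Pi.single_apply])
    simp only [Fintype.prod_sum_type, Sum.elim_inl, Sum.elim_inr, Pi.one_apply, Pi.zero_apply,
      pow_one, pow_zero, Finset.prod_const_one, Finset.univ_unique, Finset.prod_singleton,
      one_mul, mul_one] at key
    refine left_ne_zero_of_mul (b := z (D.wneg p j hj)) ?_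
    rw [key]
    refine Finset.prod_ne_zero_iff.2 fun i _ => ?_
    rcases eq_or_ne i p with rfl | hi
    · simp [D.phi_neg_zcol_self i hj]
    · exact pow_ne_zero _ (ht i hi)

theorem eq_mono {z : D.Ambient} (hz : z ∈ D.toricVariety) (ht : ∀ i, i ≠ p → z (D.t i) ≠ 0) :
    z = D.mono p (fun j => z (D.coord p j)) (fun i => z (D.t i)) := by
  funext q
  have := D.apply_eq_prod_zpow hz (Sum.elim (D.coord p) D.t)
    (Sum.elim (D.expo p q.1) (D.texpo p q.1)) q
    (by simpa using D.eq_sum_expo_add_sum_texpo p q.1) (by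
      rintro (j | i) h
      · by_cases hj : j ∈ D.bdry p
        · exact absurd (D.expo_nonneg p q hj) (not_le.2 h)
        · exact D.coord_ne_zero hz ht hj
      · refine ht i ?_
        rintro rfl
        simp [texpo_self] at h)
  simpa [mono] using this

/-- `X_p` is invertible over `ℤ`, so the values of the `x_{p,j}`, `w⁺_{p,l}` and of the `t_i` can be
prescribed by a torus element; the last coordinate is then forced by the value of `t_p`. -/
theorem exists_torusMap_eq_mono (hs : ∀ j, s j ≠ 0) (hT : ∀ i, i ≠ p → T i ≠ 0) :
    ∃ τ, D.torusMap τ = D.mono p s T := by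
  set T' : Fin k → ℂ := fun i => D.mono p s T (D.t i) with hT'
  have hT0 : ∀ i, T' i ≠ 0 := fun i => D.mono_ne_zero hs hT _
  let U : Fin k → ℂˣ := fun i => Units.mk0 (T' i) (hT0 i)
  -- The value of the character `(a_{p,j}, 0)` or `(c_{p,l}, 0)`, after division by the contribution
  -- of the `t_i`.
  let σ : Fin n → ℂˣ := fun j =>
    Units.mk0 (s j.castSucc) (hs _) * (∏ i, U i ^ D.phi (D.zcol p j) i)⁻¹
  let τ : (Fin n → ℂˣ) × (Fin k → ℂˣ) := (fun a => ∏ j, σ j ^ D.X p j a, U)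
  have ht : ∀ i, D.torusMap τ (D.t i) = T' i := by
    intro i
    have : (∏ l, U l ^ (Pi.single i (1 : ℤ) : Fin k → ℤ) l) = U i := by
      rw [Finset.prod_eq_single i]
      · simp
      · intro l _ hl
        simp [hl]
      · simp
    simp [torusMap, t, τ, this, U]
  have hx : ∀ j, D.torusMap τ (D.xw p j) = s j.castSucc := by
    intro j
    have h1 : ∏ a, (∏ l, σ l ^ D.X p l a) ^ D.zcol p j a = σ j := by
      simp only [← Finset.prod_zpow, ← zpow_mul]
      rw [Finset.prod_comm]
      have h2 : ∀ l, ∏ a, σ l ^ (D.X p l a * D.zcol p j a) = σ l ^ (if l = j then 1 else 0 : ℤ) :=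
        fun l => by rw [← row_dot_zcol, prod_zpow_eq_zpow_sum, dotProduct]
      rw [Finset.prod_congr rfl fun l _ => h2 l, Finset.prod_eq_single j]
      · simp
      · intro l _ hl
        simp [hl]
      · simp
    simp only [torusMap, xw, tilde, τ, h1, σ]
    simp
  refine ⟨τ, ?_⟩
  have hτ := D.torusMap_mem_toricVariety τ
  have hτ0 : ∀ q, D.torusMap τ q ≠ 0 := fun q => Units.ne_zero _
  rw [D.eq_mono hτ (p := p) fun i _ => hτ0 _]
  have hTT : ∀ i, i ≠ p → D.torusMap τ (D.t i) = T i := fun i hi => by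
    rw [ht, hT']
    exact D.mono_t_of_ne p s T hi
  rw [D.mono_congr p _ hTT]
  congr 1
  funext j
  induction j using Fin.lastCases with
  | cast j => rw [coord_castSucc, hx]
  | last =>
    have h1 : D.mono p (fun j => D.torusMap τ (D.coord p j)) T (D.t p) = D.mono p s T (D.t p) := by
      rw [← D.mono_congr p _ hTT, ← D.eq_mono hτ fun i _ => hτ0 _, ht]
    rw [mono_t_self, mono_t_self] at h1
    have h2 := mul_right_cancel₀ (Finset.prod_ne_zero_iff.2 fun i _ => by
      rcases eq_or_ne i p with rfl | hi
      · simp [texpo_self]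
      · exact zpow_ne_zero _ (hT i hi)) h1
    rw [← Finset.mul_prod_erase _ _ (D.last_mem_bdry p),
      ← Finset.mul_prod_erase _ s (D.last_mem_bdry p)] at h2
    have h3 : ∀ j ∈ (D.bdry p).erase (Fin.last n), D.torusMap τ (D.coord p j) = s j := by
      intro j hj
      induction j using Fin.lastCases with
      | last => simp at hj
      | cast j => rw [coord_castSucc, hx]
    rw [Finset.prod_congr rfl h3] at h2
    exact mul_right_cancel₀ (Finset.prod_ne_zero_iff.2 fun j _ => hs j) h2

theorem continuousAt_mono (q : D.genSet) (hs : ∀ j ∉ D.bdry p, s j ≠ 0) :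
    ContinuousAt (fun s => D.mono p s T q) s := by
  refine ContinuousAt.mul ?_ continuousAt_const
  refine tendsto_finsetProd _ fun j _ => ?_
  refine ContinuousAt.zpow₀ (continuous_apply j).continuousAt _ ?_
  by_cases hj : j ∈ D.bdry p
  · exact Or.inr (D.expo_nonneg p q hj)
  · exact Or.inl (hs j hj)

/-- The points with no vanishing coordinate are dense and lie in the torus image; the monomials are
continuous up to the boundary and the variety is closed. -/
theorem mono_mem_toricVariety (hs : ∀ j ∉ D.bdry p, s j ≠ 0) (hT : ∀ i, i ≠ p → T i ≠ 0) :
    D.mono p s T ∈ D.toricVariety := by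
  have hdense : Dense {s : Fin (n + 1) → ℂ | ∀ j, s j ≠ 0} := by
    have := dense_pi (Set.univ : Set (Fin (n + 1))) (fun _ _ => dense_compl_singleton (0 : ℂ))
    convert this
    ext s
    simp
  have hc : ContinuousAt (fun s => D.mono p s T) s :=
    continuousAt_pi.2 fun q => D.continuousAt_mono q hs
  have := mem_closure_iff_nhdsWithin_neBot.1 (hdense s)
  refine D.isClosed_toricVariety.closure_subset
    (mem_closure_of_tendsto (hc.mono_left (nhdsWithin_le_nhds (s := {s | ∀ j, s j ≠ 0})))
      (eventually_nhdsWithin_of_forall fun s hs => ?_))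
  obtain ⟨τ, hτ⟩ := D.exists_torusMap_eq_mono hs hT
  rw [← hτ]
  exact D.torusMap_mem_toricVariety τ

end Mono

end AdmissibleDecomposition

/-! ### Local inverses, integer powers and the pairing with weights. -/

theorem ContDiffAt.exists_local_inverse {𝕜 E F : Type*} [RCLike 𝕜] [NormedAddCommGroup E]
    [NormedSpace 𝕜 E] [NormedAddCommGroup F] [NormedSpace 𝕜 F] [CompleteSpace E] {f : E → F}
    {f' : E ≃L[𝕜] F} {a : E} (hf : ContDiffAt 𝕜 ω f a) (hf' : HasFDerivAt f (f' : E →L[𝕜] F) a) :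
    ∃ g : F → E, ContDiffAt 𝕜 ω g (f a) ∧ g (f a) = a ∧ (∀ᶠ x in 𝓝 a, g (f x) = x) ∧
      ∀ᶠ y in 𝓝 (f a), f (g y) = y :=
  ⟨hf.localInverse hf' (by simp), hf.to_localInverse hf' (by simp),
    hf.localInverse_apply_image hf' (by simp),
    (hf.hasStrictFDerivAt' hf' (by simp)).eventually_left_inverse,
    (hf.hasStrictFDerivAt' hf' (by simp)).eventually_right_inverse⟩

theorem AnalyticAt.zpow_of_ne_zero_or_nonneg {E : Type*} [NormedAddCommGroup E] [NormedSpace ℂ E]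
    {f : E → ℂ} {x : E} (hf : AnalyticAt ℂ f x) (e : ℤ) (h : f x ≠ 0 ∨ 0 ≤ e) :
    AnalyticAt ℂ (fun y => f y ^ e) x := by
  rcases h with h | h
  · exact hf.fun_zpow h
  · exact hf.zpow_nonneg h

/-- The pairing of an integral weight with a complex vector. -/
def weightPairing {n : ℕ} (v : Fin n → ℤ) : (Fin n → ℂ) →L[ℂ] ℂ :=
  ∑ a, (v a : ℂ) • ContinuousLinearMap.proj a

theorem weightPairing_apply {n : ℕ} (v : Fin n → ℤ) (ζ : Fin n → ℂ) :
    weightPairing v ζ = ∑ a, (v a : ℂ) * ζ a := by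
  simp [weightPairing]

@[simp]
theorem weightPairing_zero {n : ℕ} : weightPairing (0 : Fin n → ℤ) = 0 := by
  ext ζ
  simp [weightPairing_apply]

theorem weightPairing_sum {n : ℕ} {J : Type*} (S : Finset J) (e : J → ℤ) (v : J → Fin n → ℤ)
    (ζ : Fin n → ℂ) :
    weightPairing (∑ j ∈ S, e j • v j) ζ = ∑ j ∈ S, (e j : ℂ) * weightPairing (v j) ζ := by
  simp only [weightPairing_apply, Finset.sum_apply, Pi.smul_apply, smul_eq_mul, Int.cast_sum,
    Int.cast_mul, Finset.sum_mul, Finset.mul_sum]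
  rw [Finset.sum_comm]
  simp only [mul_assoc]

namespace AdmissibleDecomposition

variable {n k : ℕ} (D : AdmissibleDecomposition n k)

/-! ### The action of the complex torus -/

/-- The action of the complex torus, in logarithmic coordinates. -/
def act (ζ : Fin n → ℂ) (w : D.Ambient) : D.Ambient := fun q =>
  Complex.exp (weightPairing q.1.1 ζ) * w q

theorem act_apply_t (ζ : Fin n → ℂ) (w : D.Ambient) (i : Fin k) :
    D.act ζ w (D.t i) = w (D.t i) := by
  have : (D.t i).1.1 = 0 := rfl
  simp [act, this]

theorem act_mono (p : Fin k) (ζ : Fin n → ℂ) (s : Fin (n + 1) → ℂ) (T : Fin k → ℂ) :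
    D.act ζ (D.mono p s T)
      = D.mono p (fun j => Complex.exp (weightPairing (D.coord p j).1.1 ζ) * s j) T := by
  funext q
  simp only [act, mono, mul_zpow, Finset.prod_mul_distrib]
  rw [mul_assoc]
  congr 1
  conv_lhs => rw [← D.sum_expo_smul_fst p q.1, weightPairing_sum, Complex.exp_sum]
  exact Finset.prod_congr rfl fun j _ => Complex.exp_int_mul _ _

theorem sum_bdry_weightPairing (p : Fin k) (ζ : Fin n → ℂ) :
    ∑ j ∈ D.bdry p, weightPairing (D.coord p j).1.1 ζ = 0 := by
  have := weightPairing_sum (D.bdry p) (fun _ => 1) (fun j => (D.coord p j).1.1) ζ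
  simpa [D.sum_bdry_fst p] using this.symm

/-- The vector whose pairings with the weights of the coordinates are the given numbers. -/
def solveWeights (p : Fin k) : (Fin (n + 1) → ℂ) →L[ℂ] (Fin n → ℂ) :=
  ContinuousLinearMap.pi fun a => ∑ j : Fin n, (D.X p j a : ℂ) • ContinuousLinearMap.proj j.castSucc

theorem solveWeights_apply (p : Fin k) (L : Fin (n + 1) → ℂ) (a : Fin n) :
    D.solveWeights p L a = ∑ j : Fin n, (D.X p j a : ℂ) * L j.castSucc := by
  simp [solveWeights]

/-- The `n + 1` weights satisfy one relation, that of the boundary. Solving with the first `n`,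
which form a basis, therefore gives the right value on the last. -/
theorem weightPairing_solveWeights (p : Fin k) {L : Fin (n + 1) → ℂ} (hL : ∑ j ∈ D.bdry p, L j = 0)
    (j : Fin (n + 1)) : weightPairing (D.coord p j).1.1 (D.solveWeights p L) = L j := by
  have h : ∀ v : Fin n → ℤ, weightPairing v (D.solveWeights p L)
      = ∑ i : Fin n, ((D.X p i ⬝ᵥ v : ℤ) : ℂ) * L i.castSucc := by
    intro v
    simp only [weightPairing_apply, solveWeights_apply, dotProduct, Int.cast_sum, Int.cast_mul,
      Finset.mul_sum, Finset.sum_mul]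
    rw [Finset.sum_comm]
    exact Finset.sum_congr rfl fun i _ => Finset.sum_congr rfl fun a _ => by ring
  rw [h]
  induction j using Fin.lastCases with
  | cast j =>
    have : (D.xw p j).1.1 = D.zcol p j := rfl
    simp [this, row_dot_zcol]
  | last =>
    have h2 : ∑ j ∈ D.bdry p, L j = ∑ j : Fin n, (if j.val < D.m p then L j.castSucc else 0)
        + L (Fin.last n) := by
      rw [← Finset.univ_inter (D.bdry p), ← Finset.sum_ite_mem, Fin.sum_univ_castSucc]
      simp only [castSucc_mem_bdry, last_mem_bdry, if_true]
    rw [hL] at h2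
    rw [coord_last, yc_fst, eq_neg_of_add_eq_zero_right h2.symm, ← Finset.sum_neg_distrib]
    refine Finset.sum_congr rfl fun j _ => ?_
    rw [row_dot_b]
    split_ifs <;> simp

theorem solveWeights_weightPairing (p : Fin k) (ζ : Fin n → ℂ) :
    D.solveWeights p (fun j => weightPairing (D.coord p j).1.1 ζ) = ζ := by
  have h := Matrix.nonsing_inv_mul (D.X p) (D.isUnit_det p)
  ext a
  have h1 : ∀ c, ∑ j, D.X p j a * D.zcol p j c = if c = a then 1 else 0 := by
    intro c
    rw [← Matrix.one_apply, ← h, Matrix.mul_apply]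
    exact Finset.sum_congr rfl fun j _ => mul_comm _ _
  have h2 : ∀ j : Fin n, (D.coord p j.castSucc).1.1 = D.zcol p j := by
    intro j
    rw [coord_castSucc]
    rfl
  simp only [solveWeights_apply, h2, weightPairing_apply, Finset.mul_sum]
  rw [Finset.sum_comm]
  have h3 : ∀ c, ∑ j, (D.X p j a : ℂ) * ((D.zcol p j c : ℂ) * ζ c)
      = (if c = a then 1 else 0) * ζ c := by
    intro c
    have := congrArg (fun e : ℤ => (e : ℂ)) (h1 c)
    push_cast at this
    rw [← this, Finset.sum_mul]
    exact Finset.sum_congr rfl fun j _ => by ring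
  simp [h3]

/-! ### The deformation in monomial coordinates -/

theorem analyticAt_mono {E : Type*} [NormedAddCommGroup E] [NormedSpace ℂ E] {p : Fin k}
    {s : E → Fin (n + 1) → ℂ} {T : E → Fin k → ℂ} {x : E} (hs : AnalyticAt ℂ s x)
    (hT : AnalyticAt ℂ T x) (hs0 : ∀ j ∉ D.bdry p, s x j ≠ 0) (hT0 : ∀ i, i ≠ p → T x i ≠ 0) :
    AnalyticAt ℂ (fun y => D.mono p (s y) (T y)) x := by
  refine analyticAt_pi_iff.2 fun q => ?_
  refine AnalyticAt.mul (Finset.analyticAt_fun_prod _ fun j _ => ?_)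
    (Finset.analyticAt_fun_prod _ fun i _ => ?_)
  · refine (analyticAt_pi_iff.1 hs j).zpow_of_ne_zero_or_nonneg _ ?_
    by_cases hj : j ∈ D.bdry p
    · exact Or.inr (D.expo_nonneg p q hj)
    · exact Or.inl (hs0 j hj)
  · refine (analyticAt_pi_iff.1 hT i).zpow_of_ne_zero_or_nonneg _ ?_
    rcases eq_or_ne i p with rfl | hi
    · exact Or.inr (D.texpo_self i q.1).ge
    · exact Or.inl (hT0 i hi)

/-- The values of the coordinates `t_i` on the deformation. -/
def shift (ε : Fin k → ℂ) (t : ℂ) : Fin k → ℂ := fun i => t - ε i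

theorem analyticAt_shift (ε : Fin k → ℂ) (t : ℂ) : AnalyticAt ℂ (shift ε) t :=
  analyticAt_pi_iff.2 fun _ => analyticAt_id.sub analyticAt_const

/-- The unit `v_p` in the equation `t_p = v_p ∏ x_{p,j} y_p`. -/
def unitFactor (p : Fin k) (ε : Fin k → ℂ) (t : ℂ) : ℂ :=
  ∏ i, shift ε t i ^ D.texpo p (D.t p).1 i

theorem unitFactor_ne_zero {p : Fin k} {ε : Fin k → ℂ} {t : ℂ} (ht : ∀ i, i ≠ p → t ≠ ε i) :
    D.unitFactor p ε t ≠ 0 := by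
  refine Finset.prod_ne_zero_iff.2 fun i _ => ?_
  rcases eq_or_ne i p with rfl | hi
  · simp [texpo_self]
  · exact zpow_ne_zero _ (sub_ne_zero.2 (ht i hi))

theorem analyticAt_unitFactor {p : Fin k} {ε : Fin k → ℂ} {t : ℂ} (ht : ∀ i, i ≠ p → t ≠ ε i) :
    AnalyticAt ℂ (D.unitFactor p ε) t := by
  refine Finset.analyticAt_fun_prod _ fun i _ => ?_
  refine (analyticAt_id.sub analyticAt_const).zpow_of_ne_zero_or_nonneg _ ?_
  rcases eq_or_ne i p with rfl | hi
  · exact Or.inr (D.texpo_self i _).ge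
  · exact Or.inl (sub_ne_zero.2 (ht i hi))

variable {ε : Fin k → ℂ}

theorem mono_shift_t {p : Fin k} {s : Fin (n + 1) → ℂ} {t : ℂ}
    (h : (∏ j ∈ D.bdry p, s j) * D.unitFactor p ε t = t - ε p) (i : Fin k) :
    D.mono p s (shift ε t) (D.t i) = t - ε i := by
  rcases eq_or_ne i p with rfl | hi
  · rw [mono_t_self]
    exact h
  · exact D.mono_t_of_ne p s _ hi

theorem analyticAt_act {E : Type*} [NormedAddCommGroup E] [NormedSpace ℂ E]
    {ζ : E → Fin n → ℂ} {w : E → D.Ambient} {x : E} (hζ : AnalyticAt ℂ ζ x)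
    (hw : AnalyticAt ℂ w x) : AnalyticAt ℂ (fun y => D.act (ζ y) (w y)) x :=
  analyticAt_pi_iff.2 fun q => (((weightPairing q.1.1).analyticAt _).comp hζ).cexp'.mul
    (analyticAt_pi_iff.1 hw q)

/-- The logarithms of the coordinates, corrected so that those with index in `bdry` add up to 0. -/
def logCoord (p : Fin k) (j₀ : Fin (n + 1)) (z w : D.Ambient) : Fin (n + 1) → ℂ :=
  Function.update (fun j => Complex.log (w (D.coord p j) / z (D.coord p j))) j₀
    (-∑ j ∈ (D.bdry p).erase j₀, Complex.log (w (D.coord p j) / z (D.coord p j)))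

theorem sum_logCoord {p : Fin k} {j₀ : Fin (n + 1)} (hj₀ : j₀ ∈ D.bdry p) (z w : D.Ambient) :
    ∑ j ∈ D.bdry p, D.logCoord p j₀ z w j = 0 := by
  rw [← Finset.add_sum_erase _ _ hj₀]
  have : ∀ j ∈ (D.bdry p).erase j₀, D.logCoord p j₀ z w j
      = Complex.log (w (D.coord p j) / z (D.coord p j)) := fun j hj => by
    rw [logCoord, Function.update_of_ne (Finset.ne_of_mem_erase hj)]
  rw [Finset.sum_congr rfl this, logCoord, Function.update_self, neg_add_cancel]

/-- The function `(t - ε_p) / v_p(t)` has derivative `1 / v_p(ε_p) ≠ 0` at `ε_p`; `G` is its local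
inverse and recovers `t_1` from the product of the boundary coordinates. -/
theorem exists_solution_of_product (hε : Function.Injective ε) (p : Fin k) :
    ∃ G : ℂ → ℂ, AnalyticAt ℂ G 0 ∧ G 0 = ε p ∧
      (∀ᶠ t in 𝓝 (ε p), ∀ y, y * D.unitFactor p ε t = t - ε p → G y = t) ∧
      ∀ᶠ y in 𝓝 0, y * D.unitFactor p ε (G y) = G y - ε p := by
  have hne : ∀ i, i ≠ p → ε p ≠ ε i := fun i hi h => hi (hε h).symm
  have hv0 := D.unitFactor_ne_zero hne
  have hva := D.analyticAt_unitFactor hne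
  set F : ℂ → ℂ := fun t => (t - ε p) * (D.unitFactor p ε t)⁻¹ with hF
  have hFa : AnalyticAt ℂ F (ε p) := (analyticAt_id.sub analyticAt_const).mul (hva.inv hv0)
  have hF0 : F (ε p) = 0 := by simp [hF]
  have hder : HasDerivAt F (D.unitFactor p ε (ε p))⁻¹ (ε p) := by
    have := ((hasDerivAt_id (ε p)).sub_const (ε p)).mul (hva.inv hv0).differentiableAt.hasDerivAt
    simpa using! this
  have hev : ∀ᶠ t in 𝓝 (ε p), D.unitFactor p ε t ≠ 0 := hva.continuousAt.eventually_ne hv0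
  obtain ⟨G, hG, hG0, hGl, hGr⟩ := ContDiffAt.exists_local_inverse (𝕜 := ℂ) (f := F) (a := ε p)
    (f' := ContinuousLinearEquiv.unitsEquivAut ℂ (Units.mk0 _ (inv_ne_zero hv0))) hFa.contDiffAt
    (by
      refine hder.hasFDerivAt.congr_fderiv ?_
      ext
      simp)
  rw [hF0] at hG hG0 hGr
  refine ⟨G, hG.analyticAt, hG0, ?_, ?_⟩
  · filter_upwards [hGl, hev] with t h1 h2 y hy
    rw [← h1]
    congr 1
    rw [hF]
    simp only
    rw [← hy, mul_assoc, mul_inv_cancel₀ h2, mul_one]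
  · have : Filter.Tendsto G (𝓝 0) (𝓝 (ε p)) := by
      simpa only [ContinuousAt, hG0] using hG.continuousAt
    filter_upwards [hGr, this.eventually hev] with y h1 h2
    exact ((eq_mul_inv_iff_mul_eq₀ h2).1 h1.symm)

variable [NeZero k]

theorem apply_t {z : D.Ambient} (hz : z ∈ D.deformation ε) (i : Fin k) :
    z (D.t i) = z (D.t 0) - ε i := by
  rw [← hz.2 i]
  ring

theorem mono_shift_mem_divisorComplement (hε : ε 0 = 0) {p : Fin k} {s : Fin (n + 1) → ℂ} {t : ℂ}
    (hs : ∀ j ∉ D.bdry p, s j ≠ 0) (ht : ∀ i, i ≠ p → t ≠ ε i) (ht1 : t ≠ 1)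
    (h : (∏ j ∈ D.bdry p, s j) * D.unitFactor p ε t = t - ε p) :
    D.mono p s (shift ε t) ∈ D.divisorComplement ε := by
  have h1 := D.mono_shift_t h
  refine ⟨⟨D.mono_mem_toricVariety hs fun i hi => sub_ne_zero.2 (ht i hi), fun i => ?_⟩, ?_⟩
  · rw [h1, h1, hε]
    ring
  · rw [h1, hε, sub_zero]
    exact ht1

section Points

variable {z : D.Ambient} {p : Fin k}

theorem apply_t_ne_zero (hz : z ∈ D.deformation ε) (ht : ∀ i, i ≠ p → z (D.t 0) ≠ ε i) (i : Fin k)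
    (hi : i ≠ p) : z (D.t i) ≠ 0 := by
  rw [D.apply_t hz]
  exact sub_ne_zero.2 (ht i hi)

theorem coord_ne_zero_of_mem_deformation (hz : z ∈ D.deformation ε)
    (ht : ∀ i, i ≠ p → z (D.t 0) ≠ ε i) {j : Fin (n + 1)} (hj : j ∉ D.bdry p) :
    z (D.coord p j) ≠ 0 :=
  D.coord_ne_zero hz.1 (D.apply_t_ne_zero hz ht) hj

theorem eq_mono_shift (hz : z ∈ D.deformation ε) (ht : ∀ i, i ≠ p → z (D.t 0) ≠ ε i) :
    z = D.mono p (fun j => z (D.coord p j)) (shift ε (z (D.t 0))) := by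
  conv_lhs => rw [D.eq_mono hz.1 (D.apply_t_ne_zero hz ht)]
  exact D.mono_congr p _ fun i _ => D.apply_t hz i

theorem prod_coord_mul_unitFactor (hz : z ∈ D.deformation ε)
    (ht : ∀ i, i ≠ p → z (D.t 0) ≠ ε i) :
    (∏ j ∈ D.bdry p, z (D.coord p j)) * D.unitFactor p ε (z (D.t 0)) = z (D.t 0) - ε p := by
  rw [← D.apply_t hz p]
  conv_rhs => rw [D.eq_mono_shift hz ht, mono_t_self]
  rfl

end Points

/-! ### The chart at the points of a degenerate fibre -/

/-- The parametrization of the deformation by the coordinates `x_{p,j}`, `w⁺_{p,l}` and `y_p`. -/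
def graphParam (p : Fin k) (ε : Fin k → ℂ) (G : ℂ → ℂ) (s : Fin (n + 1) → ℂ) : D.Ambient :=
  D.mono p s (shift ε (G (∏ j ∈ D.bdry p, s j)))

/-- The deformation is locally the graph of the remaining ambient coordinates over these `n + 1`, so
the inverse is a coordinate projection. No condition on how many boundary coordinates vanish is
needed. -/
theorem isChart_graphParam (hε : ε 0 = 0) (hεi : Function.Injective ε) {z : D.Ambient} {p : Fin k}
    (hz : z ∈ D.divisorComplement ε) (hp : z (D.t 0) = ε p) {G : ℂ → ℂ} (hG : AnalyticAt ℂ G 0)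
    (hG0 : G 0 = ε p)
    (hGl : ∀ᶠ t in 𝓝 (ε p), ∀ y, y * D.unitFactor p ε t = t - ε p → G y = t)
    (hGr : ∀ᶠ y in 𝓝 0, y * D.unitFactor p ε (G y) = G y - ε p) :
    IsChart ℂ (n + 1) (D.divisorComplement ε) z
      (fun s => D.graphParam p ε G ((fun j => z (D.coord p j)) + s))
      (fun w j => w (D.coord p j) - z (D.coord p j)) ∧
    ∏ j ∈ D.bdry p, z (D.coord p j) = 0 := by
  have hne : ∀ i, i ≠ p → ε p ≠ ε i := fun i hi h => hi (hεi h).symm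
  have ht : ∀ i, i ≠ p → z (D.t 0) ≠ ε i := by rwa [hp]
  set c : Fin (n + 1) → ℂ := fun j => z (D.coord p j) with hc
  have hc0 : ∀ j ∉ D.bdry p, c j ≠ 0 := fun j hj => D.coord_ne_zero_of_mem_deformation hz.1 ht hj
  have hprod : ∏ j ∈ D.bdry p, c j = 0 := by
    have := D.prod_coord_mul_unitFactor hz.1 ht
    rw [hp, sub_self] at this
    exact (mul_eq_zero.1 this).resolve_right (D.unitFactor_ne_zero hne)
  have hPa : AnalyticAt ℂ (fun s : Fin (n + 1) → ℂ => ∏ j ∈ D.bdry p, (c + s) j) 0 :=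
    Finset.analyticAt_fun_prod _ fun j _ =>
      analyticAt_const.add ((ContinuousLinearMap.proj (R := ℂ) (φ := fun _ => ℂ) j).analyticAt 0)
  have hP0 : (fun s : Fin (n + 1) → ℂ => ∏ j ∈ D.bdry p, (c + s) j) 0 = 0 := by
    simpa using hprod
  have hTa : AnalyticAt ℂ (fun s : Fin (n + 1) → ℂ => G (∏ j ∈ D.bdry p, (c + s) j)) 0 :=
    hG.comp_of_eq hPa hP0
  have hT0 : (fun s : Fin (n + 1) → ℂ => G (∏ j ∈ D.bdry p, (c + s) j)) 0 = ε p := by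
    simp only at hP0 ⊢
    rw [hP0, hG0]
  have hΨ0 : D.graphParam p ε G (c + 0) = z := by
    conv_rhs => rw [D.eq_mono_shift hz.1 ht]
    rw [graphParam, add_zero, hprod, hG0, hp]
  refine ⟨⟨hΨ0, ?_, ?_, ?_, ?_, ?_⟩, hprod⟩
  · refine AnalyticAt.contDiffAt ?_
    refine D.analyticAt_mono (analyticAt_const.add analyticAt_id)
      ((analyticAt_shift ε (ε p)).comp_of_eq hTa hT0) ?_ ?_
    · simpa using hc0
    · intro i hi
      simp only at hT0 ⊢
      rw [hT0]
      exact sub_ne_zero.2 (hne i hi)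
  · refine AnalyticAt.contDiffAt (analyticAt_pi_iff.2 fun j => ?_)
    exact ((ContinuousLinearMap.proj (R := ℂ) (φ := fun _ => ℂ) (D.coord p j)).analyticAt z).sub
      analyticAt_const
  · have h1 : ∀ᶠ s in 𝓝 (0 : Fin (n + 1) → ℂ), ∀ j ∉ D.bdry p, (c + s) j ≠ 0 := by
      refine Filter.eventually_all.2 fun j => ?_
      by_cases hj : j ∈ D.bdry p
      · simp [hj]
      · have : ContinuousAt (fun s : Fin (n + 1) → ℂ => (c + s) j) 0 := by fun_prop
        exact (this.eventually_ne (by simpa using hc0 j hj)).mono fun s hs _ => hs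
    have h2 : ∀ᶠ t in 𝓝 (ε p), ∀ i, i ≠ p → t ≠ ε i := by
      refine Filter.eventually_all.2 fun i => ?_
      by_cases hi : i = p
      · simp [hi]
      · exact (continuousAt_id.eventually_ne (hne i hi)).mono fun s hs _ => hs
    have h3 : ∀ᶠ t in 𝓝 (ε p), t ≠ 1 := continuousAt_id.eventually_ne (hp ▸ hz.2)
    have hTc := hTa.continuousAt.tendsto.mono_right (congrArg 𝓝 hT0).le
    have hPc := hPa.continuousAt.tendsto.mono_right (congrArg 𝓝 hP0).le
    filter_upwards [h1, hTc.eventually h2, hTc.eventually h3, hPc.eventually hGr]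
      with s hs1 hs2 hs3 hs4
    exact D.mono_shift_mem_divisorComplement hε hs1 hs2 hs3 hs4
  · refine Filter.Eventually.of_forall fun s => ?_
    ext j
    simp [graphParam, hc]
  · have h1 : ContinuousAt (fun w : D.Ambient => w (D.t 0)) z :=
      (continuous_apply (D.t 0)).continuousAt
    have h2 : ∀ᶠ t in 𝓝 (ε p), ∀ i, i ≠ p → t ≠ ε i := by
      refine Filter.eventually_all.2 fun i => ?_
      by_cases hi : i = p
      · simp [hi]
      · exact (continuousAt_id.eventually_ne (hne i hi)).mono fun s hs _ => hs
    rw [ContinuousAt, hp] at h1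
    filter_upwards [(h1.eventually hGl).filter_mono nhdsWithin_le_nhds,
      (h1.eventually h2).filter_mono nhdsWithin_le_nhds, self_mem_nhdsWithin] with w hw1 hw2 hw
    have h3 : (c + fun j => w (D.coord p j) - c j) = fun j => w (D.coord p j) := by
      ext j
      simp
    have h4 := hw1 _ (D.prod_coord_mul_unitFactor hw.1 hw2)
    change D.graphParam p ε G (c + fun j => w (D.coord p j) - c j) = w
    rw [h3, graphParam, h4]
    exact (D.eq_mono_shift hw.1 hw2).symm

/-! ### The chart at the points where the torus acts freely -/

/-- The section of `t_1` through `z` along which all coordinates `x_{p,j}`, `w⁺_{p,l}`, `y_p` other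
than the one with index `j₀` are constant. -/
def sect (p : Fin k) (j₀ : Fin (n + 1)) (ε : Fin k → ℂ) (z : D.Ambient) (t : ℂ) : D.Ambient :=
  D.mono p (Function.update (fun j => z (D.coord p j)) j₀
    ((t - ε p) * (D.unitFactor p ε t * ∏ j ∈ (D.bdry p).erase j₀, z (D.coord p j))⁻¹)) (shift ε t)

/-- The parametrization of the deformation by the complex torus and `t_1`. -/
def orbitParam (σ : ℂ → D.Ambient) (t₀ : ℂ) (u : Fin (n + 1) → ℂ) : D.Ambient :=
  D.act (Fin.init u) (σ (t₀ + u (Fin.last n)))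

/-- The inverse of the parametrization by the complex torus and `t_1`. -/
def orbitCoord (p : Fin k) (j₀ : Fin (n + 1)) (z w : D.Ambient) : Fin (n + 1) → ℂ :=
  Fin.snoc (α := fun _ => ℂ) (D.solveWeights p (D.logCoord p j₀ z w)) (w (D.t 0) - z (D.t 0))

/-- The group element is read off from the logarithms of the coordinates other than `j₀`. That one
may vanish, and its logarithm is replaced using the weight relation on the boundary. -/
theorem isChart_orbitParam (hε : ε 0 = 0) {z : D.Ambient} {p : Fin k} {j₀ : Fin (n + 1)}
    (hz : z ∈ D.divisorComplement ε) (ht : ∀ i, i ≠ p → z (D.t 0) ≠ ε i) (hj₀ : j₀ ∈ D.bdry p)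
    (hne : ∀ j ∈ D.bdry p, j ≠ j₀ → z (D.coord p j) ≠ 0) :
    IsChart ℂ (n + 1) (D.divisorComplement ε) z (D.orbitParam (D.sect p j₀ ε z) (z (D.t 0)))
      (D.orbitCoord p j₀ z) ∧
    AnalyticAt ℂ (D.sect p j₀ ε z) (z (D.t 0)) ∧ D.sect p j₀ ε z (z (D.t 0)) = z ∧
    ∀ᶠ t in 𝓝 (z (D.t 0)), ∀ i, D.sect p j₀ ε z t (D.t i) = t - ε i := by
  set t₀ := z (D.t 0) with ht₀
  set c : Fin (n + 1) → ℂ := fun j => z (D.coord p j) with hc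
  have hc0 : ∀ j, j ≠ j₀ → c j ≠ 0 := fun j hj => by
    by_cases hjb : j ∈ D.bdry p
    · exact hne j hjb hj
    · exact D.coord_ne_zero_of_mem_deformation hz.1 ht hjb
  set B := ∏ j ∈ (D.bdry p).erase j₀, c j with hB
  have hB0 : B ≠ 0 := Finset.prod_ne_zero_iff.2 fun j hj => hc0 j (Finset.ne_of_mem_erase hj)
  have hv0 := D.unitFactor_ne_zero ht
  have hva := D.analyticAt_unitFactor ht
  set a : ℂ → ℂ := fun t => (t - ε p) * (D.unitFactor p ε t * B)⁻¹ with ha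
  have haa : AnalyticAt ℂ a t₀ := (analyticAt_id.sub analyticAt_const).mul
    ((hva.mul analyticAt_const).inv (mul_ne_zero hv0 hB0))
  have hsect : ∀ t, D.sect p j₀ ε z t = D.mono p (Function.update c j₀ (a t)) (shift ε t) :=
    fun t => rfl
  -- The coordinate `j₀` is determined by `t_1` and the others, whether or not it vanishes.
  have heq : ∀ w ∈ D.deformation ε, (∀ i, i ≠ p → w (D.t 0) ≠ ε i) →
      (∀ j, j ≠ j₀ → w (D.coord p j) ≠ 0) →
      w (D.coord p j₀) = (w (D.t 0) - ε p) * (D.unitFactor p ε (w (D.t 0)) *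
        ∏ j ∈ (D.bdry p).erase j₀, w (D.coord p j))⁻¹ := by
    intro w hw hwt hw0
    rw [← D.prod_coord_mul_unitFactor hw hwt, ← Finset.mul_prod_erase _ _ hj₀]
    have h1 := D.unitFactor_ne_zero hwt
    have h2 : ∏ j ∈ (D.bdry p).erase j₀, w (D.coord p j) ≠ 0 :=
      Finset.prod_ne_zero_iff.2 fun j hj => hw0 j (Finset.ne_of_mem_erase hj)
    field_simp
  have hz0 : D.sect p j₀ ε z t₀ = z := by
    have h1 : a t₀ = c j₀ := (heq z hz.1 ht hc0).symm
    rw [hsect, h1, Function.update_eq_self]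
    exact (D.eq_mono_shift hz.1 ht).symm
  have hnear : ∀ᶠ t in 𝓝 t₀, ∀ i, i ≠ p → t ≠ ε i := by
    refine Filter.eventually_all.2 fun i => ?_
    by_cases hi : i = p
    · simp [hi]
    · exact (continuousAt_id.eventually_ne (ht i hi)).mono fun s hs _ => hs
  have hupd : ∀ t j, j ∉ D.bdry p → Function.update c j₀ (a t) j ≠ 0 := by
    intro t j hj
    have : j ≠ j₀ := fun h => hj (h ▸ hj₀)
    rw [Function.update_of_ne this]
    exact hc0 j this
  have hprod : ∀ t, (∀ i, i ≠ p → t ≠ ε i) →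
      (∏ j ∈ D.bdry p, Function.update c j₀ (a t) j) * D.unitFactor p ε t = t - ε p := by
    intro t ht
    have h1 := D.unitFactor_ne_zero ht
    have h2 : ∏ j ∈ (D.bdry p).erase j₀, Function.update c j₀ (a t) j = B :=
      Finset.prod_congr rfl fun j hj => Function.update_of_ne (Finset.ne_of_mem_erase hj) _ _
    rw [← Finset.mul_prod_erase _ _ hj₀, h2, Function.update_self, ha]
    field_simp
  have hσa : AnalyticAt ℂ (D.sect p j₀ ε z) t₀ := by
    refine D.analyticAt_mono (s := fun t => Function.update c j₀ (a t)) ?_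
      (analyticAt_shift ε t₀) (hupd t₀) (fun i hi => sub_ne_zero.2 (ht i hi))
    refine analyticAt_pi_iff.2 fun j => ?_
    by_cases hj : j = j₀
    · subst hj
      simpa using haa
    · simpa [Function.update_of_ne hj] using! analyticAt_const
  refine ⟨⟨?_, ?_, ?_, ?_, ?_, ?_⟩, hσa, hz0, ?_⟩
  · have : Fin.init (0 : Fin (n + 1) → ℂ) = 0 := rfl
    funext q
    simp [orbitParam, this, act, hz0]
  · refine AnalyticAt.contDiffAt (D.analyticAt_act ?_ ?_)
    · exact analyticAt_pi_iff.2 fun j =>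
        (ContinuousLinearMap.proj (R := ℂ) (φ := fun _ => ℂ) j.castSucc).analyticAt _
    · refine AnalyticAt.comp_of_eq (g := D.sect p j₀ ε z) hσa (analyticAt_const.add
        ((ContinuousLinearMap.proj (R := ℂ) (φ := fun _ => ℂ) (Fin.last n)).analyticAt _)) ?_
      simp
  · refine AnalyticAt.contDiffAt ?_
    have hlog : ∀ j, j ≠ j₀ →
        AnalyticAt ℂ (fun w : D.Ambient => Complex.log (w (D.coord p j) / c j)) z := by
      intro j hj
      refine AnalyticAt.clog ?_ ?_
      · exact ((ContinuousLinearMap.proj (R := ℂ) (φ := fun _ => ℂ) (D.coord p j)).analyticAt z).div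
          analyticAt_const (hc0 j hj)
      · rw [show z (D.coord p j) / c j = 1 from div_self (hc0 j hj)]
        exact Complex.one_mem_slitPlane
    have hL : AnalyticAt ℂ (D.logCoord p j₀ z) z := by
      refine analyticAt_pi_iff.2 fun j => ?_
      by_cases hj : j = j₀
      · subst hj
        simp only [logCoord, Function.update_self]
        exact (Finset.analyticAt_fun_sum _ fun i hi => hlog i (Finset.ne_of_mem_erase hi)).neg
      · simp only [logCoord, Function.update_of_ne hj]
        exact hlog j hj
    have h2 := ((D.solveWeights p).analyticAt _).comp hL
    refine analyticAt_pi_iff.2 fun j => ?_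
    induction j using Fin.lastCases with
    | last =>
      simp only [orbitCoord, Fin.snoc_last]
      exact ((ContinuousLinearMap.proj (R := ℂ) (φ := fun _ => ℂ) (D.t 0)).analyticAt z).sub
        analyticAt_const
    | cast j =>
      simp only [orbitCoord, Fin.snoc_castSucc]
      exact analyticAt_pi_iff.1 h2 j
  · have h1 : Filter.Tendsto (fun u : Fin (n + 1) → ℂ => t₀ + u (Fin.last n)) (𝓝 0) (𝓝 t₀) := by
      have : ContinuousAt (fun u : Fin (n + 1) → ℂ => t₀ + u (Fin.last n)) 0 :=
        (continuous_const.add (continuous_apply _)).continuousAt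
      simpa [ContinuousAt] using this
    have h3 : ∀ᶠ t in 𝓝 t₀, t ≠ 1 := continuousAt_id.eventually_ne hz.2
    filter_upwards [h1.eventually hnear, h1.eventually h3] with u hu1 hu2
    rw [orbitParam, hsect, act_mono]
    refine D.mono_shift_mem_divisorComplement hε
      (fun j hj => mul_ne_zero (Complex.exp_ne_zero _) (hupd _ j hj)) hu1 hu2 ?_
    rw [Finset.prod_mul_distrib, ← Complex.exp_sum, sum_bdry_weightPairing, Complex.exp_zero,
      one_mul]
    exact hprod _ hu1
  · have h1 : Filter.Tendsto (fun u : Fin (n + 1) → ℂ => t₀ + u (Fin.last n)) (𝓝 0) (𝓝 t₀) := by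
      have : ContinuousAt (fun u : Fin (n + 1) → ℂ => t₀ + u (Fin.last n)) 0 :=
        (continuous_const.add (continuous_apply _)).continuousAt
      simpa [ContinuousAt] using this
    -- Keeps the principal logarithm inverse to the exponential.
    have h2 : ∀ᶠ u in 𝓝 (0 : Fin (n + 1) → ℂ), ∀ j,
        |(weightPairing (D.coord p j).1.1 (Fin.init u)).im| < Real.pi := by
      refine Filter.eventually_all.2 fun j => ?_
      have : ContinuousAt (fun u : Fin (n + 1) → ℂ =>
          |(weightPairing (D.coord p j).1.1 (Fin.init u)).im|) 0 :=
        (Complex.continuous_im.comp ((weightPairing _).continuous.comp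
          (continuous_pi fun i => continuous_apply i.castSucc))).abs.continuousAt
      refine this.eventually_lt_const ?_
      have : Fin.init (0 : Fin (n + 1) → ℂ) = 0 := rfl
      simp [this, Real.pi_pos]
    filter_upwards [h1.eventually hnear, h2] with u hu1 hu2
    have hcoord : ∀ j, D.orbitParam (D.sect p j₀ ε z) t₀ u (D.coord p j)
        = Complex.exp (weightPairing (D.coord p j).1.1 (Fin.init u))
          * Function.update c j₀ (a (t₀ + u (Fin.last n))) j := by
      intro j
      rw [orbitParam, hsect, act_mono, mono_coord]
    have ht0 : D.orbitParam (D.sect p j₀ ε z) t₀ u (D.t 0) = t₀ + u (Fin.last n) := by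
      rw [orbitParam, act_apply_t, hsect, D.mono_shift_t (hprod _ hu1), hε, sub_zero]
    have hlog : ∀ j, j ≠ j₀ →
        Complex.log (D.orbitParam (D.sect p j₀ ε z) t₀ u (D.coord p j) / z (D.coord p j))
        = weightPairing (D.coord p j).1.1 (Fin.init u) := by
      intro j hj
      rw [hcoord, Function.update_of_ne hj, mul_div_assoc, div_self (hc0 j hj), mul_one,
        Complex.log_exp (abs_lt.1 (hu2 j)).1 (abs_lt.1 (hu2 j)).2.le]
    have hL : D.logCoord p j₀ z (D.orbitParam (D.sect p j₀ ε z) t₀ u)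
        = fun j => weightPairing (D.coord p j).1.1 (Fin.init u) := by
      funext j
      by_cases hj : j = j₀
      · subst hj
        have := D.sum_bdry_weightPairing p (Fin.init u)
        rw [← Finset.add_sum_erase _ _ hj₀] at this
        rw [logCoord, Function.update_self, eq_neg_of_add_eq_zero_left this]
        exact congrArg Neg.neg (Finset.sum_congr rfl fun i hi => hlog i (Finset.ne_of_mem_erase hi))
      · rw [logCoord, Function.update_of_ne hj, hlog j hj]
    rw [orbitCoord, hL, solveWeights_weightPairing, ht0, add_sub_cancel_left]
    exact Fin.snoc_init_self u
  · have h1 : ContinuousAt (fun w : D.Ambient => w (D.t 0)) z :=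
      (continuous_apply (D.t 0)).continuousAt
    have h2 : ∀ᶠ w in 𝓝 z, ∀ j, j ≠ j₀ → w (D.coord p j) ≠ 0 := by
      refine Filter.eventually_all.2 fun j => ?_
      by_cases hj : j = j₀
      · simp [hj]
      · exact ((continuous_apply (D.coord p j)).continuousAt.eventually_ne (hc0 j hj)).mono
          fun s hs _ => hs
    filter_upwards [(h1.eventually hnear).filter_mono nhdsWithin_le_nhds,
      h2.filter_mono nhdsWithin_le_nhds, self_mem_nhdsWithin] with w hw1 hw2 hw
    have hlast : t₀ + D.orbitCoord p j₀ z w (Fin.last n) = w (D.t 0) := by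
      simp [orbitCoord, ht₀]
    have hinit : Fin.init (D.orbitCoord p j₀ z w) = D.solveWeights p (D.logCoord p j₀ z w) := by
      rw [orbitCoord, Fin.init_snoc]
    rw [orbitParam, hlast, hinit, hsect, act_mono]
    conv_rhs => rw [D.eq_mono_shift hw.1 hw1]
    congr 1
    funext j
    rw [D.weightPairing_solveWeights p (D.sum_logCoord hj₀ z w)]
    have hexp : ∀ j, j ≠ j₀ → Complex.exp (Complex.log (w (D.coord p j) / z (D.coord p j)))
        = w (D.coord p j) / c j := fun j hj =>
      Complex.exp_log (div_ne_zero (hw2 j hj) (hc0 j hj))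
    by_cases hj : j = j₀
    · subst hj
      -- At `j₀` the identity comes from the product equation, not from a logarithm of that
      -- coordinate.
      rw [logCoord, Function.update_self, Function.update_self, Complex.exp_neg, Complex.exp_sum,
        Finset.prod_congr rfl fun i hi => hexp i (Finset.ne_of_mem_erase hi),
        heq w hw.1 hw1 hw2, ha, Finset.prod_div_distrib]
      have h3 := D.unitFactor_ne_zero hw1
      have h4 : ∏ i ∈ (D.bdry p).erase j, w (D.coord p i) ≠ 0 :=
        Finset.prod_ne_zero_iff.2 fun i hi => hw2 i (Finset.ne_of_mem_erase hi)
      field_simp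
      exact mul_comm _ _
    · rw [logCoord, Function.update_of_ne hj, Function.update_of_ne hj, hexp j hj,
        div_mul_cancel₀ _ (hc0 j hj)]
  · filter_upwards [hnear] with t ht i
    rw [hsect, D.mono_shift_t (hprod t ht)]

end AdmissibleDecomposition

/-! ### A block determinant and coordinate derivatives. -/

theorem Matrix.det_eq_mul_of_last_column {R : Type*} [CommRing R] {d : ℕ}
    (M : Matrix (Fin (d + 1)) (Fin (d + 1)) R) (h : ∀ a : Fin d, M a.castSucc (Fin.last d) = 0) :
    M.det = (M.submatrix Fin.castSucc Fin.castSucc).det * M (Fin.last d) (Fin.last d) := by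
  rw [Matrix.det_succ_column M (Fin.last d), Finset.sum_eq_single (Fin.last d)]
  · rw [Fin.succAbove_last, ← two_mul, pow_mul]
    simp [mul_comm]
  · intro i _ hi
    obtain ⟨a, rfl⟩ := Fin.exists_castSucc_eq.2 hi
    rw [h a]
    ring
  · simp

theorem fderiv_single_apply_of_hasDerivAt {ι : Type*} [Fintype ι] {d : ℕ}
    {Ψ : (Fin d → ℂ) → (ι → ℂ)} {u : Fin d → ℂ} (hd : DifferentiableAt ℂ Ψ u) {i : Fin d} {q : ι}
    {c : ℂ} (h : HasDerivAt (fun l : ℂ => Ψ (u + l • Pi.single i 1) q) c 0) :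
    fderiv ℂ Ψ u (Pi.single i 1) q = c := by
  have h1 : HasDerivAt (fun l : ℂ => u + l • (Pi.single i 1 : Fin d → ℂ)) (Pi.single i 1) 0 := by
    simpa using ((hasDerivAt_id (0 : ℂ)).smul_const (Pi.single i 1 : Fin d → ℂ)).const_add u
  have h2 : HasFDerivAt Ψ (fderiv ℂ Ψ u) (u + (0 : ℂ) • Pi.single i 1) := by
    simpa using hd.hasFDerivAt
  have h3 := hasDerivAt_pi.1 (h2.comp_hasDerivAt (0 : ℂ) h1) q
  exact h3.unique h

namespace AdmissibleDecomposition

variable {n k : ℕ} (D : AdmissibleDecomposition n k)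

/-! ### Logarithmic derivatives of the monomials -/

/-- The logarithmic derivative, with respect to `t_1`, of the monomial in the `t_i` contained in the
generator `q`. -/
def tLogDeriv (p : Fin k) (ε : Fin k → ℂ) (q : D.genSet) (t : ℂ) : ℂ :=
  ∑ i, (D.texpo p q.1 i : ℂ) / (t - ε i)

theorem analyticAt_tLogDeriv {p : Fin k} {ε : Fin k → ℂ} (q : D.genSet) {t : ℂ}
    (ht : ∀ i, i ≠ p → t ≠ ε i) : AnalyticAt ℂ (D.tLogDeriv p ε q) t := by
  refine Finset.analyticAt_fun_sum _ fun i _ => ?_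
  rcases eq_or_ne i p with rfl | hi
  · simpa [texpo_self] using! analyticAt_const
  · exact analyticAt_const.div (analyticAt_id.sub analyticAt_const) (sub_ne_zero.2 (ht i hi))

theorem hasDerivAt_mono_shift {p : Fin k} {ε : Fin k → ℂ} {s : ℂ → Fin (n + 1) → ℂ} {t : ℂ → ℂ}
    {s' : Fin (n + 1) → ℂ} {t' x : ℂ} (hs : HasDerivAt s s' x) (ht : HasDerivAt t t' x)
    (hs0 : ∀ j, s x j ≠ 0) (ht0 : ∀ i, t x ≠ ε i) (q : D.genSet) :
    HasDerivAt (fun y => D.mono p (s y) (shift ε (t y)) q)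
      (D.mono p (s x) (shift ε (t x)) q *
        (∑ j, D.expo p q.1 j * s' j / s x j + D.tLogDeriv p ε q (t x) * t')) x := by
  have h1 : ∀ j, HasDerivAt (fun y => s y j) (s' j) x := hasDerivAt_pi.1 hs
  have h2 : ∀ i, HasDerivAt (fun y => t y - ε i) t' x := fun i => ht.sub_const _
  have h3 : ∀ i, t x - ε i ≠ 0 := fun i => sub_ne_zero.2 (ht0 i)
  have hd1 : ∀ j, DifferentiableAt ℂ (fun y => s y j ^ D.expo p q.1 j) x := fun j =>
    (h1 j).differentiableAt.zpow (Or.inl (hs0 j))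
  have hd2 : ∀ i, DifferentiableAt ℂ (fun y => (t y - ε i) ^ D.texpo p q.1 i) x := fun i =>
    (h2 i).differentiableAt.zpow (Or.inl (h3 i))
  have hn1 : ∏ j, s x j ^ D.expo p q.1 j ≠ 0 :=
    Finset.prod_ne_zero_iff.2 fun j _ => zpow_ne_zero _ (hs0 j)
  have hn2 : ∏ i, (t x - ε i) ^ D.texpo p q.1 i ≠ 0 :=
    Finset.prod_ne_zero_iff.2 fun i _ => zpow_ne_zero _ (h3 i)
  have hD1 : DifferentiableAt ℂ (fun y => ∏ j, s y j ^ D.expo p q.1 j) x :=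
    .fun_finsetProd fun j _ => hd1 j
  have hD2 : DifferentiableAt ℂ (fun y => ∏ i, (t y - ε i) ^ D.texpo p q.1 i) x :=
    .fun_finsetProd fun i _ => hd2 i
  have hlog : logDeriv (fun y => (∏ j, s y j ^ D.expo p q.1 j)
      * ∏ i, (t y - ε i) ^ D.texpo p q.1 i) x
      = ∑ j, D.expo p q.1 j * s' j / s x j + D.tLogDeriv p ε q (t x) * t' := by
    rw [logDeriv_mul x hn1 hn2 hD1 hD2,
      logDeriv_prod (f := fun j y => s y j ^ D.expo p q.1 j) (fun j _ => zpow_ne_zero _ (hs0 j))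
        (fun j _ => hd1 j),
      logDeriv_prod (f := fun i y => (t y - ε i) ^ D.texpo p q.1 i) (fun i _ => zpow_ne_zero _ (h3 i))
        (fun i _ => hd2 i), tLogDeriv,
      Finset.sum_mul]
    congr 1
    · refine Finset.sum_congr rfl fun j _ => ?_
      rw [logDeriv_fun_zpow (h1 j).differentiableAt, logDeriv_apply, (h1 j).deriv, mul_div_assoc]
    · refine Finset.sum_congr rfl fun i _ => ?_
      rw [logDeriv_fun_zpow (h2 i).differentiableAt, logDeriv_apply, (h2 i).deriv]
      ring
  have hfin := (hD1.mul hD2).hasDerivAt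
  have h4 := logDeriv_apply (fun y => (∏ j, s y j ^ D.expo p q.1 j)
      * ∏ i, (t y - ε i) ^ D.texpo p q.1 i) x
  rw [hlog, eq_div_iff (mul_ne_zero hn1 hn2)] at h4
  convert! hfin using 1
  rw [mul_comm]
  exact h4

/-- The exponents at `p` of the coordinates `x_{1,j}`, `w⁺_{1,l}` and of `t_p`. -/
def expoMatrix [NeZero k] (p : Fin k) : Matrix (Fin (n + 1)) (Fin (n + 1)) ℂ :=
  Matrix.of fun i j =>
    (D.expo p (Fin.snoc (α := fun _ => D.genSet) (D.xw 0) (D.t p) j : D.genSet).1 i : ℂ)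

theorem expo_sum {J : Type*} [Fintype J] (p : Fin k) (e : J → ℤ)
    (u : J → (Fin n → ℤ) × (Fin k → ℤ)) (i : Fin (n + 1)) :
    D.expo p (∑ j, e j • u j) i = ∑ j, e j * D.expo p (u j) i := by
  induction i using Fin.lastCases with
  | last => simp [Prod.snd_sum]
  | cast i =>
    simp only [expo_castSucc, Prod.fst_sum, Prod.snd_sum, dotProduct_sum, Finset.sum_apply,
      Prod.smul_fst, Prod.smul_snd, dotProduct_smul, Pi.smul_apply, smul_eq_mul, mul_add,
      Finset.sum_add_distrib]
    congr 1
    split_ifs <;> simp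

variable [NeZero k]

/-- An integral relation between the columns yields a lattice vector `u` with zero exponents, so
`u.1 = 0` and `u.2 p = 0`. The first kills the coefficients of the basis `zcol 0`, the second then
that of `t_p`. -/
theorem det_expoMatrix_ne_zero (p : Fin k) : (D.expoMatrix p).det ≠ 0 := by
  set N : Matrix (Fin (n + 1)) (Fin (n + 1)) ℤ := Matrix.of fun i j =>
    D.expo p (Fin.snoc (α := fun _ => D.genSet) (D.xw 0) (D.t p) j : D.genSet).1 i with hN
  have h1 : D.expoMatrix p = N.map (Int.castRingHom ℂ) := rfl
  have h2 : N.det ≠ 0 := by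
    intro h0
    obtain ⟨e, he, he0⟩ := Matrix.exists_mulVec_eq_zero_iff.2 h0
    have h3 : ∀ i, D.expo p (∑ j, e j •
        (Fin.snoc (α := fun _ => D.genSet) (D.xw 0) (D.t p) j : D.genSet).1) i = 0 := by
      intro i
      refine Eq.trans ?_ (congrFun he0 i)
      rw [expo_sum, Matrix.mulVec, dotProduct]
      exact Finset.sum_congr rfl fun j _ => mul_comm _ _
    set u := ∑ j, e j • (Fin.snoc (α := fun _ => D.genSet) (D.xw 0) (D.t p) j : D.genSet).1 with hu
    have h4 : u.1 = 0 := by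
      rw [← D.sum_expo_smul_fst p u]
      simp [h3]
    have h5 : u.2 p = 0 := by
      rw [← D.expo_last p u, h3]
    have h6 : u.1 = ∑ j : Fin n, e j.castSucc • D.zcol 0 j := by
      rw [hu, Prod.fst_sum, Fin.sum_univ_castSucc]
      simp only [Fin.snoc_castSucc, Fin.snoc_last]
      simp [xw, t, tilde]
    have h7 : ∀ j : Fin n, e j.castSucc = 0 := by
      intro j
      have := congrArg (fun v => D.X 0 j ⬝ᵥ v) (h6.symm.trans h4)
      simp only [dotProduct_sum, dotProduct_smul, row_dot_zcol, dotProduct_zero] at this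
      simpa using this
    have h8 : u.2 p = e (Fin.last n) := by
      rw [hu, Prod.snd_sum, Fin.sum_univ_castSucc]
      simp [h7, t]
    refine he (funext fun j => ?_)
    induction j using Fin.lastCases with
    | last => rw [← h8, h5, Pi.zero_apply]
    | cast j => exact h7 j
  rw [h1, ← RingHom.mapMatrix_apply, ← RingHom.map_det]
  simpa using h2

/-! ### Evaluation of the volume form -/

theorem coordWedge_apply (V : Fin (n + 1) → D.Ambient) :
    D.coordWedge V = (Matrix.of fun i j =>
      V i (Fin.snoc (α := fun _ => D.genSet) (D.xw 0) (D.t 0) j)).det := rfl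

/-- Orbit directions leave `t_1` fixed and scale each coordinate by its weight. The determinant
splits, and the factors `x_{1,j}`, `w⁺_{1,l}` cancel the denominator. -/
theorem omegaFormula_apply_of_orbit {w : D.Ambient} (hw : ∀ j, w (D.xw 0 j) ≠ 0)
    {V : Fin (n + 1) → D.Ambient} {c : ℂ}
    (h1 : ∀ a j, V (Fin.castSucc a) (D.xw 0 j) = (D.zcol 0 j a : ℂ) * w (D.xw 0 j))
    (h2 : ∀ a, V (Fin.castSucc a) (D.t 0) = 0) (h3 : V (Fin.last n) (D.t 0) = c) :
    D.omegaFormula w V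
      = Complex.I ^ (n + 1) * (((D.X 0)⁻¹.det : ℤ) : ℂ) * c / (w (D.t 0) - 1) := by
  have hdet : D.coordWedge V
      = (∏ j, w (D.xw 0 j)) * (((D.X 0)⁻¹.det : ℤ) : ℂ) * c := by
    rw [coordWedge_apply, Matrix.det_eq_mul_of_last_column _ (by simpa using h2)]
    congr 1
    · have h4 : (Matrix.of fun i j => V i (Fin.snoc (α := fun _ => D.genSet) (D.xw 0) (D.t 0) j)
          ).submatrix Fin.castSucc Fin.castSucc
          = Matrix.of fun a j => w (D.xw 0 j) * (D.X 0)⁻¹.map (Int.castRingHom ℂ) a j := by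
        ext a j
        simp [h1, zcol, mul_comm]
      rw [h4, Matrix.det_mul_row, ← RingHom.mapMatrix_apply, ← RingHom.map_det]
      rfl
    · simpa using h3
  have hprod : ∏ j, w (D.xw 0 j) ≠ 0 := Finset.prod_ne_zero_iff.2 fun j _ => hw j
  rw [omegaFormula, AlternatingMap.smul_apply, hdet, smul_eq_mul]
  by_cases h0 : w (D.t 0) - 1 = 0
  · simp [h0]
  · field_simp

theorem omegaFormula_orbitParam {σ : ℂ → D.Ambient} {t₀ : ℂ} {u : Fin (n + 1) → ℂ}
    (hd : DifferentiableAt ℂ (D.orbitParam σ t₀) u)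
    (hσ : ∀ᶠ t in 𝓝 (t₀ + u (Fin.last n)), σ t (D.t 0) = t)
    (hw : ∀ j, D.orbitParam σ t₀ u (D.xw 0 j) ≠ 0) :
    D.omegaFormula (D.orbitParam σ t₀ u)
      (fun j => fderiv ℂ (D.orbitParam σ t₀) u (Pi.single j 1))
      = Complex.I ^ (n + 1) * (((D.X 0)⁻¹.det : ℤ) : ℂ) / (t₀ + u (Fin.last n) - 1) := by
  have hcast : ∀ (a : Fin n) q, fderiv ℂ (D.orbitParam σ t₀) u (Pi.single a.castSucc 1) q
      = (q.1.1 a : ℂ) * D.orbitParam σ t₀ u q := by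
    intro a q
    refine fderiv_single_apply_of_hasDerivAt hd ?_
    have h1 : ∀ l : ℂ, D.orbitParam σ t₀ (u + l • Pi.single a.castSucc 1) q
        = Complex.exp (weightPairing q.1.1 (Fin.init u) + l * (q.1.1 a : ℂ))
          * σ (t₀ + u (Fin.last n)) q := by
      intro l
      have h2 : Fin.init (u + l • (Pi.single a.castSucc 1 : Fin (n + 1) → ℂ))
          = Fin.init u + l • Pi.single a 1 := by
        ext b
        simp [Fin.init, Pi.single_apply]
      have h3 : weightPairing q.1.1 (Pi.single a 1) = (q.1.1 a : ℂ) := by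
        simp [weightPairing_apply, Pi.single_apply]
      have h4 : (u + l • (Pi.single a.castSucc 1 : Fin (n + 1) → ℂ)) (Fin.last n)
          = u (Fin.last n) := by
        simp [(Fin.castSucc_lt_last a).ne']
      rw [orbitParam, act, h2, h4, map_add, map_smul, h3, smul_eq_mul]
    simp only [h1]
    have h5 := (((hasDerivAt_id (0 : ℂ)).mul_const (q.1.1 a : ℂ)).const_add
      (weightPairing q.1.1 (Fin.init u))).cexp.mul_const (σ (t₀ + u (Fin.last n)) q)
    convert! h5 using 1
    simp [orbitParam, act]
    ring
  have hlast : fderiv ℂ (D.orbitParam σ t₀) u (Pi.single (Fin.last n) 1) (D.t 0) = 1 := by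
    refine fderiv_single_apply_of_hasDerivAt hd ?_
    have h1 : HasDerivAt (fun l : ℂ => t₀ + u (Fin.last n) + l) 1 0 := by
      simpa using (hasDerivAt_id (0 : ℂ)).const_add (t₀ + u (Fin.last n))
    refine h1.congr_of_eventuallyEq ?_
    have h2 : Filter.Tendsto (fun l : ℂ => t₀ + u (Fin.last n) + l) (𝓝 0)
        (𝓝 (t₀ + u (Fin.last n))) := by
      have := h1.continuousAt
      simpa [ContinuousAt] using this
    filter_upwards [h2.eventually hσ] with l hl
    have h3 : (u + l • (Pi.single (Fin.last n) 1 : Fin (n + 1) → ℂ)) (Fin.last n)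
        = u (Fin.last n) + l := by
      simp
    rw [orbitParam, act_apply_t, h3, ← add_assoc]
    exact hl
  have hu : D.orbitParam σ t₀ u (D.t 0) = t₀ + u (Fin.last n) := by
    rw [orbitParam, act_apply_t]
    exact hσ.self_of_nhds
  rw [D.omegaFormula_apply_of_orbit hw (c := 1) (fun a j => hcast a _) (fun a => ?_) hlast, hu,
    mul_one]
  have : (D.t 0).1.1 a = 0 := rfl
  rw [hcast, this]
  simp

end AdmissibleDecomposition

theorem dense_forall_ne_zero (d : ℕ) : Dense {s : Fin d → ℂ | ∀ j, s j ≠ 0} := by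
  have := dense_pi (Set.univ : Set (Fin d)) (fun _ _ => dense_compl_singleton (0 : ℂ))
  convert this
  ext s
  simp

namespace AdmissibleDecomposition

variable {n k : ℕ} (D : AdmissibleDecomposition n k) [NeZero k]

/-! ### The holomorphic volume form -/

/-- The coefficient of the volume form with respect to `dx ∧ dw⁺ ∧ dy` at `p`. -/
def volCoeff (p : Fin k) (ε : Fin k → ℂ) (s : Fin (n + 1) → ℂ) (t : ℂ) : ℂ :=
  Complex.I ^ (n + 1) * (D.expoMatrix p).det * D.unitFactor p ε t /
    ((t - 1) * (1 - (t - ε p) * D.tLogDeriv p ε (D.t p) t) * ∏ j ∈ (D.bdry p)ᶜ, s j)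

/-- The volume form at the points of the fibre `t_1 = ε_p`. -/
def graphForm (p : Fin k) (ε : Fin k → ℂ) (w : D.Ambient) : D.Ambient [⋀^Fin (n + 1)]→ₗ[ℂ] ℂ :=
  D.volCoeff p ε (fun j => w (D.coord p j)) (w (D.t 0)) •
    Matrix.detRowAlternating.compLinearMap (LinearMap.funLeft ℂ ℂ (D.coord p))

open Classical in
/-- The holomorphic volume form. -/
def volForm (ε : Fin k → ℂ) (w : D.Ambient) : D.Ambient [⋀^Fin (n + 1)]→ₗ[ℂ] ℂ :=
  if ∀ j, w (D.xw 0 j) ≠ 0 then D.omegaFormula w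
  else if h : ∃ p, w (D.t 0) = ε p then D.graphForm h.choose ε w else 0

theorem volForm_of_ne_zero (ε : Fin k → ℂ) {w : D.Ambient} (hw : ∀ j, w (D.xw 0 j) ≠ 0) :
    D.volForm ε w = D.omegaFormula w := if_pos hw

theorem volForm_of_eq_zero {ε : Fin k → ℂ} (hε : Function.Injective ε) {w : D.Ambient}
    (hw : ¬ ∀ j, w (D.xw 0 j) ≠ 0) {p : Fin k} (hp : w (D.t 0) = ε p) :
    D.volForm ε w = D.graphForm p ε w := by
  have h : ∃ p, w (D.t 0) = ε p := ⟨p, hp⟩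
  rw [volForm, if_neg hw, dif_pos h]
  congr 1
  exact hε (h.choose_spec.symm.trans hp)

/-- With all coordinates nonzero, each `dx / x` is a combination of the `ds_i / s_i` and `dt`. The
boundary factors of `∏ s_i` in the denominator cancel against `t - ε_p = v_p ∏ s_j`, so the result
extends across the degenerate fibre. -/
theorem omegaFormula_graphParam {ε : Fin k → ℂ} (hε : ε 0 = 0) {p : Fin k} {G : ℂ → ℂ}
    {S : Fin (n + 1) → ℂ} (hd : DifferentiableAt ℂ (D.graphParam p ε G) S)
    (hT : DifferentiableAt ℂ (fun s : Fin (n + 1) → ℂ => G (∏ j ∈ D.bdry p, s j)) S)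
    (hS : ∀ j, S j ≠ 0)
    (hrel : ∀ᶠ s in 𝓝 S, (∏ j ∈ D.bdry p, s j) * D.unitFactor p ε (G (∏ j ∈ D.bdry p, s j))
      = G (∏ j ∈ D.bdry p, s j) - ε p)
    (ht : ∀ i, G (∏ j ∈ D.bdry p, S j) ≠ ε i)
    (hden : 1 - (G (∏ j ∈ D.bdry p, S j) - ε p) *
      D.tLogDeriv p ε (D.t p) (G (∏ j ∈ D.bdry p, S j)) ≠ 0) :
    D.omegaFormula (D.graphParam p ε G S)
      (fun j => fderiv ℂ (D.graphParam p ε G) S (Pi.single j 1))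
      = D.volCoeff p ε S (G (∏ j ∈ D.bdry p, S j)) := by
  set T : (Fin (n + 1) → ℂ) → ℂ := fun s => G (∏ j ∈ D.bdry p, s j) with hTdef
  set t := T S with htdef
  set τ : Fin (n + 1) → ℂ := fun i => fderiv ℂ T S (Pi.single i 1) with hτ
  set V : Fin (n + 1) → D.Ambient :=
    fun j => fderiv ℂ (D.graphParam p ε G) S (Pi.single j 1) with hV
  set P := D.graphParam p ε G S with hP
  set L := D.tLogDeriv p ε (D.t p) t with hL
  have hline : ∀ i, HasDerivAt (fun l : ℂ => S + l • (Pi.single i 1 : Fin (n + 1) → ℂ))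
      (Pi.single i 1) 0 := fun i => by
    simpa using ((hasDerivAt_id (0 : ℂ)).smul_const
      (Pi.single i 1 : Fin (n + 1) → ℂ)).const_add S
  have hTline : ∀ i, HasDerivAt (fun l : ℂ => T (S + l • (Pi.single i 1 : Fin (n + 1) → ℂ)))
      (τ i) 0 := fun i => by
    have h2 : HasFDerivAt T (fderiv ℂ T S) (S + (0 : ℂ) • Pi.single i 1) := by
      simpa using hT.hasFDerivAt
    exact h2.comp_hasDerivAt (0 : ℂ) (hline i)
  have hVq : ∀ i q, V i q
      = P q * (D.expo p q.1 i / S i + D.tLogDeriv p ε q t * τ i) := by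
    intro i q
    refine fderiv_single_apply_of_hasDerivAt hd ?_
    have h := D.hasDerivAt_mono_shift (p := p) (ε := ε) (hline i) (hTline i)
      (by simpa using hS) (by simpa using ht) q
    have h2 : ∑ j, (D.expo p q.1 j : ℂ) * (Pi.single i 1 : Fin (n + 1) → ℂ) j /
        (S + (0 : ℂ) • (Pi.single i 1 : Fin (n + 1) → ℂ)) j = D.expo p q.1 i / S i := by
      rw [Finset.sum_eq_single i]
      · simp
      · intro j _ hj
        simp [hj]
      · simp
    rw [h2] at h
    simp only [zero_smul, add_zero] at h
    exact h
  -- The `t_l` differ by constants, so `t_p` may replace `t_1` in the exponent matrix.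
  have htT : ∀ i l, V i (D.t l) = τ i := by
    intro i l
    refine fderiv_single_apply_of_hasDerivAt hd ?_
    have h1 := (hTline i).sub_const (ε l)
    refine h1.congr_of_eventuallyEq ?_
    have h2 : Filter.Tendsto (fun l : ℂ => S + l • (Pi.single i 1 : Fin (n + 1) → ℂ)) (𝓝 0)
        (𝓝 S) := by
      have := (hline i).continuousAt
      simpa [ContinuousAt] using this
    filter_upwards [h2.eventually hrel] with x hx
    exact D.mono_shift_t hx l
  have hPt : ∀ l, P (D.t l) = t - ε l := fun l => D.mono_shift_t hrel.self_of_nhds l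
  -- Logarithmic differentiation of `t - ε_p = v_p ∏ s_j` gives `dt = g ∑ ds_j / s_j`, summed over
  -- the boundary.
  set g := (t - ε p) / (1 - (t - ε p) * L) with hg
  have hτg : ∀ i, τ i = (S i)⁻¹ * (D.expo p (D.t p).1 i * g) := by
    intro i
    have h1 := hVq i (D.t p)
    rw [htT, hPt] at h1
    have h2 : τ i * (1 - (t - ε p) * L) = (t - ε p) * (D.expo p (D.t p).1 i / S i) := by
      rw [mul_sub, mul_one]
      conv_lhs => rw [h1]
      rw [← h1]
      linear_combination h1
    rw [eq_div_of_mul_eq hden h2, hg]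
    ring
  set x : Fin n → ℂ := fun j => P (D.xw 0 j) with hx
  -- The Jacobian is `diag(1 / S_i)` times the exponent matrix times this triangular `R`, whose last
  -- row records the dependence through `t`.
  set R : Matrix (Fin (n + 1)) (Fin (n + 1)) ℂ := Matrix.of fun a b =>
    Fin.snoc (α := fun _ => ℂ) (fun j : Fin n => if a = j.castSucc then x j else
      if a = Fin.last n then x j * D.tLogDeriv p ε (D.xw 0 j) t * g else 0)
      (if a = Fin.last n then g else 0) b with hR
  have hRdet : R.det = (∏ j, x j) * g := by
    rw [Matrix.det_eq_mul_of_last_column]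
    · have : R.submatrix Fin.castSucc Fin.castSucc = Matrix.diagonal x := by
        ext a b
        by_cases hab : a = b
        · subst hab
          simp [hR]
        · simp [hR, hab, (Fin.castSucc_lt_last a).ne]
      rw [this, Matrix.det_diagonal]
      simp [hR]
    · intro a
      simp [hR, (Fin.castSucc_lt_last a).ne]
  have hM : (Matrix.of fun i j => V i (Fin.snoc (α := fun _ => D.genSet) (D.xw 0) (D.t 0) j))
      = Matrix.of fun i j => (S i)⁻¹ * (D.expoMatrix p * R) i j := by
    ext i j
    simp only [Matrix.of_apply, Matrix.mul_apply, Fin.sum_univ_castSucc, expoMatrix,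
      Fin.snoc_castSucc, Fin.snoc_last]
    induction j using Fin.lastCases with
    | last =>
      simp [hR, htT, hτg, (Fin.castSucc_lt_last _).ne]
    | cast j =>
      have h1 : ∀ a : Fin n, R a.castSucc j.castSucc = if a = j then x j else 0 := by
        intro a
        simp [hR, (Fin.castSucc_lt_last a).ne]
      have h2 : R (Fin.last n) j.castSucc = x j * D.tLogDeriv p ε (D.xw 0 j) t * g := by
        simp [hR, (Fin.castSucc_lt_last j).ne']
      simp only [Fin.snoc_castSucc, h1, h2, hVq, hτg]
      simp only [mul_ite, mul_zero, Finset.sum_ite_eq', Finset.mem_univ, if_true, hx]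
      ring
  have hx0 : ∏ j, x j ≠ 0 := Finset.prod_ne_zero_iff.2 fun j _ => by
    refine D.mono_ne_zero hS (fun i _ => sub_ne_zero.2 (ht i)) _
  have hS0 : ∏ j ∈ (D.bdry p)ᶜ, S j ≠ 0 := Finset.prod_ne_zero_iff.2 fun j _ => hS j
  have hSb : ∏ j ∈ D.bdry p, S j ≠ 0 := Finset.prod_ne_zero_iff.2 fun j _ => hS j
  have hrel0 : (∏ j ∈ D.bdry p, S j) * D.unitFactor p ε t = t - ε p := hrel.self_of_nhds
  have hP0 : P (D.t 0) = t := by rw [hPt, hε, sub_zero]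
  have hden' : 1 - (t - ε p) * L ≠ 0 := hden
  change D.omegaFormula P V = D.volCoeff p ε S t
  rw [omegaFormula, AlternatingMap.smul_apply, coordWedge_apply, hM, Matrix.det_mul_column,
    Matrix.det_mul, hRdet, hP0, volCoeff, Finset.prod_inv_distrib,
    ← Finset.prod_mul_prod_compl (D.bdry p) S, smul_eq_mul, ← hL,
    show g = (∏ j ∈ D.bdry p, S j) * D.unitFactor p ε t / (1 - (t - ε p) * L) by rw [hrel0]]
  change _ / (_ * ∏ j, x j) * _ = _
  by_cases h1 : t - 1 = 0
  · simp [h1]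
  · field_simp

theorem coord_ne_zero_of_forall_ne {ε : Fin k → ℂ} {w : D.Ambient} (hw : w ∈ D.deformation ε)
    {p : Fin k} (ht : ∀ i, w (D.t 0) ≠ ε i) (j : Fin (n + 1)) : w (D.coord p j) ≠ 0 := by
  by_cases hj : j ∈ D.bdry p
  · have h := D.prod_coord_mul_unitFactor (p := p) hw fun i _ => ht i
    have h2 := left_ne_zero_of_mul (h.trans_ne (sub_ne_zero.2 (ht p)))
    exact Finset.prod_ne_zero_iff.1 h2 _ hj
  · exact D.coord_ne_zero_of_mem_deformation hw (fun i _ => ht i) hj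

theorem xw_ne_zero_of_forall_ne {ε : Fin k → ℂ} {w : D.Ambient} (hw : w ∈ D.deformation ε)
    (ht : ∀ i, w (D.t 0) ≠ ε i) (j : Fin n) : w (D.xw 0 j) ≠ 0 := by
  rw [← coord_castSucc]
  exact D.coord_ne_zero_of_forall_ne hw ht _

theorem graphForm_graphParam (ε : Fin k → ℂ) {p : Fin k} {G : ℂ → ℂ} {S : Fin (n + 1) → ℂ}
    (hd : DifferentiableAt ℂ (D.graphParam p ε G) S) :
    D.graphForm p ε (D.graphParam p ε G S)
      (fun j => fderiv ℂ (D.graphParam p ε G) S (Pi.single j 1))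
      = D.volCoeff p ε S (D.graphParam p ε G S (D.t 0)) := by
  have hcoord : ∀ s j, D.graphParam p ε G s (D.coord p j) = s j := fun s j => D.mono_coord p s _ j
  have h1 : ∀ i j, fderiv ℂ (D.graphParam p ε G) S (Pi.single i 1) (D.coord p j)
      = (1 : Matrix (Fin (n + 1)) (Fin (n + 1)) ℂ) i j := by
    intro i j
    refine fderiv_single_apply_of_hasDerivAt hd ?_
    simp only [hcoord]
    have h2 := ((hasDerivAt_id (0 : ℂ)).mul_const
      ((Pi.single i 1 : Fin (n + 1) → ℂ) j)).const_add (S j)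
    convert! h2 using 1
    rw [Matrix.one_apply, one_mul, Pi.single_apply]
    simp only [eq_comm]
  have h2 : Matrix.detRowAlternating.compLinearMap (LinearMap.funLeft ℂ ℂ (D.coord p))
      (fun j => fderiv ℂ (D.graphParam p ε G) S (Pi.single j 1)) = 1 := by
    have h3 : (Matrix.of fun i j =>
        fderiv ℂ (D.graphParam p ε G) S (Pi.single i 1) (D.coord p j)) = 1 := by
      ext i j
      exact h1 i j
    exact (congrArg Matrix.det h3).trans Matrix.det_one
  rw [graphForm, AlternatingMap.smul_apply, h2, smul_eq_mul, mul_one]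
  simp only [hcoord]

theorem continuousAt_omegaFormula {F : (Fin (n + 1) → ℂ) → D.Ambient} {S : Fin (n + 1) → ℂ}
    (hF : AnalyticAt ℂ F S) (hx : ∀ j, F S (D.xw 0 j) ≠ 0) (h1 : F S (D.t 0) ≠ 1) :
    ContinuousAt (fun s => D.omegaFormula (F s) (fun j => fderiv ℂ F s (Pi.single j 1))) S := by
  have hq : ∀ q, ContinuousAt (fun s => F s q) S := fun q =>
    (continuous_apply q).continuousAt.comp hF.continuousAt
  have hf : ContinuousAt (fderiv ℂ F) S := hF.fderiv.continuousAt
  have hf2 : ∀ i q, ContinuousAt (fun s => fderiv ℂ F s (Pi.single i 1) q) S := fun i q =>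
    (continuous_apply q).continuousAt.comp
      ((ContinuousLinearMap.apply ℂ D.Ambient (Pi.single i 1)).continuous.continuousAt.comp hf)
  simp only [omegaFormula, AlternatingMap.smul_apply, coordWedge_apply, Matrix.det_apply',
    smul_eq_mul]
  refine ContinuousAt.mul (continuousAt_const.div (((hq _).sub continuousAt_const).mul
    (tendsto_finsetProd _ fun j _ => hq _)) ?_) ?_
  · exact mul_ne_zero (sub_ne_zero.2 h1) (Finset.prod_ne_zero_iff.2 fun j _ => hx j)
  · refine tendsto_finsetSum _ fun σ _ => Filter.Tendsto.mul tendsto_const_nhds ?_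
    exact tendsto_finsetProd _ fun i _ => hf2 _ _

theorem analyticAt_volCoeff {ε : Fin k → ℂ} {p : Fin k} {S : Fin (n + 1) → ℂ}
    {T : (Fin (n + 1) → ℂ) → ℂ} (hT : AnalyticAt ℂ T S) (ht : ∀ i, i ≠ p → T S ≠ ε i)
    (h1 : T S ≠ 1) (hden : 1 - (T S - ε p) * D.tLogDeriv p ε (D.t p) (T S) ≠ 0)
    (hS : ∀ j ∉ D.bdry p, S j ≠ 0) : AnalyticAt ℂ (fun s => D.volCoeff p ε s (T s)) S := by
  have hu := (D.analyticAt_unitFactor ht).comp hT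
  have hl := (D.analyticAt_tLogDeriv (D.t p) ht).comp hT
  refine AnalyticAt.div (analyticAt_const.mul hu) (((hT.sub analyticAt_const).mul
    (analyticAt_const.sub ((hT.sub analyticAt_const).mul hl))).mul
    (Finset.analyticAt_fun_prod _ fun j _ =>
      (ContinuousLinearMap.proj (R := ℂ) (φ := fun _ => ℂ) j).analyticAt S)) ?_
  refine mul_ne_zero (mul_ne_zero (sub_ne_zero.2 h1) hden) (Finset.prod_ne_zero_iff.2 ?_)
  exact fun j hj => hS j (Finset.mem_compl.1 hj)

/-- This shows that the two cases in the definition of `volForm` fit together to one analytic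
coefficient near the degenerate fibre. -/
theorem eventually_volForm_graphParam {ε : Fin k → ℂ} (hε : ε 0 = 0) (hεi : Function.Injective ε)
    {p : Fin k} (hp1 : ε p ≠ 1) {G : ℂ → ℂ} (hG : AnalyticAt ℂ G 0) (hG0 : G 0 = ε p)
    (hGr : ∀ᶠ y in 𝓝 0, y * D.unitFactor p ε (G y) = G y - ε p) {c : Fin (n + 1) → ℂ}
    (hc : ∀ j ∉ D.bdry p, c j ≠ 0) (hprod : ∏ j ∈ D.bdry p, c j = 0) :
    AnalyticAt ℂ (fun s => D.volCoeff p ε s (G (∏ j ∈ D.bdry p, s j))) c ∧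
    ∀ᶠ s in 𝓝 c, D.volForm ε (D.graphParam p ε G s)
      (fun j => fderiv ℂ (D.graphParam p ε G) s (Pi.single j 1))
      = D.volCoeff p ε s (G (∏ j ∈ D.bdry p, s j)) := by
  have hne : ∀ i, i ≠ p → ε p ≠ ε i := fun i hi h => hi (hεi h).symm
  have hPa : AnalyticAt ℂ (fun s : Fin (n + 1) → ℂ => ∏ j ∈ D.bdry p, s j) c :=
    Finset.analyticAt_fun_prod _ fun j _ =>
      (ContinuousLinearMap.proj (R := ℂ) (φ := fun _ => ℂ) j).analyticAt c
  have hTa : AnalyticAt ℂ (fun s : Fin (n + 1) → ℂ => G (∏ j ∈ D.bdry p, s j)) c :=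
    hG.comp_of_eq hPa hprod
  have hTc : G (∏ j ∈ D.bdry p, c j) = ε p := by rw [hprod, hG0]
  have hΨa : AnalyticAt ℂ (D.graphParam p ε G) c :=
    D.analyticAt_mono analyticAt_id ((analyticAt_shift ε (ε p)).comp_of_eq hTa hTc) hc
      fun i hi => by
        change G (∏ j ∈ D.bdry p, c j) - ε i ≠ 0
        rw [hTc]
        exact sub_ne_zero.2 (hne i hi)
  have hden0 : 1 - (G (∏ j ∈ D.bdry p, c j) - ε p) *
      D.tLogDeriv p ε (D.t p) (G (∏ j ∈ D.bdry p, c j)) ≠ 0 := by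
    rw [hTc, sub_self, zero_mul, sub_zero]
    exact one_ne_zero
  have hva := D.analyticAt_volCoeff (p := p) (ε := ε) hTa (by simpa only [hTc] using hne)
    (by simpa only [hTc] using hp1) hden0 hc
  refine ⟨hva, ?_⟩
  have htend := hTa.continuousAt.tendsto.mono_right (congrArg 𝓝 hTc).le
  have hPtend := hPa.continuousAt.tendsto.mono_right (congrArg 𝓝 hprod).le
  have hnear : ∀ᶠ t in 𝓝 (ε p), ∀ i, i ≠ p → t ≠ ε i := by
    refine Filter.eventually_all.2 fun i => ?_
    by_cases hi : i = p
    · simp [hi]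
    · exact (continuousAt_id.eventually_ne (hne i hi)).mono fun s hs _ => hs
  have hdenc : ContinuousAt (fun s : Fin (n + 1) → ℂ => 1 - (G (∏ j ∈ D.bdry p, s j) - ε p) *
      D.tLogDeriv p ε (D.t p) (G (∏ j ∈ D.bdry p, s j))) c := by
    have hl := (D.analyticAt_tLogDeriv (p := p) (ε := ε) (D.t p)
      (by simpa only [hTc] using hne)).comp hTa
    exact (analyticAt_const.sub ((hTa.sub analyticAt_const).mul hl)).continuousAt
  have hev : ∀ᶠ s in 𝓝 c, AnalyticAt ℂ (D.graphParam p ε G) s ∧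
      AnalyticAt ℂ (fun s : Fin (n + 1) → ℂ => G (∏ j ∈ D.bdry p, s j)) s ∧
      AnalyticAt ℂ (fun s => D.volCoeff p ε s (G (∏ j ∈ D.bdry p, s j))) s ∧
      (∏ j ∈ D.bdry p, s j) * D.unitFactor p ε (G (∏ j ∈ D.bdry p, s j))
        = G (∏ j ∈ D.bdry p, s j) - ε p ∧
      (∀ i, i ≠ p → G (∏ j ∈ D.bdry p, s j) ≠ ε i) ∧ G (∏ j ∈ D.bdry p, s j) ≠ 1 ∧
      1 - (G (∏ j ∈ D.bdry p, s j) - ε p) *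
        D.tLogDeriv p ε (D.t p) (G (∏ j ∈ D.bdry p, s j)) ≠ 0 ∧ ∀ j ∉ D.bdry p, s j ≠ 0 := by
    have hoff : ∀ᶠ s in 𝓝 c, ∀ j ∉ D.bdry p, s j ≠ 0 := by
      refine Filter.eventually_all.2 fun j => ?_
      by_cases hj : j ∈ D.bdry p
      · simp [hj]
      · exact ((continuous_apply j).continuousAt.eventually_ne (hc j hj)).mono fun s hs _ => hs
    filter_upwards [hΨa.eventually_analyticAt, hTa.eventually_analyticAt,
      hva.eventually_analyticAt, hPtend.eventually hGr, htend.eventually hnear,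
      htend.eventually (continuousAt_id.eventually_ne hp1), hdenc.eventually_ne hden0, hoff]
      with s h1 h2 h3 h4 h5 h6 h7 h8 using ⟨h1, h2, h3, h4, h5, h6, h7, h8⟩
  filter_upwards [hev.eventually_nhds] with S hS
  obtain ⟨h1, h2, h3, h4, h5, h6, h7, h8⟩ := hS.self_of_nhds
  have ht0 : D.graphParam p ε G S (D.t 0) = G (∏ j ∈ D.bdry p, S j) := by
    rw [graphParam, D.mono_shift_t h4, hε, sub_zero]
  by_cases hx : ∀ j, D.graphParam p ε G S (D.xw 0 j) ≠ 0
  · rw [D.volForm_of_ne_zero ε hx]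
    have hcont := D.continuousAt_omegaFormula h1 hx (by rwa [ht0])
    -- Some `s_j` may vanish although no `x_{1,j}` or `w⁺_{1,l}` does; both sides are continuous and
    -- agree where all `s_j ≠ 0`.
    have := mem_closure_iff_nhdsWithin_neBot.1 (dense_forall_ne_zero (n + 1) S)
    refine tendsto_nhds_unique_of_eventuallyEq (hcont.tendsto.mono_left (nhdsWithin_le_nhds
      (s := {s | ∀ j, s j ≠ 0}))) (h3.continuousAt.tendsto.mono_left nhdsWithin_le_nhds) ?_
    filter_upwards [hS.eventually_nhds.filter_mono nhdsWithin_le_nhds, self_mem_nhdsWithin]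
      with s hs hs0
    obtain ⟨g1, g2, -, g4, g5, -, g7, -⟩ := hs.self_of_nhds
    refine D.omegaFormula_graphParam hε g1.differentiableAt g2.differentiableAt hs0
      (hs.mono fun s h => h.2.2.2.1) (fun i => ?_) g7
    rcases eq_or_ne i p with rfl | hi
    · rw [← sub_ne_zero, ← g4]
      exact mul_ne_zero (Finset.prod_ne_zero_iff.2 fun j _ => hs0 j) (D.unitFactor_ne_zero g5)
    · exact g5 i hi
  -- Otherwise the boundary product is nonzero, hence so is every monomial, against the vanishing of
  -- some `x_{1,j}` or `w⁺_{1,l}`.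
  · have htp : D.graphParam p ε G S (D.t 0) = ε p := by
      by_contra hcon
      rw [ht0] at hcon
      replace hcon := sub_ne_zero.2 hcon
      rw [← h4] at hcon
      have hS0 : ∀ j, S j ≠ 0 := fun j => by
        by_cases hj : j ∈ D.bdry p
        · exact Finset.prod_ne_zero_iff.1 (left_ne_zero_of_mul hcon) j hj
        · exact h8 j hj
      exact hx fun j => D.mono_ne_zero hS0 (fun i hi => sub_ne_zero.2 (h5 i hi)) _
    rw [D.volForm_of_eq_zero hεi hx htp, D.graphForm_graphParam ε h1.differentiableAt, ht0]

theorem isHolomorphicVolumeForm_volForm {ε : Fin k → ℂ} (hε : ε 0 = 0)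
    (hεi : Function.Injective ε) :
    IsHolomorphicVolumeForm (n + 1) (D.divisorComplement ε) (D.volForm ε) := by
  refine IsHolomorphicVolumeForm.of_charts fun z hz => ?_
  by_cases hp : ∃ p, z (D.t 0) = ε p
  · obtain ⟨p, hp⟩ := hp
    have hne : ∀ i, i ≠ p → ε p ≠ ε i := fun i hi h => hi (hεi h).symm
    have ht : ∀ i, i ≠ p → z (D.t 0) ≠ ε i := by rwa [hp]
    obtain ⟨G, hG, hG0, hGl, hGr⟩ := D.exists_solution_of_product hεi p
    obtain ⟨hchart, hprod⟩ := D.isChart_graphParam hε hεi hz hp hG hG0 hGl hGr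
    set c : Fin (n + 1) → ℂ := fun j => z (D.coord p j) with hc
    have hc0 : ∀ j ∉ D.bdry p, c j ≠ 0 := fun j hj => D.coord_ne_zero_of_mem_deformation hz.1 ht hj
    have hp1 : ε p ≠ 1 := hp ▸ hz.2
    obtain ⟨ha, hev⟩ := D.eventually_volForm_graphParam hε hεi hp1 hG hG0 hGr hc0 hprod
    refine ⟨_, _, fun s => D.volCoeff p ε (c + s) (G (∏ j ∈ D.bdry p, (c + s) j)), hchart,
      ?_, ?_, ?_⟩
    · exact AnalyticAt.comp_of_eq (g := fun s => D.volCoeff p ε s (G (∏ j ∈ D.bdry p, s j))) ha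
        (analyticAt_const.add analyticAt_id) (add_zero c)
    · simp only [add_zero, hprod, hG0, volCoeff, sub_self, zero_mul, sub_zero, mul_one]
      refine div_ne_zero (mul_ne_zero (mul_ne_zero (pow_ne_zero _ Complex.I_ne_zero)
        (D.det_expoMatrix_ne_zero p)) (D.unitFactor_ne_zero hne)) (mul_ne_zero
        (sub_ne_zero.2 hp1) (Finset.prod_ne_zero_iff.2 fun j hj => hc0 j (Finset.mem_compl.1 hj)))
    · have htend : Filter.Tendsto (fun s => c + s) (𝓝 0) (𝓝 c) := by
        have : ContinuousAt (fun s => c + s) 0 := (continuous_const.add continuous_id).continuousAt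
        simpa [ContinuousAt] using this
      filter_upwards [htend.eventually hev] with s hs
      rw [← hs]
      congr 1
      funext j
      rw [fderiv_comp_add_left]
  · push Not at hp
    have hdiff : ∀ j, z (D.coord 0 j) ≠ 0 := D.coord_ne_zero_of_forall_ne hz.1 hp
    obtain ⟨hchart, hσa, hσ0, hσt⟩ := D.isChart_orbitParam hε hz (fun i _ => hp i)
      (D.last_mem_bdry 0) (fun j _ _ => hdiff j)
    refine ⟨_, _, fun u => Complex.I ^ (n + 1) * (((D.X 0)⁻¹.det : ℤ) : ℂ) /
      (z (D.t 0) + u (Fin.last n) - 1), hchart, ?_, ?_, ?_⟩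
    · refine analyticAt_const.div ((analyticAt_const.add
        ((ContinuousLinearMap.proj (R := ℂ) (φ := fun _ => ℂ) (Fin.last n)).analyticAt _)).sub
        analyticAt_const) ?_
      simpa [sub_eq_zero] using hz.2
    · have h1 : IsUnit ((D.X 0)⁻¹.det) := Matrix.isUnit_nonsing_inv_det _ (D.isUnit_det 0)
      have h2 : (((D.X 0)⁻¹.det : ℤ) : ℂ) ≠ 0 := by exact_mod_cast h1.ne_zero
      refine div_ne_zero (mul_ne_zero (pow_ne_zero _ Complex.I_ne_zero) h2) ?_
      simpa [sub_eq_zero] using hz.2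
    · have htend : Filter.Tendsto (fun u : Fin (n + 1) → ℂ => z (D.t 0) + u (Fin.last n)) (𝓝 0)
          (𝓝 (z (D.t 0))) := by
        have : ContinuousAt (fun u : Fin (n + 1) → ℂ => z (D.t 0) + u (Fin.last n)) 0 :=
          (continuous_const.add (continuous_apply _)).continuousAt
        simpa [ContinuousAt] using this
      have hnear : ∀ᶠ t in 𝓝 (z (D.t 0)), ∀ i, t ≠ ε i :=
        Filter.eventually_all.2 fun i => continuousAt_id.eventually_ne (hp i)
      filter_upwards [htend.eventually hσt.eventually_nhds, htend.eventually hnear, hchart.mem,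
        hchart.contDiffAt.eventually (by simp)] with u hu1 hu2 hu3 hu4
      have ht0 : ∀ᶠ t in 𝓝 (z (D.t 0) + u (Fin.last n)),
          D.sect 0 (Fin.last n) ε z t (D.t 0) = t :=
        hu1.mono fun t ht => by rw [ht 0, hε, sub_zero]
      have hw : ∀ j, D.orbitParam (D.sect 0 (Fin.last n) ε z) (z (D.t 0)) u (D.xw 0 j) ≠ 0 := by
        refine D.xw_ne_zero_of_forall_ne hu3.1 fun i => ?_
        rw [orbitParam, act_apply_t, ht0.self_of_nhds]
        exact hu2 i
      rw [D.volForm_of_ne_zero ε hw]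
      exact D.omegaFormula_orbitParam (hu4.differentiableAt (by simp)) ht0 hw

end AdmissibleDecomposition

/-! ### The moment map of a linear torus action -/

section Moment

variable {n : ℕ}

/-- The pairing of an integral weight with a real vector. -/
def realPairing (v : Fin n → ℤ) : (Fin n → ℝ) →L[ℝ] ℝ :=
  ∑ a, (v a : ℝ) • ContinuousLinearMap.proj a

theorem realPairing_apply (v : Fin n → ℤ) (x : Fin n → ℝ) :
    realPairing v x = ∑ a, (v a : ℝ) * x a := by
  simp [realPairing]

theorem realPairing_single (v : Fin n → ℤ) (a : Fin n) :
    realPairing v (Pi.single a 1) = v a := by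
  simp [realPairing_apply, Pi.single_apply]

variable {Q : Type*} [Fintype Q] (v : Q → Fin n → ℤ)

/-- The moment map along a real orbit, as a function of the logarithm of the group element. -/
def orbitMoment (c : Q → ℝ) (x : Fin n → ℝ) : Fin n → ℝ := fun a =>
  ∑ q, (v q a : ℝ) * (c q * Real.exp (2 * realPairing (v q) x))

theorem sum_mul_orbitMoment (c : Q → ℝ) (x y : Fin n → ℝ) :
    ∑ a, y a * orbitMoment v c x a
      = ∑ q, c q * (realPairing (v q) y * Real.exp (2 * realPairing (v q) x)) := by
  simp only [orbitMoment, Finset.mul_sum]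
  rw [Finset.sum_comm]
  refine Finset.sum_congr rfl fun q _ => ?_
  rw [realPairing_apply (v q) y, Finset.sum_mul, Finset.mul_sum]
  exact Finset.sum_congr rfl fun a _ => by ring

variable {v}

/-- Strict monotonicity of a convex gradient: pairing the difference of values with `x - y` gives a
sum of nonnegative terms, which vanish only if every active weight kills `x - y`. -/
theorem orbitMoment_injective {c : Q → ℝ} (hc : ∀ q, 0 ≤ c q)
    (hv : ∀ x : Fin n → ℝ, (∀ q, c q ≠ 0 → realPairing (v q) x = 0) → x = 0) :
    Function.Injective (orbitMoment v c) := by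
  intro x y hxy
  have h1 : ∑ q, c q * (realPairing (v q) (x - y) *
      (Real.exp (2 * realPairing (v q) x) - Real.exp (2 * realPairing (v q) y))) = 0 := by
    have h2 := sum_mul_orbitMoment v c x (x - y)
    have h3 := sum_mul_orbitMoment v c y (x - y)
    rw [hxy, h3] at h2
    rw [← sub_eq_zero, ← Finset.sum_sub_distrib] at h2
    rw [← neg_eq_zero, ← h2, ← Finset.sum_neg_distrib]
    exact Finset.sum_congr rfl fun q _ => by ring
  have h4 : ∀ q, 0 ≤ realPairing (v q) (x - y) *
      (Real.exp (2 * realPairing (v q) x) - Real.exp (2 * realPairing (v q) y)) := by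
    intro q
    rw [map_sub]
    rcases le_total (realPairing (v q) x) (realPairing (v q) y) with h | h
    · exact mul_nonneg_of_nonpos_of_nonpos (sub_nonpos.2 h)
        (sub_nonpos.2 (Real.exp_le_exp.2 (by linarith)))
    · exact mul_nonneg (sub_nonneg.2 h) (sub_nonneg.2 (Real.exp_le_exp.2 (by linarith)))
  rw [Finset.sum_eq_zero_iff_of_nonneg fun q _ => mul_nonneg (hc q) (h4 q)] at h1
  refine sub_eq_zero.1 (hv _ fun q hq => ?_)
  rcases mul_eq_zero.1 ((mul_eq_zero.1 (h1 q (Finset.mem_univ q))).resolve_left hq) with h | h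
  · exact h
  · rw [map_sub, sub_eq_zero]
    have := Real.exp_injective (sub_eq_zero.1 h)
    linarith

theorem max_zero_sq_le_exp (y : ℝ) : max 0 y ^ 2 ≤ Real.exp (2 * y) := by
  rcases le_total y 0 with h | h
  · rw [max_eq_left h, zero_pow two_ne_zero]
    exact (Real.exp_pos _).le
  · rw [max_eq_right h]
    have h1 := Real.pow_div_factorial_le_exp (2 * y) (by positivity) 2
    have h2 : ((2 : ℕ).factorial : ℝ) = 2 := by norm_num [Nat.factorial]
    rw [h2] at h1
    nlinarith [sq_nonneg y]

/-- A preimage of `δ` is a minimum of `∑ c_q e^{2⟨v_q, x⟩} - 2⟨δ, x⟩`. Since some weight is positive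
in every direction, the exponentials dominate `κ ‖x‖²` and the minimum exists. -/
theorem orbitMoment_surjective {c : Q → ℝ} (hc : ∀ q, 0 < c q)
    (hv : ∀ x : Fin n → ℝ, x ≠ 0 → ∃ q, 0 < realPairing (v q) x) :
    Function.Surjective (orbitMoment v c) := by
  intro δ
  set m : (Fin n → ℝ) → ℝ := fun x => ∑ q, c q * max 0 (realPairing (v q) x) ^ 2 with hm
  have hmc : Continuous m := by
    refine continuous_finsetSum _ fun q _ => ?_
    exact continuous_const.mul ((continuous_const.max (realPairing (v q)).continuous).pow 2)
  obtain ⟨κ, hκ, hκm⟩ : ∃ κ > 0, ∀ x ∈ Metric.sphere (0 : Fin n → ℝ) 1, κ ≤ m x := by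
    rcases (Metric.sphere (0 : Fin n → ℝ) 1).eq_empty_or_nonempty with h | h
    -- The unit sphere is empty when `n = 0`.
    · exact ⟨1, one_pos, by simp [h]⟩
    · obtain ⟨x, hx, hmin⟩ := (isCompact_sphere (0 : Fin n → ℝ) 1).exists_isMinOn h hmc.continuousOn
      refine ⟨m x, ?_, fun y hy => hmin hy⟩
      obtain ⟨q, hq⟩ := hv x (by rintro rfl; simp at hx)
      refine Finset.sum_pos' (fun q _ => mul_nonneg (hc q).le (sq_nonneg _))
        ⟨q, Finset.mem_univ q, ?_⟩
      rw [max_eq_right hq.le]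
      exact mul_pos (hc q) (by positivity)
  have hκ2 : ∀ x, κ * ‖x‖ ^ 2 ≤ m x := by
    intro x
    rcases eq_or_ne x 0 with rfl | hx
    · simp [hm]
    have hx' : 0 < ‖x‖ := norm_pos_iff.2 hx
    have h1 := hκm (‖x‖⁻¹ • x) (by simp [norm_smul, hx'.ne'])
    have h2 : m (‖x‖⁻¹ • x) = ‖x‖⁻¹ ^ 2 * m x := by
      simp only [hm, map_smul, smul_eq_mul, Finset.mul_sum]
      refine Finset.sum_congr rfl fun q _ => ?_
      have : max 0 (‖x‖⁻¹ * realPairing (v q) x) = ‖x‖⁻¹ * max 0 (realPairing (v q) x) := by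
        rw [mul_max_of_nonneg _ _ (by positivity), mul_zero]
      rw [this]
      ring
    rw [h2] at h1
    calc κ * ‖x‖ ^ 2 ≤ (‖x‖⁻¹ ^ 2 * m x) * ‖x‖ ^ 2 := by gcongr
      _ = m x := by field_simp
  set f : (Fin n → ℝ) → ℝ := fun x =>
    (∑ q, c q * Real.exp (2 * realPairing (v q) x)) - ∑ a, 2 * (δ a * x a) with hf
  have hfc : Continuous f := by
    refine (continuous_finsetSum _ fun q _ => continuous_const.mul
      (Real.continuous_exp.comp (continuous_const.mul (realPairing (v q)).continuous))).sub ?_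
    fun_prop
  have hlow : ∀ x, ‖x‖ * (κ * ‖x‖ - 2 * ∑ a, |δ a|) ≤ f x := by
    intro x
    have h1 : m x ≤ ∑ q, c q * Real.exp (2 * realPairing (v q) x) :=
      Finset.sum_le_sum fun q _ => mul_le_mul_of_nonneg_left (max_zero_sq_le_exp _) (hc q).le
    have h2 : ∑ a, 2 * (δ a * x a) ≤ ∑ a, 2 * (|δ a| * ‖x‖) := by
      refine Finset.sum_le_sum fun a _ => mul_le_mul_of_nonneg_left ?_ zero_le_two
      calc δ a * x a ≤ |δ a * x a| := le_abs_self _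
        _ = |δ a| * ‖x a‖ := by rw [abs_mul, Real.norm_eq_abs]
        _ ≤ |δ a| * ‖x‖ := mul_le_mul_of_nonneg_left (norm_le_pi_norm x a) (abs_nonneg _)
    have h3 : ∑ a, 2 * (|δ a| * ‖x‖) = 2 * ((∑ a, |δ a|) * ‖x‖) := by
      rw [← Finset.mul_sum, ← Finset.sum_mul]
    have h4 := hκ2 x
    simp only [hf]
    nlinarith
  have htend : Filter.Tendsto f (Filter.cocompact _) Filter.atTop := by
    refine Filter.tendsto_atTop_mono hlow ?_
    refine Filter.Tendsto.comp (g := fun r : ℝ => r * (κ * r - 2 * ∑ a, |δ a|)) ?_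
      (tendsto_norm_cocompact_atTop (E := Fin n → ℝ))
    refine Filter.tendsto_id.atTop_mul_atTop₀ ?_
    exact Filter.tendsto_atTop_add_const_right _ _ (Filter.tendsto_id.const_mul_atTop hκ)
  obtain ⟨x, hx⟩ := hfc.exists_forall_le htend
  refine ⟨x, funext fun a => ?_⟩
  have hder : HasDerivAt (fun l : ℝ => f (x + l • Pi.single a 1))
      (2 * orbitMoment v c x a - 2 * δ a) 0 := by
    have h1 : ∀ q, HasDerivAt (fun l : ℝ => c q * Real.exp (2 * realPairing (v q)
        (x + l • Pi.single a 1))) (c q * (Real.exp (2 * realPairing (v q) x) * (2 * v q a))) 0 := by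
      intro q
      have h2 : HasDerivAt (fun l : ℝ => 2 * realPairing (v q) (x + l • Pi.single a 1))
          (2 * v q a) 0 := by
        simp only [map_add, map_smul, realPairing_single, smul_eq_mul]
        simpa using (((hasDerivAt_id (0 : ℝ)).mul_const (v q a : ℝ)).const_add
          (realPairing (v q) x)).const_mul 2
      simpa using h2.exp.const_mul (c q)
    have h3 : ∀ b, HasDerivAt (fun l : ℝ => 2 * (δ b * (x + l • (Pi.single a 1 : Fin n → ℝ)) b))
        (2 * (δ b * (Pi.single a 1 : Fin n → ℝ) b)) 0 := by
      intro b
      simpa using ((((hasDerivAt_id (0 : ℝ)).mul_const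
        ((Pi.single a 1 : Fin n → ℝ) b)).const_add (x b)).const_mul (δ b)).const_mul 2
    have h4 := (HasDerivAt.fun_sum fun q (_ : q ∈ Finset.univ) => h1 q).sub
      (HasDerivAt.fun_sum fun b (_ : b ∈ Finset.univ) => h3 b)
    convert! h4 using 1
    simp only [orbitMoment, Finset.mul_sum, Pi.single_apply, mul_ite, mul_one, mul_zero,
      Finset.sum_ite_eq', Finset.mem_univ, if_true]
    congr 1
    exact Finset.sum_congr rfl fun q _ => by ring
  have hmin : IsLocalMin (fun l : ℝ => f (x + l • Pi.single a 1)) 0 :=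
    Filter.Eventually.of_forall fun l => by simpa using hx _
  have := hmin.hasDerivAt_eq_zero hder
  linarith

/-- The derivative in `x` is `2 ∑ c_q e^{2⟨v_q, x⟩} v_q v_qᵀ`, positive definite since the active
weights span. Keeping `ψ` as an extra component turns this into an application of the inverse
function theorem. -/
theorem exists_orbitMoment_eq {c : ℝ → Q → ℝ} {ψ₀ : ℝ} (hca : ContDiffAt ℝ ω c ψ₀)
    (hc : ∀ q, 0 ≤ c ψ₀ q)
    (hv : ∀ x : Fin n → ℝ, (∀ q, c ψ₀ q ≠ 0 → realPairing (v q) x = 0) → x = 0)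
    (x₀ : Fin n → ℝ) :
    ∃ S : ℝ → Fin n → ℝ, ContDiffAt ℝ ω S ψ₀ ∧ S ψ₀ = x₀ ∧
      ∀ᶠ ψ in 𝓝 ψ₀, orbitMoment v (c ψ) (S ψ) = orbitMoment v (c ψ₀) x₀ := by
  set F : (Fin n → ℝ) × ℝ → (Fin n → ℝ) × ℝ := fun y => (orbitMoment v (c y.2) y.1, y.2) with hF
  have hFa : ContDiffAt ℝ ω F (x₀, ψ₀) := by
    refine ContDiffAt.prodMk (contDiffAt_pi.2 fun a => ?_) contDiffAt_snd
    refine ContDiffAt.sum fun q _ => contDiffAt_const.mul (ContDiffAt.mul ?_ ?_)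
    · exact (contDiffAt_pi.1 hca q).comp (x₀, ψ₀) contDiffAt_snd
    · exact (contDiffAt_const.mul ((realPairing (v q)).contDiff.contDiffAt.comp (x₀, ψ₀)
        contDiffAt_fst)).exp
  have hFd := (hFa.differentiableAt (by simp)).hasFDerivAt
  set A := fderiv ℝ F (x₀, ψ₀) with hA
  have hline : ∀ y : (Fin n → ℝ) × ℝ, HasDerivAt (fun l : ℝ => F ((x₀, ψ₀) + l • y)) (A y) 0 := by
    intro y
    have h1 : HasDerivAt (fun l : ℝ => (x₀, ψ₀) + l • y) y 0 := by
      simpa using ((hasDerivAt_id (0 : ℝ)).smul_const y).const_add (x₀, ψ₀)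
    have h2 : HasFDerivAt F A ((x₀, ψ₀) + (0 : ℝ) • y) := by simpa using hFd
    exact h2.comp_hasDerivAt (0 : ℝ) h1
  have hA2 : ∀ y, (A y).2 = y.2 := by
    intro y
    have h1 := hasFDerivAt_snd.comp_hasDerivAt (0 : ℝ) (hline y)
    have h2 : HasDerivAt (fun l : ℝ => ψ₀ + l * y.2) y.2 0 := by
      simpa using ((hasDerivAt_id (0 : ℝ)).mul_const y.2).const_add ψ₀
    exact h1.unique h2
  have hA1 : ∀ y : Fin n → ℝ, ∀ a, (A (y, 0)).1 a
      = ∑ q, (v q a : ℝ) * (c ψ₀ q * (Real.exp (2 * realPairing (v q) x₀) *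
        (2 * realPairing (v q) y))) := by
    intro y a
    have h1 := hasDerivAt_pi.1 (hasFDerivAt_fst.comp_hasDerivAt (0 : ℝ) (hline (y, 0))) a
    have h2 : ∀ q, HasDerivAt (fun l : ℝ => (v q a : ℝ) * (c ψ₀ q *
        Real.exp (2 * realPairing (v q) (x₀ + l • y)))) ((v q a : ℝ) * (c ψ₀ q *
        (Real.exp (2 * realPairing (v q) x₀) * (2 * realPairing (v q) y)))) 0 := by
      intro q
      have h3 : HasDerivAt (fun l : ℝ => 2 * realPairing (v q) (x₀ + l • y))
          (2 * realPairing (v q) y) 0 := by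
        simp only [map_add, map_smul, smul_eq_mul]
        simpa using (((hasDerivAt_id (0 : ℝ)).mul_const (realPairing (v q) y)).const_add
          (realPairing (v q) x₀)).const_mul 2
      simpa using (h3.exp.const_mul (c ψ₀ q)).const_mul (v q a : ℝ)
    refine h1.unique ?_
    have h4 := HasDerivAt.fun_sum fun q (_ : q ∈ Finset.univ) => h2 q
    convert! h4 using 1
    funext l
    simp [hF, orbitMoment]
  have hinj : Function.Injective A := by
    rw [injective_iff_map_eq_zero]
    rintro ⟨y, s⟩ hy
    have hs : s = 0 := by
      have h := hA2 (y, s)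
      rw [hy] at h
      exact h.symm
    subst hs
    have h1 : ∑ q, c ψ₀ q * (realPairing (v q) y ^ 2 * Real.exp (2 * realPairing (v q) x₀)) = 0 := by
      have h2 : ∑ a, y a * (A (y, 0)).1 a = 0 := by simp [hy]
      simp only [hA1, Finset.mul_sum] at h2
      rw [Finset.sum_comm] at h2
      have h3 : ∀ q, ∑ a, y a * ((v q a : ℝ) * (c ψ₀ q * (Real.exp (2 * realPairing (v q) x₀) *
          (2 * realPairing (v q) y)))) = 2 * (c ψ₀ q * (realPairing (v q) y ^ 2 *
          Real.exp (2 * realPairing (v q) x₀))) := by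
        intro q
        have h4 : ∀ K : ℝ, ∑ a, y a * ((v q a : ℝ) * K) = realPairing (v q) y * K := by
          intro K
          rw [realPairing_apply, Finset.sum_mul]
          exact Finset.sum_congr rfl fun a _ => by ring
        rw [h4]
        ring
      simp only [h3, ← Finset.mul_sum] at h2
      linarith
    rw [Finset.sum_eq_zero_iff_of_nonneg fun q _ => mul_nonneg (hc q) (by positivity)] at h1
    have h2 : y = 0 := hv y fun q hq => by
      have h3 := (mul_eq_zero.1 (h1 q (Finset.mem_univ q))).resolve_left hq
      exact pow_eq_zero_iff two_ne_zero |>.1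
        ((mul_eq_zero.1 h3).resolve_right (Real.exp_pos _).ne')
    rw [h2]
    rfl
  obtain ⟨g, hg, hg0, -, hgr⟩ := ContDiffAt.exists_local_inverse (𝕜 := ℝ) (f := F)
    (f' := (LinearEquiv.ofInjectiveEndo A.toLinearMap hinj).toContinuousLinearEquiv) hFa
    (hFd.congr_fderiv (by ext <;> rfl))
  have hcurve : ContDiffAt ℝ ω (fun ψ : ℝ => (orbitMoment v (c ψ₀) x₀, ψ)) ψ₀ :=
    contDiffAt_const.prodMk contDiffAt_id
  refine ⟨fun ψ => (g (orbitMoment v (c ψ₀) x₀, ψ)).1, ?_, ?_, ?_⟩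
  · exact contDiffAt_fst.comp ψ₀ (ContDiffAt.comp (g := g) ψ₀ hg hcurve)
  · exact congrArg Prod.fst hg0
  · filter_upwards [hcurve.continuousAt.eventually hgr] with ψ hψ
    have h1 := congrArg Prod.fst hψ
    have h2 := congrArg Prod.snd hψ
    simp only [hF] at h1 h2
    rw [h2] at h1
    exact h1

end Moment

theorem weightPairing_re {n : ℕ} (v : Fin n → ℤ) (ζ : Fin n → ℂ) :
    (weightPairing v ζ).re = realPairing v fun a => (ζ a).re := by
  simp [weightPairing_apply, realPairing_apply, Complex.re_sum]

theorem weightPairing_ofReal {n : ℕ} (v : Fin n → ℤ) (x : Fin n → ℝ) :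
    weightPairing v (fun a => (x a : ℂ)) = (realPairing v x : ℂ) := by
  simp [weightPairing_apply, realPairing_apply]

namespace AdmissibleDecomposition

variable {n k : ℕ} (D : AdmissibleDecomposition n k)

/-! ### The moment map on an orbit -/

theorem moment_act (ζ : Fin n → ℂ) (w : D.Ambient) :
    D.moment (D.act ζ w)
      = orbitMoment (fun q : D.genSet => q.1.1) (fun q => ‖w q‖ ^ 2) fun a => (ζ a).re := by
  funext a
  refine Finset.sum_congr rfl fun q _ => ?_
  rw [act, norm_mul, mul_pow, Complex.norm_exp, weightPairing_re, ← Real.exp_nat_mul]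
  push_cast
  ring

variable [NeZero k] {ε : Fin k → ℂ}

/-! ### Orbit charts -/

/-- The chart at `z` given by the complex torus and a section `σ` of `t_1` through `z`. -/
structure IsOrbitChart (ε : Fin k → ℂ) (z : D.Ambient) (σ : ℂ → D.Ambient)
    (ρ : D.Ambient → Fin (n + 1) → ℂ) : Prop where
  isChart : IsChart ℂ (n + 1) (D.divisorComplement ε) z (D.orbitParam σ (z (D.t 0))) ρ
  analyticAt : AnalyticAt ℂ σ (z (D.t 0))
  apply_self : σ (z (D.t 0)) = z
  apply_t : ∀ᶠ t in 𝓝 (z (D.t 0)), σ t (D.t 0) = t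

theorem isClosed_deformation (ε : Fin k → ℂ) : IsClosed (D.deformation ε) := by
  have : D.deformation ε = D.toricVariety ∩ ⋂ i, {z | z (D.t 0) - z (D.t i) = ε i} := by
    ext z
    simp [deformation]
  rw [this]
  exact D.isClosed_toricVariety.inter (isClosed_iInter fun i =>
    isClosed_eq ((continuous_apply (D.t 0)).sub (continuous_apply (D.t i))) continuous_const)

/-- Ensures that small torus charts around a point outside the locus stay outside it. -/
theorem isClosed_singularLocus (ε : Fin k → ℂ) : IsClosed (D.singularLocus ε) := by
  have : D.singularLocus ε = D.deformation ε ∩ ⋃ p : Fin k, {z | z (D.t 0) = ε p} ∩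
      ((⋃ j : Fin n, ⋃ _ : j.val < D.m p, {z | z (D.xw p j) = 0} ∩ {z | z (D.y p) = 0}) ∪
      ⋃ j : Fin n, ⋃ j' : Fin n, ⋃ _ : j.val < D.m p, ⋃ _ : j'.val < D.m p, ⋃ _ : j ≠ j',
        {z | z (D.xw p j) = 0} ∩ {z | z (D.xw p j') = 0}) := by
    ext z
    simp only [singularLocus, Set.mem_ofPred_eq, Set.mem_inter_iff, Set.mem_iUnion, Set.mem_union,
      exists_prop]
  rw [this]
  have hcl : ∀ (q : D.genSet) (c : ℂ), IsClosed {z : D.Ambient | z q = c} := fun q c =>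
    isClosed_eq (continuous_apply _) continuous_const
  refine (D.isClosed_deformation ε).inter (isClosed_iUnion_of_finite fun p => (hcl _ _).inter ?_)
  exact (isClosed_iUnion_of_finite fun j => isClosed_iUnion_of_finite fun _ =>
    (hcl _ _).inter (hcl _ _)).union
    (isClosed_iUnion_of_finite fun j => isClosed_iUnion_of_finite fun j' =>
    isClosed_iUnion_of_finite fun _ => isClosed_iUnion_of_finite fun _ =>
    isClosed_iUnion_of_finite fun _ => (hcl _ _).inter (hcl _ _))

/-- Off the singular locus at most one boundary coordinate vanishes, and it is taken as `j₀`. If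
none vanishes, the choice of `j₀` is arbitrary. -/
theorem exists_isOrbitChart (hε : ε 0 = 0) (hεi : Function.Injective ε) {z : D.Ambient}
    (hz : z ∈ D.divisorComplement ε) (hs : z ∉ D.singularLocus ε) :
    ∃ σ ρ, D.IsOrbitChart ε z σ ρ := by
  suffices h : ∃ p, ∃ j₀ ∈ D.bdry p, (∀ i, i ≠ p → z (D.t 0) ≠ ε i) ∧
      ∀ j ∈ D.bdry p, j ≠ j₀ → z (D.coord p j) ≠ 0 by
    obtain ⟨p, j₀, hj₀, ht, hne⟩ := h
    obtain ⟨h1, h2, h3, h4⟩ := D.isChart_orbitParam hε hz ht hj₀ hne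
    exact ⟨_, _, h1, h2, h3, h4.mono fun t ht => by simpa [hε] using ht 0⟩
  by_cases hp : ∃ p, z (D.t 0) = ε p
  · obtain ⟨p, hp⟩ := hp
    have ht : ∀ i, i ≠ p → z (D.t 0) ≠ ε i := fun i hi h => hi (hεi (h.symm.trans hp))
    have hns : ∀ j₁ ∈ D.bdry p, ∀ j₂ ∈ D.bdry p, j₁ ≠ j₂ → z (D.coord p j₁) = 0 →
        z (D.coord p j₂) ≠ 0 := by
      have hy : ∀ j : Fin n, j.val < D.m p → D.yc p = D.y p := fun j hj =>
        if_pos (lt_of_le_of_lt (Nat.zero_le _) hj)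
      intro j₁ h₁ j₂ h₂ hne hz₁ hz₂
      induction j₁ using Fin.lastCases with
      | last =>
        induction j₂ using Fin.lastCases with
        | last => exact hne rfl
        | cast j₂ =>
          rw [castSucc_mem_bdry] at h₂
          rw [coord_last, hy j₂ h₂] at hz₁
          rw [coord_castSucc] at hz₂
          exact hs ⟨hz.1, p, hp, Or.inl ⟨j₂, h₂, hz₂, hz₁⟩⟩
      | cast j₁ =>
        rw [castSucc_mem_bdry] at h₁
        rw [coord_castSucc] at hz₁
        induction j₂ using Fin.lastCases with
        | last =>
          rw [coord_last, hy j₁ h₁] at hz₂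
          exact hs ⟨hz.1, p, hp, Or.inl ⟨j₁, h₁, hz₁, hz₂⟩⟩
        | cast j₂ =>
          rw [castSucc_mem_bdry] at h₂
          rw [coord_castSucc] at hz₂
          exact hs ⟨hz.1, p, hp, Or.inr ⟨j₁, j₂, h₁, h₂, fun h => hne (h ▸ rfl), hz₁, hz₂⟩⟩
    by_cases h0 : ∃ j₀ ∈ D.bdry p, z (D.coord p j₀) = 0
    · obtain ⟨j₀, hj₀, h0⟩ := h0
      exact ⟨p, j₀, hj₀, ht, fun j hj hne => hns j₀ hj₀ j hj hne.symm h0⟩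
    · push Not at h0
      exact ⟨p, Fin.last n, D.last_mem_bdry p, ht, fun j hj _ => h0 j hj⟩
  · push Not at hp
    exact ⟨0, Fin.last n, D.last_mem_bdry 0, fun i _ => hp i, fun j _ _ =>
      D.coord_ne_zero_of_forall_ne hz.1 hp j⟩

namespace IsOrbitChart

variable {D} {z : D.Ambient} {σ : ℂ → D.Ambient} {ρ : D.Ambient → Fin (n + 1) → ℂ}

/-- Such an `x` generates a one-parameter group fixing `z`, which the injectivity of the chart
forbids. -/
theorem eq_zero_of_realPairing (h : D.IsOrbitChart ε z σ ρ) (x : Fin n → ℝ)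
    (hx : ∀ q : D.genSet, z q ≠ 0 → realPairing q.1.1 x = 0) : x = 0 := by
  set c : ℝ → Fin (n + 1) → ℂ := fun l =>
    Fin.snoc (α := fun _ => ℂ) (fun a => ((l • x) a : ℂ)) 0 with hc
  have hcc : Filter.Tendsto c (𝓝[≠] 0) (𝓝 0) := by
    have h1 : Continuous c := by
      refine continuous_pi fun j => ?_
      induction j using Fin.lastCases with
      | last => simp [hc, continuous_const]
      | cast j =>
        simp only [hc, Fin.snoc_castSucc, Pi.smul_apply, smul_eq_mul]
        fun_prop
    have h2 : c 0 = 0 := by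
      ext j
      induction j using Fin.lastCases <;> simp [hc]
    have h3 := h1.tendsto 0
    rw [h2] at h3
    exact h3.mono_left nhdsWithin_le_nhds
  have hΨ : ∀ l, D.orbitParam σ (z (D.t 0)) (c l) = z := by
    intro l
    have h1 : Fin.init (c l) = fun a => ((l • x) a : ℂ) := Fin.init_snoc _ _
    have h2 : c l (Fin.last n) = 0 := Fin.snoc_last _ _
    funext q
    rw [orbitParam, h2, add_zero, h.apply_self, act, h1, weightPairing_ofReal, map_smul]
    by_cases hq : z q = 0
    · simp [hq]
    · simp [hx q hq]
  obtain ⟨l, hl, hl0⟩ := ((hcc.eventually h.isChart.left_inv).and self_mem_nhdsWithin).exists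
  rw [hΨ, h.isChart.inv_apply] at hl
  ext a
  have h1 := congrFun hl a.castSucc
  simp only [hc, Fin.snoc_castSucc, Pi.zero_apply, Pi.smul_apply, smul_eq_mul] at h1
  have h2 : l * x a = 0 := by exact_mod_cast h1.symm
  exact (mul_eq_zero.1 h2).resolve_left hl0

/-- The volume form at `z` in terms of the orbit chart. -/
theorem volForm_apply (h : D.IsOrbitChart ε z σ ρ) (hε : ε 0 = 0) (hεi : Function.Injective ε)
    (hz : z ∈ D.divisorComplement ε) :
    D.volForm ε z (fun j => fderiv ℂ (D.orbitParam σ (z (D.t 0))) 0 (Pi.single j 1))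
      = Complex.I ^ (n + 1) * (((D.X 0)⁻¹.det : ℤ) : ℂ) / (z (D.t 0) - 1) := by
  set t₀ := z (D.t 0) with ht₀
  set Ψ := D.orbitParam σ t₀ with hΨ
  have ha := ((D.isHolomorphicVolumeForm_volForm hε hεi).2 z hz Ψ h.isChart.isLocalParam).1
  -- If `z` lies on a degenerate fibre the explicit formula may not apply at `z`; the value is
  -- obtained as a limit along the section, whose nearby points lie on regular fibres.
  set c : ℂ → Fin (n + 1) → ℂ := fun τ => Pi.single (Fin.last n) τ with hc
  have hcl : ∀ τ, c τ (Fin.last n) = τ := fun τ => Pi.single_eq_same _ _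
  have hcc : Filter.Tendsto c (𝓝[≠] 0) (𝓝 0) := by
    have h1 : Continuous c := continuous_single (A := fun _ => ℂ) (Fin.last n)
    have h2 := h1.tendsto 0
    rw [show c 0 = 0 from Pi.single_zero _] at h2
    exact h2.mono_left nhdsWithin_le_nhds
  have hadd : Filter.Tendsto (fun τ : ℂ => t₀ + τ) (𝓝[≠] 0) (𝓝 t₀) := by
    have h1 : Filter.Tendsto (fun τ : ℂ => t₀ + τ) (𝓝 0) (𝓝 (t₀ + 0)) :=
      (continuous_const.add continuous_id).tendsto 0
    rw [add_zero] at h1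
    exact h1.mono_left nhdsWithin_le_nhds
  have hlim1 := ha.continuousAt.tendsto.comp hcc
  have hlim2 : Filter.Tendsto (fun τ : ℂ => Complex.I ^ (n + 1) * (((D.X 0)⁻¹.det : ℤ) : ℂ) /
      (t₀ + τ - 1)) (𝓝[≠] 0) (𝓝 (Complex.I ^ (n + 1) * (((D.X 0)⁻¹.det : ℤ) : ℂ) / (t₀ - 1))) :=
    tendsto_const_nhds.div (hadd.sub_const 1) (sub_ne_zero.2 hz.2)
  have hne : ∀ᶠ τ in 𝓝[≠] (0 : ℂ), ∀ i, t₀ + τ ≠ ε i := by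
    refine Filter.eventually_all.2 fun i => ?_
    by_cases hi : t₀ = ε i
    · filter_upwards [self_mem_nhdsWithin] with τ hτ h1
      exact hτ (by simpa [hi] using h1)
    · exact hadd.eventually_ne hi
  have hdiff : ∀ᶠ u in 𝓝 (0 : Fin (n + 1) → ℂ), DifferentiableAt ℂ Ψ u :=
    (h.isChart.contDiffAt.eventually (by simp)).mono fun u hu => hu.differentiableAt (by simp)
  have hmap := h.isChart.map_zero
  have key : (fun τ => D.volForm ε (Ψ (c τ)) (fun j => fderiv ℂ Ψ (c τ) (Pi.single j 1)))
      =ᶠ[𝓝[≠] 0] fun τ => Complex.I ^ (n + 1) * (((D.X 0)⁻¹.det : ℤ) : ℂ) / (t₀ + τ - 1) := by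
    filter_upwards [hcc.eventually hdiff, hcc.eventually h.isChart.mem, hne,
      hadd.eventually h.apply_t.eventually_nhds] with τ h1 h2 h3 h4
    have h5 : Ψ (c τ) (D.t 0) = t₀ + τ := by
      rw [hΨ, orbitParam, act_apply_t, hcl]
      exact h4.self_of_nhds
    have h6 : ∀ j, Ψ (c τ) (D.xw 0 j) ≠ 0 :=
      D.xw_ne_zero_of_forall_ne h2.1 fun i => by rw [h5]; exact h3 i
    rw [D.volForm_of_ne_zero ε h6, hΨ, D.omegaFormula_orbitParam h1 (by rwa [hcl]) h6, hcl]
  have := tendsto_nhds_unique_of_eventuallyEq hlim1 hlim2 key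
  rwa [show Ψ 0 = z from hmap] at this

end IsOrbitChart

end AdmissibleDecomposition

namespace AdmissibleDecomposition

variable {n k : ℕ} (D : AdmissibleDecomposition n k) [NeZero k] {ε : Fin k → ℂ}

/-! ### The chart of the torus fibration -/

/-- The orbit coordinates of a point of the torus with angles `s`, where the noncompact part of the
group element is `S`. -/
def torusCoord (S : ℝ → Fin n → ℝ) (t₀ : ℂ) (s : Fin (n + 1) → ℝ) : Fin (n + 1) → ℂ :=
  Fin.snoc (α := fun _ => ℂ)
    (fun a => (S (s (Fin.last n)) a : ℂ) + Complex.I * s a.castSucc)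
    ((t₀ - 1) * (Complex.exp (Complex.I * s (Fin.last n)) - 1))

/-- The angles of a point of the torus. -/
def torusAngle (ρ : D.Ambient → Fin (n + 1) → ℂ) (t₀ : ℂ) (w : D.Ambient) : Fin (n + 1) → ℝ :=
  Fin.snoc (α := fun _ => ℝ) (fun a => (ρ w a.castSucc).im)
    (Complex.log (1 + ρ w (Fin.last n) / (t₀ - 1))).im

@[simp]
theorem torusCoord_castSucc (S : ℝ → Fin n → ℝ) (t₀ : ℂ) (s : Fin (n + 1) → ℝ) (a : Fin n) :
    torusCoord S t₀ s a.castSucc = (S (s (Fin.last n)) a : ℂ) + Complex.I * s a.castSucc :=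
  Fin.snoc_castSucc (α := fun _ => ℂ) _ _ _

@[simp]
theorem torusCoord_last (S : ℝ → Fin n → ℝ) (t₀ : ℂ) (s : Fin (n + 1) → ℝ) :
    torusCoord S t₀ s (Fin.last n)
      = (t₀ - 1) * (Complex.exp (Complex.I * s (Fin.last n)) - 1) :=
  Fin.snoc_last (α := fun _ => ℂ) _ _

theorem torusCoord_zero {S : ℝ → Fin n → ℝ} (hS : S 0 = 0) (t₀ : ℂ) : torusCoord S t₀ 0 = 0 := by
  ext j
  induction j using Fin.lastCases <;> simp [hS]

theorem contDiffAt_torusCoord {S : ℝ → Fin n → ℝ} {t₀ : ℂ} {s : Fin (n + 1) → ℝ}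
    (hS : ContDiffAt ℝ ω S (s (Fin.last n))) : ContDiffAt ℝ ω (torusCoord S t₀) s := by
  have h1 : ∀ j, ContDiffAt ℝ ω (fun s : Fin (n + 1) → ℝ => (s j : ℂ)) s := fun j =>
    Complex.ofRealCLM.contDiff.contDiffAt.comp s (contDiff_apply ℝ ℝ j).contDiffAt
  refine contDiffAt_pi.2 fun j => ?_
  induction j using Fin.lastCases with
  | last =>
    simp only [torusCoord_last]
    exact contDiffAt_const.mul (((contDiffAt_const.mul (h1 _)).cexp).sub contDiffAt_const)
  | cast a =>
    simp only [torusCoord_castSucc]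
    refine ContDiffAt.add ?_ (contDiffAt_const.mul (h1 _))
    refine Complex.ofRealCLM.contDiff.contDiffAt.comp s ?_
    exact (contDiffAt_pi.1 hS a).comp s (contDiff_apply ℝ ℝ (Fin.last n)).contDiffAt

theorem torus_subset_divisorComplement {r : ℝ} (hr : 0 < r) (δ : Fin n → ℝ) :
    D.torus ε r δ ⊆ D.divisorComplement ε := by
  rintro z ⟨h1, h2, -⟩
  refine ⟨h1, fun h => ?_⟩
  rw [h, sub_self, norm_zero] at h2
  exact hr.ne h2

/-- The angular parametrization of the torus through `z`, for a function `S` such that the moment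
map is constant. -/
structure IsTorusChart (ε : Fin k → ℂ) (r : ℝ) (δ : Fin n → ℝ) (z : D.Ambient)
    (σ : ℂ → D.Ambient) (ρ : D.Ambient → Fin (n + 1) → ℂ) (S : ℝ → Fin n → ℝ) : Prop where
  isOrbitChart : D.IsOrbitChart ε z σ ρ
  contDiffAt : ContDiffAt ℝ ω S 0
  map_zero : S 0 = 0
  isChart : IsChart ℝ (n + 1) (D.torus ε r δ \ D.singularLocus ε) z
    (D.orbitParam σ (z (D.t 0)) ∘ torusCoord S (z (D.t 0))) (D.torusAngle ρ (z (D.t 0)))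

/-- In orbit coordinates the circle condition fixes `t_1` up to an angle, and the moment condition
fixes `Re ζ = S(ψ)`; the angles `Im ζ` and `ψ` stay free. -/
theorem exists_isTorusChart (hε : ε 0 = 0) (hεi : Function.Injective ε) {r : ℝ} (hr : 0 < r)
    {δ : Fin n → ℝ} {z : D.Ambient} (hz : z ∈ D.torus ε r δ \ D.singularLocus ε) :
    ∃ σ ρ S, D.IsTorusChart ε r δ z σ ρ S := by
  have hzX := D.torus_subset_divisorComplement hr δ hz.1
  obtain ⟨σ, ρ, h⟩ := D.exists_isOrbitChart hε hεi hzX hz.2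
  set t₀ := z (D.t 0) with ht₀
  have ht1 : t₀ - 1 ≠ 0 := sub_ne_zero.2 hzX.2
  set τ : ℝ → ℂ := fun ψ => t₀ + (t₀ - 1) * (Complex.exp (Complex.I * ψ) - 1) with hτ
  have hτ0 : τ 0 = t₀ := by simp [hτ]
  have hτc : ContDiffAt ℝ ω τ 0 :=
    contDiffAt_const.add (contDiffAt_const.mul ((contDiffAt_const.mul
      Complex.ofRealCLM.contDiff.contDiffAt).cexp.sub contDiffAt_const))
  have hστ : ContDiffAt ℝ ω (fun ψ => σ (τ ψ)) 0 := by
    refine ContDiffAt.comp (g := σ) 0 ?_ hτc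
    rw [hτ0]
    exact h.analyticAt.contDiffAt.restrict_scalars ℝ
  set c : ℝ → D.genSet → ℝ := fun ψ q => ‖σ (τ ψ) q‖ ^ 2 with hc
  have hcc : ContDiffAt ℝ ω c 0 := contDiffAt_pi.2 fun q => (contDiffAt_pi.1 hστ q).norm_sq ℝ
  have hc0 : ∀ q, c 0 q = ‖z q‖ ^ 2 := fun q => by
    simp only [hc, hτ0]
    rw [h.apply_self]
  have hspan : ∀ x : Fin n → ℝ, (∀ q : D.genSet, c 0 q ≠ 0 → realPairing q.1.1 x = 0) → x = 0 := by
    intro x hx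
    refine h.eq_zero_of_realPairing x fun q hq => hx q ?_
    rw [hc0]
    simpa using hq
  obtain ⟨S, hSc, hS0, hSm⟩ := exists_orbitMoment_eq (v := fun q : D.genSet => q.1.1) hcc
    (fun q => sq_nonneg _) hspan 0
  have hδ : orbitMoment (fun q : D.genSet => q.1.1) (c 0) 0 = δ := by
    have h1 := D.moment_act 0 z
    have h2 : D.act 0 z = z := by
      funext q
      simp [act]
    rw [h2] at h1
    have h3 : c 0 = fun q => ‖z q‖ ^ 2 := funext hc0
    rw [h3]
    exact h1.symm.trans (funext hz.1.2.2)
  rw [hδ] at hSm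
  refine ⟨σ, ρ, S, h, hSc, hS0, ?_⟩
  set Ψ := D.orbitParam σ t₀ with hΨ
  have hQ0 := torusCoord_zero hS0 t₀
  have hQc : ContDiffAt ℝ ω (torusCoord S t₀) 0 := contDiffAt_torusCoord hSc
  have hPc : ContDiffAt ℝ ω (Ψ ∘ torusCoord S t₀) 0 := by
    refine ContDiffAt.comp (g := Ψ) 0 ?_ hQc
    rw [hQ0]
    exact h.isChart.contDiffAt.restrict_scalars ℝ
  have hQt : Filter.Tendsto (torusCoord S t₀) (𝓝 0) (𝓝 0) := by
    simpa only [ContinuousAt, hQ0] using hQc.continuousAt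
  have hlast : Filter.Tendsto (fun s : Fin (n + 1) → ℝ => s (Fin.last n)) (𝓝 0) (𝓝 0) := by
    simpa using (continuous_apply (A := fun _ => ℝ) (Fin.last n)).tendsto (0 : Fin (n + 1) → ℝ)
  have hτt : Filter.Tendsto τ (𝓝 0) (𝓝 t₀) := by
    simpa only [ContinuousAt, hτ0] using hτc.continuousAt
  have hmom : ∀ s : Fin (n + 1) → ℝ, D.moment (Ψ (torusCoord S t₀ s))
      = orbitMoment (fun q : D.genSet => q.1.1) (c (s (Fin.last n))) (S (s (Fin.last n))) := by
    intro s
    rw [hΨ, orbitParam, moment_act]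
    congr 1
    · simp [hc, hτ]
    · funext a
      simp [Fin.init]
  have hΨt : ∀ᶠ u in 𝓝 (0 : Fin (n + 1) → ℂ), Ψ u (D.t 0) = t₀ + u (Fin.last n) := by
    have h1 : Filter.Tendsto (fun u : Fin (n + 1) → ℂ => t₀ + u (Fin.last n)) (𝓝 0) (𝓝 t₀) := by
      have h2 : Continuous (fun u : Fin (n + 1) → ℂ => t₀ + u (Fin.last n)) := by fun_prop
      simpa using h2.tendsto 0
    filter_upwards [h1.eventually h.apply_t] with u hu
    rw [hΨ, orbitParam, act_apply_t]
    exact hu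
  have hP0 : (Ψ ∘ torusCoord S t₀) 0 = z := by
    rw [Function.comp_apply, hQ0]
    exact h.isChart.map_zero
  have hρt : Filter.Tendsto ρ (𝓝 z) (𝓝 0) := by
    have h1 := h.isChart.contDiffAt_inv.continuousAt
    rwa [ContinuousAt, h.isChart.inv_apply] at h1
  have hAc : ContDiffAt ℝ ω (D.torusAngle ρ t₀) z := by
    have h1 : ContDiffAt ℝ ω ρ z := h.isChart.contDiffAt_inv.restrict_scalars ℝ
    refine contDiffAt_pi.2 fun j => ?_
    induction j using Fin.lastCases with
    | last =>
      simp only [torusAngle, Fin.snoc_last]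
      have h2 : ContDiffAt ℂ ω (fun w => Complex.log (1 + ρ w (Fin.last n) / (t₀ - 1))) z := by
        have h3 : ContDiffAt ℂ ω (fun w => 1 + ρ w (Fin.last n) / (t₀ - 1)) z :=
          contDiffAt_const.add ((contDiffAt_pi.1 h.isChart.contDiffAt_inv _).div_const _)
        refine ContDiffAt.comp (g := Complex.log) z (Complex.contDiffAt_log ?_) h3
        simp [h.isChart.inv_apply]
      exact Complex.imCLM.contDiff.contDiffAt.comp z (h2.restrict_scalars ℝ)
    | cast a =>
      simp only [torusAngle, Fin.snoc_castSucc]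
      exact Complex.imCLM.contDiff.contDiffAt.comp z (contDiffAt_pi.1 h1 a.castSucc)
  have hA0 : D.torusAngle ρ t₀ z = 0 := by
    ext j
    induction j using Fin.lastCases <;> simp [torusAngle, h.isChart.inv_apply]
  have hAt : Filter.Tendsto (fun w => D.torusAngle ρ t₀ w (Fin.last n)) (𝓝 z) (𝓝 0) := by
    have h1 : Filter.Tendsto (D.torusAngle ρ t₀) (𝓝 z) (𝓝 0) := by
      simpa only [ContinuousAt, hA0] using hAc.continuousAt
    exact hlast.comp h1
  refine ⟨hP0, hPc, hAc, ?_, ?_, ?_⟩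
  · have h1 : ∀ᶠ w in 𝓝 ((Ψ ∘ torusCoord S t₀) 0), w ∉ D.singularLocus ε := by
      rw [hP0]
      exact (D.isClosed_singularLocus ε).isOpen_compl.eventually_mem hz.2
    filter_upwards [hPc.continuousAt.eventually h1, hQt.eventually h.isChart.mem,
      hlast.eventually hSm, hQt.eventually hΨt] with s hs1 hs2 hs3 hs4
    refine ⟨⟨hs2.1, ?_, fun a => ?_⟩, hs1⟩
    · rw [Function.comp_apply, hs4, torusCoord_last]
      have h2 : t₀ + (t₀ - 1) * (Complex.exp (Complex.I * s (Fin.last n)) - 1) - 1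
          = (t₀ - 1) * Complex.exp (Complex.I * s (Fin.last n)) := by ring
      rw [h2, norm_mul, mul_comm Complex.I, Complex.norm_exp_ofReal_mul_I, mul_one]
      exact hz.1.2.1
    · rw [Function.comp_apply, hmom, hs3]
  · have h1 : ∀ᶠ x in 𝓝 (0 : ℝ), |x| < Real.pi :=
      (continuous_abs.continuousAt (x := (0 : ℝ))).eventually_lt_const (by simp [Real.pi_pos])
    filter_upwards [hQt.eventually h.isChart.left_inv, hlast.eventually h1] with s hs1 hs2
    have h2 : ρ ((Ψ ∘ torusCoord S t₀) s) = torusCoord S t₀ s := hs1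
    ext j
    induction j using Fin.lastCases with
    | last =>
      rw [torusAngle, Fin.snoc_last, h2, torusCoord_last, mul_div_cancel_left₀ _ ht1,
        add_sub_cancel, Complex.log_exp] <;> simp [(abs_lt.1 hs2).1, (abs_lt.1 hs2).2.le]
    | cast a =>
      rw [torusAngle, Fin.snoc_castSucc, h2]
      simp
  -- Weights active at `z` stay active nearby, so the moment map remains injective on the real
  -- orbits through nearby points of the section.
  · have h1 : ∀ᶠ ψ in 𝓝 (0 : ℝ), ∀ q, c 0 q ≠ 0 → c ψ q ≠ 0 := by
      refine Filter.eventually_all.2 fun q => ?_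
      by_cases hq : c 0 q = 0
      · simp [hq]
      · exact ((contDiffAt_pi.1 hcc q).continuousAt.eventually_ne hq).mono fun ψ h1 _ => h1
    have h2 : 𝓝[D.torus ε r δ \ D.singularLocus ε] z ≤ 𝓝[D.divisorComplement ε] z :=
      nhdsWithin_mono z (Set.sdiff_subset.trans (D.torus_subset_divisorComplement hr δ))
    filter_upwards [h.isChart.right_inv.filter_mono h2, self_mem_nhdsWithin,
      (hρt.eventually hΨt).filter_mono nhdsWithin_le_nhds,
      (hAt.eventually h1).filter_mono nhdsWithin_le_nhds,
      (hAt.eventually hSm).filter_mono nhdsWithin_le_nhds] with w hw1 hw2 hw3 hw4 hw5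
    set ψ := D.torusAngle ρ t₀ w (Fin.last n) with hψ
    have hwt : w (D.t 0) = t₀ + ρ w (Fin.last n) := by
      rw [← hw3]
      exact congrFun hw1.symm _
    set X := 1 + ρ w (Fin.last n) / (t₀ - 1) with hX
    have hX1 : (t₀ - 1) * X = w (D.t 0) - 1 := by
      rw [hwt, hX]
      field_simp
      ring
    have hXn : ‖X‖ = 1 := by
      have h3 := congrArg norm hX1
      rw [norm_mul, hw2.1.2.1, hz.1.2.1] at h3
      exact (mul_eq_left₀ hr.ne').1 h3
    have hexp : Complex.exp (Complex.I * ψ) = X := by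
      have h3 : ψ = (Complex.log X).im := Fin.snoc_last (α := fun _ => ℝ) _ _
      have h4 : Complex.log X = Complex.I * ψ := by
        apply Complex.ext
        · simp [Complex.log_re, hXn]
        · simp [h3]
      rw [← h4, Complex.exp_log]
      intro h5
      simp [h5] at hXn
    have hlastu : (t₀ - 1) * (Complex.exp (Complex.I * ψ) - 1) = ρ w (Fin.last n) := by
      rw [hexp, mul_sub, hX1, hwt]
      ring
    have hre : (fun a => (ρ w a.castSucc).re) = S ψ := by
      refine orbitMoment_injective (v := fun q : D.genSet => q.1.1) (c := c ψ)
        (fun q => sq_nonneg _) (fun x hx => hspan x fun q hq => hx q (hw4 q hq)) ?_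
      rw [hw5]
      have h3 : D.moment (Ψ (ρ w)) = δ := by
        rw [show Ψ (ρ w) = w from hw1]
        exact funext hw2.1.2.2
      rw [← h3, hΨ, orbitParam, moment_act, ← hlastu]
      rfl
    have hQ : torusCoord S t₀ (D.torusAngle ρ t₀ w) = ρ w := by
      ext j
      induction j using Fin.lastCases with
      | last => rw [torusCoord_last, ← hψ, hlastu]
      | cast a =>
        have h3 : D.torusAngle ρ t₀ w a.castSucc = (ρ w a.castSucc).im :=
          Fin.snoc_castSucc (α := fun _ => ℝ) _ _ _
        rw [torusCoord_castSucc, ← hψ, ← hre, h3, mul_comm]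
        exact Complex.re_add_im _
    rw [Function.comp_apply, hQ]
    exact hw1

end AdmissibleDecomposition

/-! ### Algebra of the standard symplectic form. -/

section Symplectic

variable {ι : Type*} [Fintype ι]

theorem stdSymplectic_add_left (u v w : ι → ℂ) :
    stdSymplectic (u + v) w = stdSymplectic u w + stdSymplectic v w := by
  simp only [stdSymplectic, Pi.add_apply, map_add, add_mul, Complex.add_im, Finset.sum_add_distrib]

theorem stdSymplectic_smul_left (c : ℝ) (u v : ι → ℂ) :
    stdSymplectic (c • u) v = c * stdSymplectic u v := by
  simp only [stdSymplectic, Pi.smul_apply, Finset.mul_sum]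
  refine Finset.sum_congr rfl fun q _ => ?_
  simp
  ring

theorem stdSymplectic_swap (u v : ι → ℂ) : stdSymplectic u v = -stdSymplectic v u := by
  simp only [stdSymplectic, ← Finset.sum_neg_distrib]
  refine Finset.sum_congr rfl fun q _ => ?_
  simp
  ring

theorem stdSymplectic_self (u : ι → ℂ) : stdSymplectic u u = 0 := by
  have := stdSymplectic_swap u u
  linarith

end Symplectic

theorem DifferentiableAt.hasDerivAt_line {E F : Type*} [NormedAddCommGroup E] [NormedSpace ℝ E]
    [NormedAddCommGroup F] [NormedSpace ℝ F] {f : E → F} (hf : DifferentiableAt ℝ f 0) (u : E) :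
    HasDerivAt (fun l : ℝ => f (l • u)) (fderiv ℝ f 0 u) 0 := by
  have h1 : HasDerivAt (fun l : ℝ => l • u) u 0 := by
    simpa using (hasDerivAt_id (0 : ℝ)).smul_const u
  have h2 : HasFDerivAt f (fderiv ℝ f 0) ((0 : ℝ) • u) := by simpa using hf.hasFDerivAt
  exact h2.comp_hasDerivAt (0 : ℝ) h1

namespace AdmissibleDecomposition

variable {n k : ℕ} {D : AdmissibleDecomposition n k} [NeZero k] {ε : Fin k → ℂ} {r : ℝ}
  {δ : Fin n → ℝ} {z : D.Ambient} {σ : ℂ → D.Ambient} {ρ : D.Ambient → Fin (n + 1) → ℂ}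
  {S : ℝ → Fin n → ℝ}

/-! ### The fibres are special Lagrangian -/

namespace IsTorusChart

theorem differentiableAt (h : D.IsTorusChart ε r δ z σ ρ S) :
    DifferentiableAt ℝ (D.orbitParam σ (z (D.t 0)) ∘ torusCoord S (z (D.t 0))) 0 :=
  h.isChart.contDiffAt.differentiableAt (by simp)

theorem fderiv_snoc_zero (h : D.IsTorusChart ε r δ z σ ρ S) (θ : Fin n → ℝ) (q : D.genSet) :
    fderiv ℝ (D.orbitParam σ (z (D.t 0)) ∘ torusCoord S (z (D.t 0))) 0
      (Fin.snoc (α := fun _ => ℝ) θ 0) q = Complex.I * realPairing q.1.1 θ * z q := by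
  have h1 := hasDerivAt_pi.1 (h.differentiableAt.hasDerivAt_line
    (Fin.snoc (α := fun _ => ℝ) θ 0)) q
  refine h1.unique ?_
  have h2 : ∀ l : ℝ, (D.orbitParam σ (z (D.t 0)) ∘ torusCoord S (z (D.t 0)))
      (l • Fin.snoc (α := fun _ => ℝ) θ 0) q
      = Complex.exp ((l : ℂ) * (Complex.I * realPairing q.1.1 θ)) * z q := by
    intro l
    have h3 : Fin.init (torusCoord S (z (D.t 0)) (l • Fin.snoc (α := fun _ => ℝ) θ 0))
        = (l * Complex.I) • fun a => (θ a : ℂ) := by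
      funext a
      simp [Fin.init, h.map_zero]
      ring
    have h4 : torusCoord S (z (D.t 0)) (l • Fin.snoc (α := fun _ => ℝ) θ 0) (Fin.last n) = 0 := by
      simp
    rw [Function.comp_apply, orbitParam, act, h3, h4, add_zero, h.isOrbitChart.apply_self,
      map_smul, weightPairing_ofReal, smul_eq_mul, mul_assoc]
  simp only [h2]
  have h5 := ((Complex.ofRealCLM.hasDerivAt (x := (0 : ℝ))).mul_const
    (Complex.I * realPairing q.1.1 θ)).cexp.mul_const (z q)
  simpa using h5

/-- Half the derivative of the moment map, which is constant on the fibre. -/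
theorem sum_re_conj_mul_fderiv (h : D.IsTorusChart ε r δ z σ ρ S) (u : Fin (n + 1) → ℝ)
    (a : Fin n) : ∑ q : D.genSet, (q.1.1 a : ℝ) * (starRingEnd ℂ (z q) *
      fderiv ℝ (D.orbitParam σ (z (D.t 0)) ∘ torusCoord S (z (D.t 0))) 0 u q).re = 0 := by
  set P := D.orbitParam σ (z (D.t 0)) ∘ torusCoord S (z (D.t 0)) with hP
  have h1 : ∀ q, HasDerivAt (fun l : ℝ => ‖P (l • u) q‖ ^ 2)
      (2 * (starRingEnd ℂ (z q) * fderiv ℝ P 0 u q).re) 0 := by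
    intro q
    have h2 := (hasDerivAt_pi.1 (h.differentiableAt.hasDerivAt_line u) q).norm_sq
    have h3 : P ((0 : ℝ) • u) = z := by
      rw [zero_smul]
      exact h.isChart.map_zero
    rw [← hP, h3, Complex.inner, mul_comm (fderiv ℝ P 0 u q)] at h2
    exact h2
  have h4 := HasDerivAt.fun_sum fun q (_ : q ∈ Finset.univ) => (h1 q).const_mul (q.1.1 a : ℝ)
  have h5 : (fun l : ℝ => ∑ q : D.genSet, (q.1.1 a : ℝ) * ‖P (l • u) q‖ ^ 2)
      =ᶠ[𝓝 0] fun _ => δ a := by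
    have h6 : Filter.Tendsto (fun l : ℝ => l • u) (𝓝 0) (𝓝 0) := by
      have : Continuous (fun l : ℝ => l • u) := by fun_prop
      simpa using this.tendsto 0
    filter_upwards [h6.eventually h.isChart.mem] with l hl
    exact hl.1.2.2 a
  have h7 := (h4.congr_of_eventuallyEq h5.symm).unique (hasDerivAt_const (0 : ℝ) (δ a))
  have h8 : 2 * ∑ q : D.genSet, (q.1.1 a : ℝ) * (starRingEnd ℂ (z q) * fderiv ℝ P 0 u q).re = 0 := by
    rw [← h7, Finset.mul_sum]
    exact Finset.sum_congr rfl fun q _ => by ring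
  linarith

/-- Pairing a rotation with a tangent vector gives a derivative of the moment map, hence 0. Modulo
rotations the tangent space is one-dimensional, and the form is alternating. -/
theorem stdSymplectic_fderiv (h : D.IsTorusChart ε r δ z σ ρ S) (u v : Fin (n + 1) → ℝ) :
    stdSymplectic
      (fderiv ℝ (D.orbitParam σ (z (D.t 0)) ∘ torusCoord S (z (D.t 0))) 0 u)
      (fderiv ℝ (D.orbitParam σ (z (D.t 0)) ∘ torusCoord S (z (D.t 0))) 0 v) = 0 := by
  set A := fderiv ℝ (D.orbitParam σ (z (D.t 0)) ∘ torusCoord S (z (D.t 0))) 0 with hA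
  have h1 : ∀ (θ : Fin n → ℝ) v, stdSymplectic (A (Fin.snoc (α := fun _ => ℝ) θ 0)) (A v) = 0 := by
    intro θ v
    have h2 : ∀ q, (starRingEnd ℂ (A (Fin.snoc (α := fun _ => ℝ) θ 0) q) * A v q).im
        = -(realPairing q.1.1 θ * (starRingEnd ℂ (z q) * A v q).re) := by
      intro q
      rw [hA, h.fderiv_snoc_zero]
      simp
      ring
    have h3 : ∀ q : D.genSet, realPairing q.1.1 θ * (starRingEnd ℂ (z q) * A v q).re
        = ∑ a, θ a * ((q.1.1 a : ℝ) * (starRingEnd ℂ (z q) * A v q).re) := by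
      intro q
      rw [realPairing_apply, Finset.sum_mul]
      exact Finset.sum_congr rfl fun a _ => by ring
    simp only [stdSymplectic, h2, h3, Finset.sum_neg_distrib]
    rw [Finset.sum_comm]
    simp only [← Finset.mul_sum]
    rw [Finset.sum_eq_zero fun a _ => by rw [h.sum_re_conj_mul_fderiv v a, mul_zero], neg_zero]
  have h2 : ∀ u : Fin (n + 1) → ℝ, A u = A (Fin.snoc (α := fun _ => ℝ) (Fin.init u) 0)
      + u (Fin.last n) • A (Pi.single (Fin.last n) 1) := by
    intro u
    rw [← map_smul, ← map_add]
    congr 1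
    ext j
    induction j using Fin.lastCases <;> simp [Fin.init, (Fin.castSucc_lt_last _).ne]
  rw [h2 u, stdSymplectic_add_left, h1, zero_add, stdSymplectic_smul_left, stdSymplectic_swap, h2 v,
    stdSymplectic_add_left, h1, stdSymplectic_smul_left, stdSymplectic_self]
  simp

theorem fderiv_eq (h : D.IsTorusChart ε r δ z σ ρ S) (u : Fin (n + 1) → ℝ) :
    fderiv ℝ (D.orbitParam σ (z (D.t 0)) ∘ torusCoord S (z (D.t 0))) 0 u
      = fderiv ℂ (D.orbitParam σ (z (D.t 0))) 0 (fderiv ℝ (torusCoord S (z (D.t 0))) 0 u) := by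
  have h0 := torusCoord_zero h.map_zero (z (D.t 0))
  have h1 : HasFDerivAt (torusCoord S (z (D.t 0))) (fderiv ℝ (torusCoord S (z (D.t 0))) 0) 0 :=
    ((contDiffAt_torusCoord h.contDiffAt).differentiableAt (by simp)).hasFDerivAt
  have h2 : HasFDerivAt (D.orbitParam σ (z (D.t 0))) (fderiv ℂ (D.orbitParam σ (z (D.t 0))) 0)
      (torusCoord S (z (D.t 0)) 0) := by
    rw [h0]
    exact (h.isOrbitChart.isChart.contDiffAt.differentiableAt (by simp)).hasFDerivAt
  rw [((h2.restrictScalars ℝ).comp 0 h1).fderiv]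
  rfl

/-- The derivative of `S` enters only the last row, off the diagonal, so the matrix is triangular.
-/
theorem det_fderiv_torusCoord (h : D.IsTorusChart ε r δ z σ ρ S) :
    (Matrix.of fun j => fderiv ℝ (torusCoord S (z (D.t 0))) 0 (Pi.single j 1)).det
      = Complex.I ^ (n + 1) * (z (D.t 0) - 1) := by
  set t₀ := z (D.t 0)
  have hd : DifferentiableAt ℝ (torusCoord S t₀) 0 :=
    (contDiffAt_torusCoord h.contDiffAt).differentiableAt (by simp)
  have h1 : ∀ a : Fin n, fderiv ℝ (torusCoord S t₀) 0 (Pi.single a.castSucc 1)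
      = Pi.single a.castSucc Complex.I := by
    intro a
    refine (hd.hasDerivAt_line _).unique ?_
    have h2 : ∀ l : ℝ, torusCoord S t₀ (l • Pi.single a.castSucc 1)
        = (l : ℂ) • Pi.single a.castSucc Complex.I := by
      intro l
      ext j
      induction j using Fin.lastCases with
      | last => simp [(Fin.castSucc_lt_last a).ne']
      | cast b =>
        by_cases hb : b = a
        · subst hb
          simp [h.map_zero, (Fin.castSucc_lt_last _).ne', mul_comm]
        · simp [h.map_zero, (Fin.castSucc_lt_last _).ne', hb]
    simp only [h2]
    simpa using (Complex.ofRealCLM.hasDerivAt (x := (0 : ℝ))).smul_const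
      (Pi.single a.castSucc Complex.I : Fin (n + 1) → ℂ)
  have h3 : fderiv ℝ (torusCoord S t₀) 0 (Pi.single (Fin.last n) 1) (Fin.last n)
      = Complex.I * (t₀ - 1) := by
    refine (hasDerivAt_pi.1 (hd.hasDerivAt_line _) _).unique ?_
    simp only [torusCoord_last, Pi.smul_apply, Pi.single_eq_same, smul_eq_mul, mul_one]
    have h4 := (((Complex.ofRealCLM.hasDerivAt (x := (0 : ℝ))).const_mul
      Complex.I).cexp.sub_const 1).const_mul (t₀ - 1)
    simpa [mul_comm] using h4
  rw [Matrix.det_eq_mul_of_last_column _ (by simp [h1, (Fin.castSucc_lt_last _).ne'])]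
  have h5 : (Matrix.of fun j => fderiv ℝ (torusCoord S t₀) 0 (Pi.single j 1)).submatrix
      Fin.castSucc Fin.castSucc = Complex.I • (1 : Matrix (Fin n) (Fin n) ℂ) := by
    ext a b
    simp [h1, Matrix.one_apply, Pi.single_apply, eq_comm]
  rw [h5, Matrix.det_smul, Matrix.det_one, Matrix.of_apply, h3, Fintype.card_fin]
  ring

/-- The Jacobian factor cancels `t_1 - 1` in the volume form and `i^{n+1} · i^{n+1} = (-1)^{n+1}`;
everything else is a real determinant. -/
theorem volForm_fderiv_im (h : D.IsTorusChart ε r δ z σ ρ S) (hε : ε 0 = 0)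
    (hεi : Function.Injective ε) (hz : z ∈ D.divisorComplement ε)
    (u : Fin (n + 1) → Fin (n + 1) → ℝ) :
    (D.volForm ε z fun j =>
      fderiv ℝ (D.orbitParam σ (z (D.t 0)) ∘ torusCoord S (z (D.t 0))) 0 (u j)).im = 0 := by
  simp only [h.fderiv_eq]
  set B := fderiv ℝ (torusCoord S (z (D.t 0))) 0 with hB
  have h1 := (D.volForm ε z).map_linearMap_apply
    (fderiv ℂ (D.orbitParam σ (z (D.t 0))) 0).toLinearMap fun j => B (u j)
  simp only [ContinuousLinearMap.coe_coe] at h1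
  have h2 : (Matrix.of fun j => B (u j))
      = (Matrix.of u).map Complex.ofRealHom * Matrix.of fun j => B (Pi.single j 1) := by
    ext i j
    conv_lhs => rw [Matrix.of_apply, pi_eq_sum_univ' (u i), map_sum]
    simp [Matrix.mul_apply]
  have ht : z (D.t 0) - 1 ≠ 0 := sub_ne_zero.2 hz.2
  rw [h1, h2, Matrix.det_mul, hB, h.det_fderiv_torusCoord, h.isOrbitChart.volForm_apply hε hεi hz,
    ← RingHom.mapMatrix_apply, ← RingHom.map_det]
  have h3 : ∀ K d : ℂ, K * (Complex.I ^ (n + 1) * (z (D.t 0) - 1)) *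
      (Complex.I ^ (n + 1) * d / (z (D.t 0) - 1)) = K * d * (-1) ^ (n + 1) := by
    intro K d
    field_simp
    rw [← pow_mul, mul_comm (n + 1) 2, pow_mul, Complex.I_sq]
    ring
  rw [h3]
  have h4 : Complex.ofRealHom (Matrix.of u).det * (((D.X 0)⁻¹.det : ℤ) : ℂ) * (-1) ^ (n + 1)
      = (((Matrix.of u).det * ((D.X 0)⁻¹.det : ℤ) * (-1) ^ (n + 1) : ℝ) : ℂ) := by
    simp only [Complex.ofReal_mul, Complex.ofReal_pow, Complex.ofReal_neg, Complex.ofReal_one,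
      Complex.ofReal_intCast, Complex.ofRealHom_eq_coe]
  rw [h4, Complex.ofReal_im]

end IsTorusChart

variable (D) in
theorem isSpecialLagrangian_torus_diff_singularLocus (hε : ε 0 = 0) (hεi : Function.Injective ε)
    (hr : 0 < r) (δ : Fin n → ℝ) : IsSpecialLagrangian (n + 1) (D.divisorComplement ε)
      (D.volForm ε) 0 (D.torus ε r δ \ D.singularLocus ε) where
  subset := Set.sdiff_subset.trans (D.torus_subset_divisorComplement hr δ)
  submanifold z hz := by
    obtain ⟨σ, ρ, S, h⟩ := D.exists_isTorusChart hε hεi hr hz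
    exact ⟨_, h.isChart.isLocalParam⟩
  isotropic z hz φ hφ u v := by
    obtain ⟨σ, ρ, S, h⟩ := D.exists_isTorusChart hε hεi hr hz
    -- Tangent vectors of any parametrization are tangent vectors of the torus chart.
    rw [h.isChart.fderiv_zero_eq_comp hφ]
    exact h.stdSymplectic_fderiv _ _
  special z hz φ hφ u := by
    obtain ⟨σ, ρ, S, h⟩ := D.exists_isTorusChart hε hεi hr hz
    rw [h.isChart.fderiv_zero_eq_comp hφ, Complex.ofReal_zero, mul_zero, neg_zero,
      Complex.exp_zero, one_mul]
    exact h.volForm_fderiv_im hε hεi (D.torus_subset_divisorComplement hr δ hz.1) fun j =>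
      fderiv ℝ (_ ∘ φ) 0 (u j)

theorem torus_diff_singularLocus (hr : ∀ p, ‖ε p - 1‖ ≠ r) (δ : Fin n → ℝ) :
    D.torus ε r δ \ D.singularLocus ε = D.torus ε r δ := by
  refine sdiff_eq_left.2 (Set.disjoint_left.2 ?_)
  rintro z ⟨-, h1, -⟩ ⟨-, p, h2, -⟩
  exact hr p (by rw [← h2, h1])

end AdmissibleDecomposition

namespace AdmissibleDecomposition

variable {n k : ℕ} (D : AdmissibleDecomposition n k) {ε : Fin k → ℂ}

/-! ### The positions of the weights -/

theorem sum_row_mul_realPairing_zcol (p : Fin k) (x : Fin n → ℝ) (a : Fin n) :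
    ∑ j, (D.X p j a : ℝ) * realPairing (D.zcol p j) x = x a := by
  have h := Matrix.nonsing_inv_mul (D.X p) (D.isUnit_det p)
  have h1 : ∀ c, ∑ j, (D.X p j a : ℝ) * (D.zcol p j c : ℝ) = if c = a then 1 else 0 := by
    intro c
    have h2 := congrFun (congrFun h c) a
    rw [Matrix.mul_apply, Matrix.one_apply] at h2
    have h3 : ((∑ j, (D.X p)⁻¹ c j * D.X p j a : ℤ) : ℝ) = ((if c = a then 1 else 0 : ℤ) : ℝ) :=
      congrArg _ h2
    push_cast at h3
    rw [← h3]
    exact Finset.sum_congr rfl fun j _ => mul_comm _ _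
  simp only [realPairing_apply, Finset.mul_sum, ← mul_assoc]
  rw [Finset.sum_comm]
  simp only [← Finset.sum_mul, h1]
  simp

/-- The weights `a_{p,j}` and `b_p` add up to 0, and those of `w⁺_{p,l}` and `w⁻_{p,l}` are
opposite. If no pairing is positive, then all vanish, and the columns of `X_p⁻¹` form a basis. -/
theorem exists_realPairing_pos (p : Fin k) {x : Fin n → ℝ} (hx : x ≠ 0) :
    ∃ q : D.genSet, 0 < realPairing q.1.1 x := by
  by_contra! h
  have h1 : ∀ j, realPairing (D.zcol p j) x ≤ 0 := fun j => h (D.xw p j)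
  have h2 : ∑ j with j.val < D.m p, realPairing (D.zcol p j) x = -realPairing (D.b p) x := by
    simp only [realPairing_apply, b, Pi.neg_apply, Finset.sum_apply, Int.cast_neg, Int.cast_sum,
      neg_mul, Finset.sum_neg_distrib, neg_neg, Finset.sum_mul]
    exact Finset.sum_comm
  have h3 : ∑ j with j.val < D.m p, realPairing (D.zcol p j) x = 0 := by
    refine le_antisymm (Finset.sum_nonpos fun j _ => h1 j) ?_
    rw [h2]
    exact neg_nonneg.2 (h (D.y p))
  rw [Finset.sum_eq_zero_iff_of_nonpos fun j _ => h1 j] at h3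
  refine hx (funext fun a => ?_)
  rw [← D.sum_row_mul_realPairing_zcol p x a]
  refine Finset.sum_eq_zero fun j _ => ?_
  rcases lt_or_ge j.val (D.m p) with hj | hj
  · rw [h3 j (by simpa using hj), mul_zero]
  · have h4 : realPairing (-D.zcol p j) x ≤ 0 := h (D.wneg p j hj)
    have h5 : realPairing (-D.zcol p j) x = -realPairing (D.zcol p j) x := by
      simp [realPairing_apply]
    rw [le_antisymm (h1 j) (by linarith), mul_zero]

/-! ### A section over the complement of the critical values -/

/-- The point of the deformation with the given value of `t_1` at which the noncompact part of the
torus acts by `1`. -/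
def base (ε : Fin k → ℂ) (t : ℂ) : D.Ambient := fun q => ∏ i, shift ε t i ^ q.1.2 i

theorem base_t (ε : Fin k → ℂ) (t : ℂ) (i : Fin k) : D.base ε t (D.t i) = t - ε i := by
  rw [base, Finset.prod_eq_single i]
  · simp [AdmissibleDecomposition.t, shift]
  · intro j _ hj
    simp [AdmissibleDecomposition.t, hj]
  · simp

theorem base_ne_zero {t : ℂ} (ht : ∀ i, t ≠ ε i) (q : D.genSet) : D.base ε t q ≠ 0 :=
  Finset.prod_ne_zero_iff.2 fun i _ => zpow_ne_zero _ (sub_ne_zero.2 (ht i))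

theorem analyticAt_base {t : ℂ} (ht : ∀ i, t ≠ ε i) : AnalyticAt ℂ (D.base ε) t :=
  analyticAt_pi_iff.2 fun _ => Finset.analyticAt_fun_prod _ fun i _ =>
    (analyticAt_id.sub analyticAt_const).fun_zpow (sub_ne_zero.2 (ht i))

theorem torusMap_eq_act_base {t : ℂ} {τ : (Fin n → ℂˣ) × (Fin k → ℂˣ)} {ζ : Fin n → ℂ}
    (h1 : ∀ a, (τ.1 a : ℂ) = Complex.exp (ζ a)) (h2 : ∀ i, (τ.2 i : ℂ) = t - ε i) :
    D.torusMap τ = D.act ζ (D.base ε t) := by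
  funext q
  simp only [torusMap, act, base, Units.val_mul, Units.coe_prod, Units.val_zpow_eq_zpow_val, h1, h2]
  congr 1
  rw [weightPairing_apply, Complex.exp_sum]
  exact Finset.prod_congr rfl fun a _ => (Complex.exp_int_mul _ _).symm

theorem act_base_mem_deformation [NeZero k] (hε : ε 0 = 0) {t : ℂ} (ht : ∀ i, t ≠ ε i)
    (ζ : Fin n → ℂ) :
    D.act ζ (D.base ε t) ∈ D.deformation ε := by
  refine ⟨?_, fun i => ?_⟩
  · rw [← D.torusMap_eq_act_base (τ := (fun a => Units.mk0 _ (Complex.exp_ne_zero (ζ a)),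
      fun i => Units.mk0 _ (sub_ne_zero.2 (ht i)))) (fun _ => rfl) fun _ => rfl]
    exact D.torusMap_mem_toricVariety _
  · rw [act_apply_t, act_apply_t, base_t, base_t, hε]
    ring

/-- On a regular fibre no coordinate vanishes, so the point is in the torus image; `ζ` is the
logarithm of its first `n` torus coordinates. -/
theorem exists_eq_act_base [NeZero k] {z : D.Ambient} (hz : z ∈ D.deformation ε)
    (ht : ∀ i, z (D.t 0) ≠ ε i) : ∃ ζ, z = D.act ζ (D.base ε (z (D.t 0))) := by
  have hT : ∀ i, z (D.t i) ≠ 0 := fun i => by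
    rw [D.apply_t hz]
    exact sub_ne_zero.2 (ht i)
  obtain ⟨τ, hτ⟩ := D.exists_torusMap_eq_mono (p := 0)
    (fun j => D.coord_ne_zero_of_forall_ne hz ht j) fun i _ => hT i
  rw [← D.eq_mono hz.1 fun i _ => hT i] at hτ
  refine ⟨fun a => Complex.log (τ.1 a), ?_⟩
  rw [← D.torusMap_eq_act_base (τ := τ) (fun a => (Complex.exp_log (τ.1 a).ne_zero).symm) ?_, hτ]
  intro i
  rw [← D.apply_t hz, ← hτ]
  simp only [torusMap, t, Units.val_mul, Units.coe_prod, Units.val_zpow_eq_zpow_val]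
  rw [Finset.prod_eq_single (a := i) (f := fun l =>
    (τ.2 l : ℂ) ^ (Pi.single i (1 : ℤ) : Fin k → ℤ) l)]
  · simp
  · intro l _ hl
    simp [hl]
  · simp

/-! ### The global parametrization of the torus -/

/-- The points of the circle `γ(r)`. -/
def circlePoint (r ψ : ℝ) : ℂ := 1 + r * Complex.exp (Complex.I * ψ)

theorem norm_circlePoint_sub_one {r : ℝ} (hr : 0 < r) (ψ : ℝ) : ‖circlePoint r ψ - 1‖ = r := by
  rw [circlePoint, add_sub_cancel_left, norm_mul, mul_comm Complex.I,
    Complex.norm_exp_ofReal_mul_I, mul_one, Complex.norm_real, Real.norm_of_nonneg hr.le]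

theorem contDiff_circlePoint (r : ℝ) : ContDiff ℝ ω (circlePoint r) :=
  contDiff_const.add (contDiff_const.mul (contDiff_const.mul Complex.ofRealCLM.contDiff).cexp)

theorem circlePoint_eq_iff {r : ℝ} (hr : 0 < r) (ψ ψ' : ℝ) :
    circlePoint r ψ = circlePoint r ψ' ↔ ∃ p : ℤ, ψ - ψ' = 2 * Real.pi * p := by
  have hr' : (r : ℂ) ≠ 0 := by exact_mod_cast hr.ne'
  rw [circlePoint, circlePoint, add_right_inj, mul_right_inj' hr', Complex.exp_eq_exp_iff_exists_int]
  refine exists_congr fun p => ?_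
  rw [show Complex.I * ψ' + p * (2 * Real.pi * Complex.I)
    = Complex.I * (ψ' + p * (2 * Real.pi)) by ring, mul_right_inj' Complex.I_ne_zero]
  constructor
  · intro h
    have h1 : ψ = ψ' + p * (2 * Real.pi) := by exact_mod_cast h
    rw [h1]
    ring
  · intro h
    have h1 : ψ = ψ' + p * (2 * Real.pi) := by linarith
    rw [h1]
    push_cast
    ring

theorem exists_circlePoint_eq {r : ℝ} {t : ℂ} (ht : ‖t - 1‖ = r) : ∃ ψ, circlePoint r ψ = t := by
  refine ⟨(t - 1).arg, ?_⟩
  rw [circlePoint, ← ht, mul_comm Complex.I, Complex.norm_mul_exp_arg_mul_I]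
  ring

theorem circlePoint_ne {r : ℝ} (hr : 0 < r) (hrε : ∀ p, ‖ε p - 1‖ ≠ r) (ψ : ℝ) (i : Fin k) :
    circlePoint r ψ ≠ ε i := fun h =>
  hrε i (by rw [← h, norm_circlePoint_sub_one hr])

theorem orbitMoment_base_injective [NeZero k] {r : ℝ} (hr : 0 < r) (hrε : ∀ p, ‖ε p - 1‖ ≠ r)
    (ψ : ℝ) : Function.Injective (orbitMoment
    (fun q : D.genSet => q.1.1) fun q => ‖D.base ε (circlePoint r ψ) q‖ ^ 2) := by
  refine orbitMoment_injective (fun q => sq_nonneg _) fun x hx => ?_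
  by_contra h0
  obtain ⟨q, hq⟩ := D.exists_realPairing_pos 0 h0
  exact hq.ne' (hx q (pow_ne_zero 2 (norm_ne_zero_iff.2
    (D.base_ne_zero (circlePoint_ne hr hrε ψ) q))))

/-- The noncompact part of the group elements which carry the section to the level of the moment
map. -/
theorem exists_moment_section [NeZero k] {r : ℝ} (hr : 0 < r) (hrε : ∀ p, ‖ε p - 1‖ ≠ r)
    (δ : Fin n → ℝ) : ∃ S : ℝ → Fin n → ℝ, ContDiff ℝ ω S ∧
    ∀ ψ, orbitMoment (fun q : D.genSet => q.1.1)
      (fun q => ‖D.base ε (circlePoint r ψ) q‖ ^ 2) (S ψ) = δ := by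
  have hpos : ∀ ψ (q : D.genSet), 0 < ‖D.base ε (circlePoint r ψ) q‖ ^ 2 := fun ψ q =>
    pow_pos (norm_pos_iff.2 (D.base_ne_zero (circlePoint_ne hr hrε ψ) q)) 2
  have hsurj : ∀ ψ, ∃ x, orbitMoment (fun q : D.genSet => q.1.1)
      (fun q => ‖D.base ε (circlePoint r ψ) q‖ ^ 2) x = δ := fun ψ =>
    orbitMoment_surjective (hpos ψ) (fun x hx => D.exists_realPairing_pos 0 hx) δ
  choose S hS using hsurj
  refine ⟨S, contDiff_iff_contDiffAt.2 fun ψ₀ => ?_, hS⟩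
  have hc : ContDiffAt ℝ ω (fun ψ (q : D.genSet) => ‖D.base ε (circlePoint r ψ) q‖ ^ 2) ψ₀ := by
    have h1 : ContDiffAt ℝ ω (fun ψ => D.base ε (circlePoint r ψ)) ψ₀ :=
      ContDiffAt.comp (g := D.base ε) ψ₀
        ((D.analyticAt_base (circlePoint_ne hr hrε ψ₀)).contDiffAt.restrict_scalars ℝ)
        (contDiff_circlePoint r).contDiffAt
    exact contDiffAt_pi.2 fun q => (contDiffAt_pi.1 h1 q).norm_sq ℝ
  obtain ⟨S', hS', -, hS'm⟩ := exists_orbitMoment_eq (v := fun q : D.genSet => q.1.1) hc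
    (fun q => (hpos ψ₀ q).le) (fun x hx => by
      by_contra h0
      obtain ⟨q, hq⟩ := D.exists_realPairing_pos 0 h0
      exact hq.ne' (hx q (hpos ψ₀ q).ne')) (S ψ₀)
  -- By uniqueness the pointwise choice `S` coincides locally with the analytic solution `S'`.
  refine hS'.congr_of_eventuallyEq (hS'm.mono fun ψ hψ => ?_)
  exact D.orbitMoment_base_injective hr hrε ψ (by rw [hS, hψ, hS])

/-- The parametrization of the torus by angles. -/
def torusParam (ε : Fin k → ℂ) (r : ℝ) (S : ℝ → Fin n → ℝ) (s : Fin (n + 1) → ℝ) : D.Ambient :=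
  D.act (fun a => (S (s (Fin.last n)) a : ℂ) + Complex.I * s a.castSucc)
    (D.base ε (circlePoint r (s (Fin.last n))))

theorem torusParam_t (ε : Fin k → ℂ) (r : ℝ) (S : ℝ → Fin n → ℝ) (s : Fin (n + 1) → ℝ)
    (i : Fin k) : D.torusParam ε r S s (D.t i) = circlePoint r (s (Fin.last n)) - ε i := by
  rw [torusParam, act_apply_t, base_t]

theorem weightPairing_ofReal_add_I_mul (v : Fin n → ℤ) (x y : Fin n → ℝ) :
    weightPairing v (fun a => (x a : ℂ) + Complex.I * y a)
      = realPairing v x + Complex.I * realPairing v y := by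
  have : (fun a => (x a : ℂ) + Complex.I * y a)
      = (fun a => (x a : ℂ)) + Complex.I • fun a => (y a : ℂ) := rfl
  rw [this, map_add, map_smul, weightPairing_ofReal, weightPairing_ofReal, smul_eq_mul]

theorem torusParam_apply (ε : Fin k → ℂ) (r : ℝ) (S : ℝ → Fin n → ℝ) (s : Fin (n + 1) → ℝ)
    (q : D.genSet) : D.torusParam ε r S s q
      = Complex.exp (realPairing q.1.1 (S (s (Fin.last n)))
        + Complex.I * realPairing q.1.1 (fun a => s a.castSucc))
        * D.base ε (circlePoint r (s (Fin.last n))) q := by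
  rw [torusParam, act, weightPairing_ofReal_add_I_mul]

theorem contDiff_torusParam {r : ℝ} (hr : 0 < r) (hrε : ∀ p, ‖ε p - 1‖ ≠ r) {S : ℝ → Fin n → ℝ}
    (hS : ContDiff ℝ ω S) : ContDiff ℝ ω (D.torusParam ε r S) := by
  have h1 : ContDiff ℝ ω fun s : Fin (n + 1) → ℝ => s (Fin.last n) := contDiff_apply ℝ ℝ _
  have h2 : ContDiff ℝ ω fun s : Fin (n + 1) → ℝ => fun a : Fin n => s a.castSucc :=
    contDiff_pi.2 fun a => contDiff_apply ℝ ℝ _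
  have h3 : ContDiff ℝ ω fun ψ => D.base ε (circlePoint r ψ) :=
    contDiff_iff_contDiffAt.2 fun ψ => ContDiffAt.comp (g := D.base ε) ψ
      ((D.analyticAt_base (circlePoint_ne hr hrε ψ)).contDiffAt.restrict_scalars ℝ)
      (contDiff_circlePoint r).contDiffAt
  refine contDiff_pi.2 fun q => ?_
  simp only [torusParam_apply]
  refine ContDiff.mul (ContDiff.cexp (ContDiff.add ?_ (contDiff_const.mul ?_))) ?_
  · exact Complex.ofRealCLM.contDiff.comp ((realPairing q.1.1).contDiff.comp (hS.comp h1))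
  · exact Complex.ofRealCLM.contDiff.comp ((realPairing q.1.1).contDiff.comp h2)
  · exact (contDiff_pi.1 h3 q).comp h1

theorem eq_zero_of_realPairing_eq_zero [NeZero k] {x : Fin n → ℝ}
    (hx : ∀ q : D.genSet, realPairing q.1.1 x = 0) : x = 0 := by
  by_contra h0
  obtain ⟨q, hq⟩ := D.exists_realPairing_pos 0 h0
  exact hq.ne' (hx q)

theorem injective_fderiv_torusParam [NeZero k] {r : ℝ} (hr : 0 < r) (hrε : ∀ p, ‖ε p - 1‖ ≠ r)
    {S : ℝ → Fin n → ℝ} (hS : ContDiff ℝ ω S) (s : Fin (n + 1) → ℝ) :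
    Function.Injective (fderiv ℝ (D.torusParam ε r S) s) := by
  have hd : DifferentiableAt ℝ (D.torusParam ε r S) s :=
    (D.contDiff_torusParam hr hrε hS).contDiffAt.differentiableAt (by simp)
  rw [injective_iff_map_eq_zero]
  intro u hu
  have hline : ∀ q, HasDerivAt (fun l : ℝ => D.torusParam ε r S (s + l • u) q) 0 0 := by
    intro q
    have h1 : HasDerivAt (fun l : ℝ => s + l • u) u 0 := by
      simpa using ((hasDerivAt_id (0 : ℝ)).smul_const u).const_add s
    have h2 : HasFDerivAt (D.torusParam ε r S) (fderiv ℝ (D.torusParam ε r S) s)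
        (s + (0 : ℝ) • u) := by simpa using hd.hasFDerivAt
    have h3 := hasDerivAt_pi.1 (h2.comp_hasDerivAt (0 : ℝ) h1) q
    rwa [hu] at h3
  have haff : ∀ a b : ℝ, HasDerivAt (fun l : ℝ => ((a + l * b : ℝ) : ℂ)) b 0 := by
    intro a b
    have h1 : HasDerivAt (fun l : ℝ => a + l * b) b 0 := by
      simpa using ((hasDerivAt_id (0 : ℝ)).mul_const b).const_add a
    exact h1.ofReal_comp
  have hlast : u (Fin.last n) = 0 := by
    have h1 := hline (D.t 0)
    simp only [torusParam_t, circlePoint, Pi.add_apply, Pi.smul_apply, smul_eq_mul] at h1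
    have h2 := (((((haff (s (Fin.last n)) (u (Fin.last n))).const_mul Complex.I).cexp.const_mul
      (r : ℂ)).const_add 1).sub_const (ε 0)).unique h1
    simpa [hr.ne'] using h2
  have hinit : (fun a : Fin n => u a.castSucc) = 0 := by
    refine D.eq_zero_of_realPairing_eq_zero fun q => ?_
    have h1 := hline q
    have h2 : ∀ l : ℝ, realPairing q.1.1 (fun a : Fin n => s a.castSucc + l * u a.castSucc)
        = realPairing q.1.1 (fun a : Fin n => s a.castSucc)
          + l * realPairing q.1.1 (fun a : Fin n => u a.castSucc) := by
      intro l
      rw [← smul_eq_mul, ← map_smul, ← map_add]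
      rfl
    simp only [torusParam_apply, Pi.add_apply, Pi.smul_apply, smul_eq_mul, hlast, mul_zero,
      add_zero, h2] at h1
    have h3 := ((((haff (realPairing q.1.1 fun a : Fin n => s a.castSucc)
      (realPairing q.1.1 fun a : Fin n => u a.castSucc)).const_mul Complex.I).const_add
      (realPairing q.1.1 (S (s (Fin.last n))) : ℂ)).cexp.mul_const
      (D.base ε (circlePoint r (s (Fin.last n))) q)).unique h1
    simpa [D.base_ne_zero (circlePoint_ne hr hrε _) q] using h3
  ext j
  induction j using Fin.lastCases with
  | last => exact hlast
  | cast a => exact congrFun hinit a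

theorem moment_torusParam (ε : Fin k → ℂ) (r : ℝ) (S : ℝ → Fin n → ℝ) (s : Fin (n + 1) → ℝ) :
    D.moment (D.torusParam ε r S s) = orbitMoment (fun q : D.genSet => q.1.1)
      (fun q => ‖D.base ε (circlePoint r (s (Fin.last n))) q‖ ^ 2) (S (s (Fin.last n))) := by
  rw [torusParam, moment_act]
  congr 1
  funext a
  simp

/-- Equality of two points forces equal `t_1`, hence equal `S`; the remaining phases agree modulo
`2π` on a lattice basis of weights, hence so do the angles. -/
theorem isEmbeddedTorus_torus [NeZero k] (hε : ε 0 = 0) {r : ℝ} (hr : 0 < r)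
    (hrε : ∀ p, ‖ε p - 1‖ ≠ r) (δ : Fin n → ℝ) :
    IsEmbeddedTorus (n + 1) (D.torus ε r δ) := by
  obtain ⟨S, hS, hSm⟩ := D.exists_moment_section hr hrε δ
  refine ⟨D.torusParam ε r S, (D.contDiff_torusParam hr hrε hS).of_le le_top,
    D.injective_fderiv_torusParam hr hrε hS, fun s s' => ⟨fun h => ?_, ?_⟩, ?_⟩
  · have h1 := congrFun h (D.t 0)
    rw [torusParam_t, torusParam_t, sub_left_inj] at h1
    obtain ⟨p₀, hp₀⟩ := (circlePoint_eq_iff hr _ _).1 h1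
    have h2 : S (s (Fin.last n)) = S (s' (Fin.last n)) := by
      refine D.orbitMoment_base_injective hr hrε (s (Fin.last n)) ?_
      rw [hSm, h1, hSm]
    have h3 : ∀ j : Fin n, ∃ m : ℤ, realPairing (D.zcol 0 j) (fun a => s a.castSucc)
        - realPairing (D.zcol 0 j) (fun a => s' a.castSucc) = 2 * Real.pi * m := by
      intro j
      have h4 := congrFun h (D.xw 0 j)
      rw [torusParam_apply, torusParam_apply, h1, h2,
        mul_left_inj' (D.base_ne_zero (circlePoint_ne hr hrε _) _),
        Complex.exp_add, Complex.exp_add, mul_right_inj' (Complex.exp_ne_zero _),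
        Complex.exp_eq_exp_iff_exists_int] at h4
      obtain ⟨m, hm⟩ := h4
      refine ⟨m, ?_⟩
      have h5 := congrArg Complex.im hm
      simp at h5
      have h6 : (D.xw 0 j).1.1 = D.zcol 0 j := rfl
      rw [h6] at h5
      linarith
    choose m hm using h3
    -- The multiples `m` are relative to the basis `zcol 0`; the integral inverse matrix `X_1` turns
    -- them into integers for the angles.
    refine ⟨Fin.snoc (α := fun _ => ℤ) (fun a => ∑ j, D.X 0 j a * m j) p₀, fun j => ?_⟩
    induction j using Fin.lastCases with
    | last => simpa using hp₀
    | cast a =>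
      rw [Fin.snoc_castSucc, ← D.sum_row_mul_realPairing_zcol 0 (fun a => s a.castSucc) a,
        ← D.sum_row_mul_realPairing_zcol 0 (fun a => s' a.castSucc) a, ← Finset.sum_sub_distrib]
      push_cast
      rw [Finset.mul_sum]
      refine Finset.sum_congr rfl fun j _ => ?_
      rw [← mul_sub, hm]
      ring
  · rintro ⟨p, hp⟩
    have h1 := (circlePoint_eq_iff hr _ _).2 ⟨p (Fin.last n), hp (Fin.last n)⟩
    -- Periodicity of `S`: its value is the unique solution determined by the point on the circle.
    have h2 : S (s (Fin.last n)) = S (s' (Fin.last n)) := by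
      refine D.orbitMoment_base_injective hr hrε (s (Fin.last n)) ?_
      rw [hSm, h1, hSm]
    funext q
    rw [torusParam_apply, torusParam_apply, h1, h2]
    congr 1
    rw [Complex.exp_eq_exp_iff_exists_int]
    refine ⟨∑ a : Fin n, q.1.1 a * p a.castSucc, ?_⟩
    have h3 : realPairing q.1.1 (fun a => s a.castSucc)
        = realPairing q.1.1 (fun a => s' a.castSucc)
          + 2 * Real.pi * ∑ a : Fin n, (q.1.1 a : ℝ) * p a.castSucc := by
      simp only [realPairing_apply, Finset.mul_sum, ← Finset.sum_add_distrib]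
      refine Finset.sum_congr rfl fun a _ => ?_
      rw [eq_add_of_sub_eq (hp a.castSucc)]
      ring
    rw [h3]
    push_cast
    ring
  · apply Set.Subset.antisymm
    · rintro _ ⟨s, rfl⟩
      refine ⟨D.act_base_mem_deformation hε (circlePoint_ne hr hrε _) _, ?_, fun a => ?_⟩
      · rw [torusParam_t, hε, sub_zero, norm_circlePoint_sub_one hr]
      · rw [moment_torusParam, hSm]
    · rintro z ⟨hz, hzr, hzm⟩
      obtain ⟨ψ, hψ⟩ := exists_circlePoint_eq hzr
      obtain ⟨ζ, hζ⟩ := D.exists_eq_act_base hz fun i => by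
        rw [← hψ]
        exact circlePoint_ne hr hrε ψ i
      rw [← hψ] at hζ
      have h1 : (fun a => (ζ a).re) = S ψ := by
        refine D.orbitMoment_base_injective hr hrε ψ ?_
        rw [hSm, ← moment_act, ← hζ]
        exact funext hzm
      refine ⟨Fin.snoc (α := fun _ => ℝ) (fun a => (ζ a).im) ψ, ?_⟩
      rw [torusParam, Fin.snoc_last, hζ]
      congr 1
      funext a
      rw [Fin.snoc_castSucc, ← h1, mul_comm]
      exact Complex.re_add_im _

end AdmissibleDecomposition

end

/-! ### The proposition. -/

theorem mainTheorem5 (n k : ℕ) [NeZero k] (D : AdmissibleDecomposition n k) (ε : Fin k → ℂ)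
    (hε_zero : ε 0 = 0) (hε_inj : Function.Injective ε) (hε_one : ∀ i, ε i ≠ 1) :
    ∃ Ω : D.Ambient → (D.Ambient [⋀^Fin (n + 1)]→ₗ[ℂ] ℂ),
      IsHolomorphicVolumeForm (n + 1) (D.divisorComplement ε) Ω ∧
      (∀ z ∈ D.divisorComplement ε, (∀ j, z (D.xw 0 j) ≠ 0) → Ω z = D.omegaFormula z) ∧
      (∀ (r : ℝ) (δ : Fin n → ℝ), 0 < r → (∀ p, ‖ε p - 1‖ ≠ r) →
        IsEmbeddedTorus (n + 1) (D.torus ε r δ) ∧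
        IsSpecialLagrangian (n + 1) (D.divisorComplement ε) Ω 0 (D.torus ε r δ)) ∧
      (∀ (r : ℝ) (δ : Fin n → ℝ), 0 < r →
        IsSpecialLagrangian (n + 1) (D.divisorComplement ε) Ω 0
          (D.torus ε r δ \ D.singularLocus ε)) := by
  refine ⟨D.volForm ε, D.isHolomorphicVolumeForm_volForm hε_zero hε_inj,
    fun z _ hz => D.volForm_of_ne_zero ε hz, fun r δ hr hrε => ⟨?_, ?_⟩, fun r δ hr =>
    D.isSpecialLagrangian_torus_diff_singularLocus hε_zero hε_inj hr δ⟩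
  · exact D.isEmbeddedTorus_torus hε_zero hr hrε δ
  · rw [← AdmissibleDecomposition.torus_diff_singularLocus hrε δ]
    exact D.isSpecialLagrangian_torus_diff_singularLocus hε_zero hε_inj hr δ
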